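/- Let $\mathbb T=\mathbb R/2\pi\mathbb Z$, let $\lambda\in\mathbb Z$ and $0<\ell<\frac56$, let $f\in H^\ell(\mathbb T^2;\mathbb R)$ and $g\in C^\infty(\mathbb T;\mathbb R)$. For $\nu>0$ let $F_\nu\in C([0,\infty);L^2(\mathbb T^2))\cap L^2_{\rm loc}([0,\infty);\dot H^1(\mathbb T^2))$ be the weak solution of $$\partial_tF_\nu-\big(e^{\nu t\partial_2^2}g\big)(y_2)\,\partial_1F_\nu=\nu\big((\lambda^2+1)\partial_1^2+\partial_2^2\big)F_\nu\ \text{ in }\mathbb R_+\times\mathbb T^2,\qquad F_\nu(0,\cdot)=f,$$ where $e^{s\partial^2}$ is the heat semigroup on $\mathbb T$. Consider, for $x\in\mathbb T^3$, the 2.75D shear flow of the Navier–Stokes equations with viscosity $\nu$ $$u^\nu(t,x)=\big(F_\nu(t,\lambda x_1+x_2,x_3),\,-\lambda F_\nu(t,\lambda x_1+x_2,x_3)-(e^{\nu t\partial_3^2}g)(x_3),\,0\big)$$ and the 2.75D shear flow of the Euler equations $$u^E(t,x)=\big(f(\lambda x_1+x_2+tg(x_3),x_3),\,-\lambda f(\lambda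 x_1+x_2+tg(x_3),x_3)-g(x_3),\,0\big),$$ which have the same initial data. Then the following hold. (1) For all $t\ge0$ and $\nu\in(0,1)$, $$\nu\int_0^t\int_{\mathbb T^3}|\nabla u^\nu|^2\,dx\,ds\le \nu^{\ell}\,C(\lambda,\ell,t,\|g'\|_{L^\infty},\|f\|_{H^\ell}).$$ (2) If moreover $\ell\in[\frac12,\frac56)$, then $u^\nu\to u^E$ in $C([0,T];L^2(\mathbb T^3))$ as $\nu\to0$ for every $T>0$, and for every $\ell'\in[0,\ell)$, $T>0$ and $\nu\in(0,1)$, $$\sup_{t\in[0,T]}\|u^\nu(t,\cdot)-u^E(t,\cdot)\|_{\dot H^{\ell'}}\le \nu^{\frac14\left(1-\frac{\ell'}{\ell}\right)}\,C(\lambda,\ell,\ell',T,\|g\|_{W^{3,\infty}},\|f\|_{H^\ell}).$$ Here $\dot H^0$ is $L^2$. -/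

import Mathlib

open Real Set Filter Topology MeasureTheory
open scoped ENNReal NNReal ContDiff

namespace ShearFlow

instance two_pi_pos_fact : Fact (0 < 2 * π) := ⟨Real.two_pi_pos⟩

/-- The circle `𝕋 = ℝ / 2πℤ`; its `volume` has total mass `2π`. -/
abbrev Circ : Type := AddCircle (2 * π)

/-- The torus `𝕋ⁿ = (ℝ / 2πℤ)ⁿ`, with the product measure. -/
abbrev Torus (n : ℕ) : Type := Fin n → Circ

/-! ### Calculus on the torus -/

/-- A function on `𝕋ⁿ` is smooth when its periodic lift to `ℝⁿ` is `C^∞`. -/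
def Smooth {n : ℕ} (φ : Torus n → ℝ) : Prop :=
  ContDiff ℝ ∞ (fun v : Fin n → ℝ => φ (fun i => (v i : Circ)))

/-- The classical partial derivative `∂ᵢ φ` of a function on `𝕋ⁿ`. -/
noncomputable def pderiv {n : ℕ} (i : Fin n) (φ : Torus n → ℝ) : Torus n → ℝ :=
  fun x => deriv (fun s : ℝ => φ (x + Pi.single i (s : Circ))) 0

/-- `w` is the weak partial derivative `∂ᵢ v` on `𝕋ⁿ`. -/
def IsWeakPDeriv {n : ℕ} (i : Fin n) (v w : Torus n → ℝ) : Prop :=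
  Integrable v volume ∧ Integrable w volume ∧
    ∀ φ : Torus n → ℝ, Smooth φ → ∫ x, v x * pderiv i φ x = - ∫ x, w x * φ x

/-- `∫ |∇v|² dx` for a scalar function on `𝕋ⁿ`, with the weak gradient; it is `∞` when `v` has no
weak gradient or when that gradient is not square integrable. The weak gradient is unique up to
null sets, so the infimum runs over at most one value. -/
noncomputable def gradSq {n : ℕ} (v : Torus n → ℝ) : ℝ≥0∞ :=
  ⨅ (w : Fin n → Torus n → ℝ) (_ : ∀ i, IsWeakPDeriv i v (w i)),
    ∫⁻ x, ENNReal.ofReal (∑ i, (w i x) ^ 2)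

/-- `∫ |∇u|² dx` for a vector field on `𝕋ⁿ`. -/
noncomputable def gradSqVec {n m : ℕ} (u : Torus n → EuclideanSpace ℝ (Fin m)) : ℝ≥0∞ :=
  ∑ j, gradSq (fun x => u x j)

/-! ### Sobolev norms -/

/-- The Fourier coefficient `(2π)⁻ⁿ ∫ v(x) e^{-i k·x} dx`. -/
noncomputable def coeff {n : ℕ} (v : Torus n → ℝ) (k : Fin n → ℤ) : ℂ :=
  ((2 * π : ℝ) ^ n)⁻¹ • ∫ x, (v x : ℂ) * ∏ i, fourier (-(k i)) (x i)

/-- `|k|²` for a frequency `k ∈ ℤⁿ`. -/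
noncomputable def freqSq {n : ℕ} (k : Fin n → ℤ) : ℝ := ∑ i, (k i : ℝ) ^ 2

/-- The inhomogeneous norm `‖v‖_{H^s}`, with values in `[0, ∞]`. -/
noncomputable def sobolevNorm {n : ℕ} (s : ℝ) (v : Torus n → ℝ) : ℝ≥0∞ :=
  (∑' k : Fin n → ℤ,
    ENNReal.ofReal ((2 * π) ^ n * ((1 + freqSq k) ^ s * ‖coeff v k‖ ^ 2))) ^ (1 / 2 : ℝ)

/-- Membership in `H^s(𝕋ⁿ; ℝ)`, `s ≥ 0`. -/
def MemSobolev {n : ℕ} (s : ℝ) (v : Torus n → ℝ) : Prop :=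
  MemLp v 2 volume ∧ sobolevNorm s v < ⊤

/-- The square of the homogeneous norm `‖v‖_{Ḣ^s}`, that is `(2π)ⁿ ∑ |k|^{2s} |v̂(k)|²`. As
`0 ^ 0 = 1`, the case `s = 0` is the full `L²` norm; for `s > 0` the mean does not contribute. -/
noncomputable def homSobolevSq {n : ℕ} (s : ℝ) (v : Torus n → ℝ) : ℝ≥0∞ :=
  ∑' k : Fin n → ℤ, ENNReal.ofReal ((2 * π) ^ n * (freqSq k ^ s * ‖coeff v k‖ ^ 2))

/-- The homogeneous norm `‖u‖_{Ḣ^s}` of a vector field. -/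
noncomputable def homSobolevNormVec {n m : ℕ} (s : ℝ)
    (u : Torus n → EuclideanSpace ℝ (Fin m)) : ℝ≥0∞ :=
  (∑ j, homSobolevSq s (fun x => u x j)) ^ (1 / 2 : ℝ)

/-- `v ∈ C(I; L²(𝕋ⁿ))` for an interval of times `I`. -/
def ContInL2 {n : ℕ} {E : Type*} [NormedAddCommGroup E] (I : Set ℝ) (v : ℝ → Torus n → E) :
    Prop :=
  (∀ t ∈ I, MemLp (v t) 2 volume) ∧
    ∀ t₀ ∈ I, Tendsto (fun t => eLpNorm (v t - v t₀) 2 volume) (𝓝[I] t₀) (𝓝 0)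

/-! ### Functions of one variable -/

/-- A function on `𝕋` is smooth when its periodic lift to `ℝ` is `C^∞`. -/
def SmoothCirc (g : Circ → ℝ) : Prop := ContDiff ℝ ∞ (fun x : ℝ => g (x : Circ))

/-- `‖g^{(j)}‖_{L^∞}`, for a smooth `g` on `𝕋`. -/
noncomputable def supDeriv (j : ℕ) (g : Circ → ℝ) : ℝ :=
  ⨆ x : ℝ, |iteratedDeriv j (fun y : ℝ => g (y : Circ)) x|

/-- `‖g‖_{W^{m,∞}}`, for a smooth `g` on `𝕋`. -/
noncomputable def wInfNorm (m : ℕ) (g : Circ → ℝ) : ℝ :=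
  ∑ j ∈ Finset.range (m + 1), supDeriv j g

/-- The heat semigroup `e^{s ∂²} g` on `𝕋`, `s ≥ 0`: the convolution of `g` with the heat kernel
`(4πs)^{-1/2} e^{-z²/(4s)}`, the centred Gaussian of variance `2s` (a Dirac mass for `s = 0`). -/
noncomputable def heat (s : ℝ) (g : Circ → ℝ) : Circ → ℝ :=
  fun x => ∫ z : ℝ, g (x - (z : Circ)) ∂(ProbabilityTheory.gaussianReal 0 (2 * s).toNNReal)

/-! ### The shear flows -/

/-- `F` is the global weak solution, in `C([0,∞); L²) ∩ L²_loc([0,∞); Ḣ¹)`, of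
`∂ₜ F - (e^{ν t ∂₂²} g)(y₂) ∂₁ F = ν ((lam² + 1) ∂₁² + ∂₂²) F` on `𝕋² × ℝ₊`, `F(0) = f`.
(The variables `y₁, y₂` have the indices `0, 1`.) -/
structure IsProfile (lam : ℤ) (ν : ℝ) (f : Torus 2 → ℝ) (g : Circ → ℝ)
    (F : ℝ → Torus 2 → ℝ) : Prop where
  cont : ContInL2 (Ici 0) F
  dissip : ∀ T : ℝ, 0 < T → ∫⁻ s in Ioc 0 T, homSobolevSq 1 (F s) < ⊤
  init : F 0 =ᵐ[volume] f
  weak : ∀ φ : Torus 2 → ℝ, Smooth φ → ∀ t : ℝ, 0 ≤ t →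
    ∫ y, F t y * φ y = (∫ y, f y * φ y) +
      ∫ s in (0 : ℝ)..t, ∫ y, F s y *
        (ν * (((lam : ℝ) ^ 2 + 1) * pderiv 0 (pderiv 0 φ) y + pderiv 1 (pderiv 1 φ) y)
          - heat (ν * s) g (y 1) * pderiv 0 φ y)

/-- The Navier-Stokes shear flow
`u^ν = (F(t, lam x₁ + x₂, x₃), -lam F(t, lam x₁ + x₂, x₃) - e^{ν t ∂₃²} g(x₃), 0)`. -/
noncomputable def uNS (lam : ℤ) (ν : ℝ) (g : Circ → ℝ) (F : ℝ → Torus 2 → ℝ) (t : ℝ) :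
    Torus 3 → EuclideanSpace ℝ (Fin 3) :=
  fun x => !₂[F t ![lam • x 0 + x 1, x 2],
    -(lam : ℝ) * F t ![lam • x 0 + x 1, x 2] - heat (ν * t) g (x 2), 0]

/-- The Euler shear flow
`u^E = (f(lam x₁ + x₂ + t g(x₃), x₃), -lam f(lam x₁ + x₂ + t g(x₃), x₃) - g(x₃), 0)`. -/
noncomputable def uE (lam : ℤ) (f : Torus 2 → ℝ) (g : Circ → ℝ) (t : ℝ) :
    Torus 3 → EuclideanSpace ℝ (Fin 3) :=
  fun x => !₂[f ![lam • x 0 + x 1 + ((t * g (x 2) : ℝ) : Circ), x 2],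
    -(lam : ℝ) * f ![lam • x 0 + x 1 + ((t * g (x 2) : ℝ) : Circ), x 2] - g (x 2), 0]

end ShearFlow

/-! Expand the profiles in Fourier series. At a fixed first frequency k, what remains is a function
of y₂, the `slice`, and its coordinates a_m solve ∂ₜa = -d a + i k G a. Here G is multiplication by
g with d = 0 for Euler, and multiplication by e^{νt∂²}g with d comparable to νX for Navier–Stokes,
where X = |K|² = k² + m². Since G is symmetric, i k G is skew and the L² norm does not grow
(`IsModeTraj.norm_le`).

Fractional regularity is propagated through the bounded weights sX/(s+X). Commuting such a weight
with G costs only ‖g'‖_∞, uniformly in s and k (`commutator_le`), so the weighted energy, together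
with its dissipation, grows at most like e^{‖g'‖t} (`IsModeTraj.energy`). For 0 < l < 1 the power
X^l is a constant multiple of ∫₀^∞ s^{l-2} sX/(s+X) ds. Integrating in s therefore gives the same
estimate in Ḣ^l (`tsum_rpow_le`, `IsModeFamily.sobolev_energy`). As each weight is bounded, no
regularity beyond L² has to be known beforehand.

Dissipation: take s = 1/ν and A = X/(1+νX), so that X = A + νAX. The first piece is controlled by
the propagated energy of weight A, the second by the dissipation of that energy, and νA ≤ (νX)^l
produces the factor ν^l (`IsModeFamily.dissipation_le`).

Convergence: pair the two profiles F and E with each other. The squared L² distance is bounded by a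
damping term ∑∫ d|F̂||Ê| and a forcing term. In the first, νX|F̂||Ê| = √ν X^{1/2}·(√ν
X^{1/2}|F̂|)·|Ê|, which Young's inequality splits into √ν times the H^{1/2} dissipation of F and the
H^{1/2} energy of E. In the second, ‖e^{νs∂²}g - g‖_∞ ≤ ‖g'‖√(2νs), and the factor |k| is again paid
by half a derivative. So the squared distance is O(√ν), which explains both the exponent 1/4 and the
threshold l ≥ 1/2 (`IsProfile.wSum_sub_le`). Interpolation with the bound in Ḣ^l gives the other
norms (`IsProfile.wSum_rpow_sub_le`).

The flows on 𝕋³ are profiles composed with the homomorphism (lam x₁ + x₂, x₃), which sends the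
frequency (k, m) to (lam k, k, m), plus a function of x₃ alone. Their norms are thus bounded by
those of the profiles and of the heat flow of g (`sum_homSobolevSq_le`). -/

namespace ShearFlow

open ComplexConjugate

/-! ### Exponentials on the torus -/

/-- The exponential `x ↦ e^{i k·x}` on `𝕋ⁿ`. -/
noncomputable def expo {n : ℕ} (k : Fin n → ℤ) : C(Torus n, ℂ) where
  toFun x := ∏ i, fourier (k i) (x i)
  continuous_toFun := by fun_prop

lemma expo_apply {n : ℕ} (k : Fin n → ℤ) (x : Torus n) :
    expo k x = ∏ i, fourier (k i) (x i) := rfl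

lemma expo_zero {n : ℕ} (x : Torus n) : expo 0 x = 1 := by simp [expo_apply]

lemma expo_neg {n : ℕ} (k : Fin n → ℤ) (x : Torus n) : expo (-k) x = conj (expo k x) := by
  simp only [expo_apply, Pi.neg_apply, fourier_neg, map_prod]

lemma expo_add {n : ℕ} (k l : Fin n → ℤ) (x : Torus n) :
    expo (k + l) x = expo k x * expo l x := by
  simp only [expo_apply, Pi.add_apply, fourier_add, Finset.prod_mul_distrib]

lemma fourier_add_arg (k : ℤ) (x y : Circ) :
    fourier k (x + y) = fourier k x * fourier k y := by
  simp only [fourier_apply, smul_add, AddCircle.toCircle_add, Circle.coe_mul]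

lemma expo_add_arg {n : ℕ} (k : Fin n → ℤ) (x z : Torus n) :
    expo k (x + z) = expo k x * expo k z := by
  simp only [expo_apply, Pi.add_apply, fourier_add_arg, Finset.prod_mul_distrib]

lemma norm_expo {n : ℕ} (k : Fin n → ℤ) (x : Torus n) : ‖expo k x‖ = 1 := by
  rw [expo_apply, norm_prod]
  exact Finset.prod_eq_one fun i _ => by rw [fourier_apply, Circle.norm_coe]

lemma expo_single {n : ℕ} (k : Fin n → ℤ) (i : Fin n) (z : Circ) :
    expo k (Pi.single i z) = fourier (k i) z := by
  rw [expo_apply, Finset.prod_eq_single i]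
  · simp
  · intro j _ hj
    simp [Pi.single_eq_of_ne hj]
  · simp

lemma exists_fourier_ne_one {k : ℤ} (hk : k ≠ 0) : ∃ z : Circ, fourier k z ≠ 1 := by
  -- At π/k the exponential takes the value e^{iπ} = -1.
  refine ⟨((π / k : ℝ) : Circ), ?_⟩
  rw [fourier_coe_apply]
  have : 2 * (π : ℂ) * Complex.I * k * ((π / k : ℝ) : ℂ) / ((2 * π : ℝ) : ℂ) = π * Complex.I := by
    have h1 : (k : ℂ) ≠ 0 := by exact_mod_cast hk
    have h2 : (π : ℂ) ≠ 0 := by exact_mod_cast Real.pi_ne_zero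
    push_cast
    field_simp
  rw [this, Complex.exp_pi_mul_I]
  norm_num

lemma torus_volume_univ (n : ℕ) : (volume : Measure (Torus n)) univ = ENNReal.ofReal ((2 * π) ^ n) := by
  rw [volume_pi, Measure.pi_univ]
  simp [AddCircle.measure_univ, ENNReal.ofReal_pow Real.two_pi_pos.le]

lemma torus_volume_real_univ (n : ℕ) : (volume : Measure (Torus n)).real univ = (2 * π) ^ n := by
  rw [Measure.real, torus_volume_univ, ENNReal.toReal_ofReal (by positivity)]

instance (n : ℕ) : (volume : Measure (Torus n)).IsAddHaarMeasure := by
  rw [volume_pi]; infer_instance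

/-- A function that is multiplied by a constant `c ≠ 1` under a translation has integral zero. -/
lemma integral_eq_zero_of_translate {n : ℕ} {v : Torus n → ℂ} {z : Torus n} {c : ℂ} (hc : c ≠ 1)
    (h : ∀ x, v (x + z) = c * v x) : ∫ x, v x = 0 := by
  have h1 : ∫ x, v x = c * ∫ x, v x := by
    rw [← integral_const_mul, ← integral_add_right_eq_self v z]
    exact integral_congr_ae (Eventually.of_forall h)
  have h2 : (1 - c) * ∫ x, v x = 0 := by linear_combination h1
  exact (mul_eq_zero.mp h2).resolve_left (sub_ne_zero.mpr hc.symm)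

lemma integral_expo {n : ℕ} (k : Fin n → ℤ) :
    ∫ x, expo k x = if k = 0 then ((2 * π : ℝ) ^ n : ℂ) else 0 := by
  split_ifs with h
  · subst h
    simp only [expo_zero, integral_const, torus_volume_real_univ]
    simp
  · obtain ⟨i, hi⟩ := Function.ne_iff.mp h
    obtain ⟨z, hz⟩ := exists_fourier_ne_one hi
    refine integral_eq_zero_of_translate (z := Pi.single i z) hz fun x => ?_
    rw [expo_add_arg, expo_single, mul_comm]

/-- The linear span of the exponentials is dense in `C(𝕋ⁿ)`. -/
theorem span_expo_closure (n : ℕ) :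
    (Submodule.span ℂ (range (expo (n := n)))).topologicalClosure = ⊤ := by
  classical
  let A : StarSubalgebra ℂ C(Torus n, ℂ) :=
    { toSubalgebra := Algebra.adjoin ℂ (range expo)
      star_mem' := by
        change Algebra.adjoin ℂ (range expo) ≤ star (Algebra.adjoin ℂ (range expo))
        refine Algebra.adjoin_le ?_
        rintro _ ⟨k, rfl⟩
        refine Algebra.subset_adjoin ⟨-k, ?_⟩
        ext1 x
        simp only [expo_neg, starRingEnd_apply, ContinuousMap.star_apply] }
  -- Exponentials are closed under multiplication, so the algebra they generate is merely their
  -- span.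
  have hA : A.toSubalgebra.toSubmodule = Submodule.span ℂ (range expo) := by
    apply Algebra.adjoin_eq_span_of_subset
    refine .trans (fun x ↦ Submonoid.closure_induction (fun _ ↦ id) ⟨0, ?_⟩ ?_)
      Submodule.subset_span
    · ext z
      simp [expo_zero]
    · rintro _ _ _ _ ⟨m, rfl⟩ ⟨n, rfl⟩
      refine ⟨m + n, ?_⟩
      ext z
      simp [expo_add]
  -- Two distinct points differ in some coordinate, and the first exponential of that coordinate is
  -- injective on the circle.
  have hsep : A.SeparatesPoints := by
    intro x y hxy
    rw [Ne, funext_iff, not_forall] at hxy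
    obtain ⟨i, hi⟩ := hxy
    refine ⟨_, ⟨expo (Pi.single i 1), Algebra.subset_adjoin ⟨Pi.single i 1, rfl⟩, rfl⟩, ?_⟩
    have key : ∀ z : Torus n, expo (Pi.single i 1) z = fourier 1 (z i) := by
      intro z
      rw [expo_apply, Finset.prod_eq_single i]
      · simp
      · intro j _ hj
        simp [Pi.single_eq_of_ne hj]
      · simp
    dsimp only
    rw [key, key, fourier_one, fourier_one, Ne, Circle.coe_inj]
    contrapose hi
    exact AddCircle.injective_toCircle Real.two_pi_pos.ne' hi
  rw [← hA]
  exact congr_arg (Subalgebra.toSubmodule <| StarSubalgebra.toSubalgebra ·)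
    (ContinuousMap.starSubalgebra_topologicalClosure_eq_top_of_separatesPoints A hsep)

/-! ### The Hilbert basis of exponentials, Parseval and Riesz–Fischer on 𝕋ⁿ. -/

/-- `(2π)ⁿ` as a positive real. -/
lemma two_pi_pow_pos (n : ℕ) : 0 < (2 * π) ^ n := by positivity

/-- The normalised exponentials in `L²(𝕋ⁿ)`. -/
noncomputable def expoLp {n : ℕ} (k : Fin n → ℤ) : Lp ℂ 2 (volume : Measure (Torus n)) :=
  (((√((2 * π) ^ n))⁻¹ : ℝ) : ℂ) • ContinuousMap.toLp (E := ℂ) 2 volume ℂ (expo k)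

lemma orthonormal_expoLp (n : ℕ) : Orthonormal ℂ (expoLp (n := n)) := by
  rw [orthonormal_iff_ite]
  intro k l
  have hs : √((2 * π) ^ n) * √((2 * π) ^ n) = (2 * π) ^ n :=
    Real.mul_self_sqrt (two_pi_pow_pos n).le
  have hs0 : √((2 * π) ^ n) ≠ 0 := (Real.sqrt_pos.mpr (two_pi_pow_pos n)).ne'
  have h1 : ∀ x, expo l x * conj (expo k x) = expo (l - k) x := by
    intro x
    rw [sub_eq_add_neg, expo_add, expo_neg]
  simp only [expoLp, inner_smul_left, inner_smul_right, ContinuousMap.inner_toLp, h1,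
    integral_expo, Complex.conj_ofReal, sub_eq_zero, eq_comm (a := l)]
  split_ifs
  · rw [← mul_assoc, ← Complex.ofReal_mul, ← Complex.ofReal_pow, ← Complex.ofReal_mul]
    generalize √((2 * π) ^ n) = q at hs hs0 ⊢
    rw [← hs]
    norm_cast
    field_simp
  · simp

lemma span_expoLp_closure (n : ℕ) :
    (⊤ : Submodule ℂ (Lp ℂ 2 (volume : Measure (Torus n)))) ≤
      (Submodule.span ℂ (range (expoLp (n := n)))).topologicalClosure := by
  have h : (Submodule.span ℂ (range fun k : Fin n → ℤ =>
      ContinuousMap.toLp (E := ℂ) 2 (volume : Measure (Torus n)) ℂ (expo k))).topologicalClosure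
        = ⊤ := by
    simpa only [Submodule.map_span, ContinuousLinearMap.coe_coe, ← range_comp,
      Function.comp_def] using
      (ContinuousMap.toLp_denseRange (p := 2) ℂ (volume : Measure (Torus n)) ℂ
        ENNReal.ofNat_ne_top).topologicalClosure_map_submodule (span_expo_closure n)
  rw [← h]
  refine Submodule.topologicalClosure_mono (Submodule.span_le.mpr ?_)
  rintro _ ⟨k, rfl⟩
  have hs0 : ((√((2 * π) ^ n) : ℝ) : ℂ) ≠ 0 := by
    exact_mod_cast (Real.sqrt_pos.mpr (two_pi_pow_pos n)).ne'
  have : ContinuousMap.toLp (E := ℂ) 2 (volume : Measure (Torus n)) ℂ (expo k) =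
      ((√((2 * π) ^ n) : ℝ) : ℂ) • expoLp k := by
    rw [expoLp, smul_smul, Complex.ofReal_inv, mul_inv_cancel₀ hs0, one_smul]
  simp only [SetLike.mem_coe, this]
  exact Submodule.smul_mem _ _ (Submodule.subset_span ⟨k, rfl⟩)

/-- The Hilbert basis of normalised exponentials. -/
noncomputable def expoBasis (n : ℕ) :
    HilbertBasis (Fin n → ℤ) ℂ (Lp ℂ 2 (volume : Measure (Torus n))) :=
  HilbertBasis.mk (orthonormal_expoLp n) (span_expoLp_closure n)

/-- Fourier coefficients of complex functions. -/
noncomputable def ccoeff {n : ℕ} (v : Torus n → ℂ) (k : Fin n → ℤ) : ℂ :=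
  ((2 * π : ℝ) ^ n)⁻¹ • ∫ x, v x * expo (-k) x

lemma coeff_eq_ccoeff {n : ℕ} (v : Torus n → ℝ) (k : Fin n → ℤ) :
    coeff v k = ccoeff (fun x => (v x : ℂ)) k := rfl

/-- The basis vector carries (2π)^{-n/2} while `ccoeff` carries (2π)^{-n}; the quotient of the two
normalisations is the square root that appears. -/
lemma expoBasis_repr {n : ℕ} {v : Torus n → ℂ} (hv : MemLp v 2 volume) (k : Fin n → ℤ) :
    (expoBasis n).repr (hv.toLp v) k = (√((2 * π) ^ n) : ℝ) * ccoeff v k := by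
  have hs : √((2 * π) ^ n) * √((2 * π) ^ n) = (2 * π) ^ n :=
    Real.mul_self_sqrt (two_pi_pow_pos n).le
  have hs0 : √((2 * π) ^ n) ≠ 0 := (Real.sqrt_pos.mpr (two_pi_pow_pos n)).ne'
  rw [HilbertBasis.repr_apply_apply, expoBasis, HilbertBasis.coe_mk, expoLp, inner_smul_left,
    L2.inner_def, ccoeff]
  have h : ∫ x, inner ℂ ((ContinuousMap.toLp (E := ℂ) 2 volume ℂ (expo k)) x) (hv.toLp v x) =
      ∫ x, v x * expo (-k) x := by
    refine integral_congr_ae ?_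
    filter_upwards [ContinuousMap.coeFn_toLp (p := 2) (𝕜 := ℂ) volume (expo k), hv.coeFn_toLp]
      with x h1 h2
    rw [h1, h2, expo_neg, RCLike.inner_apply]
  rw [h, Complex.conj_ofReal, Complex.real_smul, ← mul_assoc]
  congr 1
  rw [← Complex.ofReal_mul]
  generalize √((2 * π) ^ n) = q at hs hs0 ⊢
  rw [← hs]
  congr 1
  field_simp

/-- Parseval's identity for the inner product. -/
theorem hasSum_ccoeff_mul {n : ℕ} {u v : Torus n → ℂ} (hu : MemLp u 2 volume)
    (hv : MemLp v 2 volume) :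
    HasSum (fun k => ((2 * π) ^ n : ℝ) * (conj (ccoeff u k) * ccoeff v k))
      (∫ x, conj (u x) * v x) := by
  have h := (expoBasis n).hasSum_inner_mul_inner (hu.toLp u) (hv.toLp v)
  have hs : √((2 * π) ^ n) * √((2 * π) ^ n) = (2 * π) ^ n :=
    Real.mul_self_sqrt (two_pi_pow_pos n).le
  have h2 : inner ℂ (hu.toLp u) (hv.toLp v) = ∫ x, conj (u x) * v x := by
    rw [L2.inner_def]
    refine integral_congr_ae ?_
    filter_upwards [hu.coeFn_toLp, hv.coeFn_toLp] with x h1 h2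
    rw [h1, h2, RCLike.inner_apply, mul_comm]
  rw [h2] at h
  have e : (fun k => inner ℂ (hu.toLp u) (expoBasis n k) * inner ℂ (expoBasis n k) (hv.toLp v)) =
      fun k => (((2 * π) ^ n : ℝ) : ℂ) * (conj (ccoeff u k) * ccoeff v k) := ?_
  · rwa [e] at h
  funext k
  rw [← inner_conj_symm, ← HilbertBasis.repr_apply_apply, ← HilbertBasis.repr_apply_apply,
    expoBasis_repr, expoBasis_repr, map_mul, Complex.conj_ofReal]
  have hs' : ((√((2 * π) ^ n) : ℝ) : ℂ) * (√((2 * π) ^ n) : ℝ) = ((2 * π) ^ n : ℝ) := by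
    rw [← Complex.ofReal_mul, hs]
  linear_combination (conj (ccoeff u k) * ccoeff v k) * hs'

/-- Parseval's identity. -/
theorem hasSum_ccoeff_sq {n : ℕ} {v : Torus n → ℂ} (hv : MemLp v 2 volume) :
    HasSum (fun k => (2 * π) ^ n * ‖ccoeff v k‖ ^ 2) (∫ x, ‖v x‖ ^ 2) := by
  have h := hasSum_ccoeff_mul hv hv
  rw [← Complex.hasSum_ofReal]
  convert h using 2 with k
  · rw [Complex.conj_mul']; push_cast; rfl
  · rw [← integral_complex_ofReal]
    congr 1; ext x
    rw [Complex.conj_mul']; push_cast; rfl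

lemma lintegral_sq_eq_tsum {n : ℕ} {v : Torus n → ℂ} (hv : MemLp v 2 volume) :
    ∫⁻ x, ENNReal.ofReal (‖v x‖ ^ 2) =
      ∑' k, ENNReal.ofReal ((2 * π) ^ n * ‖ccoeff v k‖ ^ 2) := by
  rw [← ofReal_integral_eq_lintegral_ofReal, ← (hasSum_ccoeff_sq hv).tsum_eq,
    ENNReal.ofReal_tsum_of_nonneg (fun _ => by positivity) (hasSum_ccoeff_sq hv).summable]
  · exact hv.integrable_norm_pow (by norm_num)
  · exact Eventually.of_forall fun x => by positivity

/-- Riesz–Fischer: square summable families are Fourier coefficients of `L²` functions. -/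
theorem exists_memLp_ccoeff {n : ℕ} {c : (Fin n → ℤ) → ℂ} (hc : Summable fun k => ‖c k‖ ^ 2) :
    ∃ v : Torus n → ℂ, MemLp v 2 volume ∧ ∀ k, ccoeff v k = c k := by
  have hs0 : ((√((2 * π) ^ n) : ℝ) : ℂ) ≠ 0 := by
    exact_mod_cast (Real.sqrt_pos.mpr (two_pi_pow_pos n)).ne'
  have hm : Memℓp (fun k => ((√((2 * π) ^ n) : ℝ) : ℂ) * c k) 2 := by
    apply memℓp_gen
    simp only [ENNReal.toReal_ofNat, norm_mul, Real.rpow_ofNat, mul_pow]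
    exact hc.mul_left _
  let V := (expoBasis n).repr.symm ⟨_, hm⟩
  refine ⟨V, Lp.memLp V, fun k => ?_⟩
  have h := expoBasis_repr (Lp.memLp V) k
  rw [Lp.toLp_coeFn, LinearIsometryEquiv.apply_symm_apply] at h
  exact (mul_left_cancel₀ hs0 h).symm

end ShearFlow

namespace ShearFlow

open ComplexConjugate

/-! ### Trajectories in a Hilbert space with a basis -/

section Core

variable {H : Type*} [NormedAddCommGroup H] [InnerProductSpace ℂ H] {ι : Type*}

lemma hasSum_repr_sq (e : HilbertBasis ι ℂ H) (x : H) :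
    HasSum (fun m => ‖e.repr x m‖ ^ 2) (‖x‖ ^ 2) := by
  have h := lp.hasSum_norm (p := 2) (by norm_num) (e.repr x)
  simpa using h

lemma hasSum_repr_inner (e : HilbertBasis ι ℂ H) (x y : H) :
    HasSum (fun m => conj (e.repr x m) * e.repr y m) (inner ℂ x y) := by
  have h := lp.hasSum_inner (𝕜 := ℂ) (e.repr x) (e.repr y)
  rw [LinearIsometryEquiv.inner_map_map] at h
  simpa [RCLike.inner_apply, mul_comm] using h

lemma continuous_repr (e : HilbertBasis ι ℂ H) (m : ι) : Continuous fun x : H => e.repr x m := by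
  have h : (fun x : H => e.repr x m) = fun x => inner ℂ (e m) x := by
    funext x; rw [HilbertBasis.repr_apply_apply]
  rw [h]
  exact continuous_const.inner continuous_id

lemma exists_repr_eq (e : HilbertBasis ι ℂ H) {c : ι → ℂ} (hc : Summable fun m => ‖c m‖ ^ 2) :
    ∃ x : H, ∀ m, e.repr x m = c m := by
  have hm : Memℓp c 2 := by
    apply memℓp_gen
    simpa using hc
  exact ⟨e.repr.symm ⟨c, hm⟩, fun m => by rw [LinearIsometryEquiv.apply_symm_apply]⟩

lemma repr_ext (e : HilbertBasis ι ℂ H) {x y : H} (h : ∀ m, e.repr x m = e.repr y m) : x = y :=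
  e.repr.injective (by ext m; exact h m)

/-- Bounded entries keep the coordinates square summable, so Riesz–Fischer yields the image vector,
and uniqueness of coordinates makes the choice linear. -/
lemma exists_diag (e : HilbertBasis ι ℂ H) (w : ι → ℝ) {B : ℝ} (hB : ∀ m, |w m| ≤ B) :
    ∃ W : H →L[ℂ] H, ∀ x m, e.repr (W x) m = w m * e.repr x m := by
  have hle : ∀ (x : H) (m : ι), ‖(w m : ℂ) * e.repr x m‖ ^ 2 ≤ B ^ 2 * ‖e.repr x m‖ ^ 2 := by
    intro x m
    rw [norm_mul, mul_pow, Complex.norm_real, Real.norm_eq_abs]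
    gcongr
    exact hB m
  have hex : ∀ x : H, ∃ y : H, ∀ m, e.repr y m = w m * e.repr x m := fun x =>
    exists_repr_eq e <| Summable.of_nonneg_of_le (fun m => by positivity) (hle x)
      ((hasSum_repr_sq e x).summable.mul_left _)
  choose W hW using hex
  let L : H →ₗ[ℂ] H :=
    { toFun := W
      map_add' := fun x y => repr_ext e fun m => by
        simp only [hW, map_add, lp.coeFn_add, Pi.add_apply]; ring
      map_smul' := fun c x => repr_ext e fun m => by
        simp only [hW, map_smul, lp.coeFn_smul, Pi.smul_apply, smul_eq_mul, RingHom.id_apply]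
        ring }
  refine ⟨L.mkContinuous |B| fun x => ?_, hW⟩
  refine abs_le_of_sq_le_sq' ?_ (by positivity) |>.2
  have h1 := hasSum_repr_sq e (W x)
  have h2 := (hasSum_repr_sq e x).mul_left (B ^ 2)
  rw [mul_pow, sq_abs]
  refine hasSum_le (fun m => ?_) h1 h2
  rw [hW]
  exact hle x m

/-- The bounded operator which is diagonal in the basis `e` with bounded real entries `w`. -/
noncomputable def diag (e : HilbertBasis ι ℂ H) (w : ι → ℝ) {B : ℝ} (hB : ∀ m, |w m| ≤ B) :
    H →L[ℂ] H := (exists_diag e w hB).choose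

lemma repr_diag (e : HilbertBasis ι ℂ H) (w : ι → ℝ) {B : ℝ} (hB : ∀ m, |w m| ≤ B) (x : H)
    (m : ι) : e.repr (diag e w hB x) m = w m * e.repr x m :=
  (exists_diag e w hB).choose_spec x m

lemma inner_diag_comm (e : HilbertBasis ι ℂ H) (w : ι → ℝ) {B : ℝ} (hB : ∀ m, |w m| ≤ B)
    (x y : H) : inner ℂ (diag e w hB x) y = inner ℂ x (diag e w hB y) := by
  refine (hasSum_repr_inner e _ _).unique ?_
  have h := hasSum_repr_inner e x (diag e w hB y)
  simp only [repr_diag, map_mul, Complex.conj_ofReal] at h ⊢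
  convert! h using 2 with m
  ring

lemma hasSum_inner_diag_self (e : HilbertBasis ι ℂ H) (w : ι → ℝ) {B : ℝ} (hB : ∀ m, |w m| ≤ B)
    (x : H) : HasSum (fun m => w m * ‖e.repr x m‖ ^ 2) (inner ℂ (diag e w hB x) x).re := by
  have h := Complex.hasSum_re (hasSum_repr_inner e (diag e w hB x) x)
  convert! h using 2 with m
  rw [repr_diag, map_mul, Complex.conj_ofReal, mul_assoc, Complex.conj_mul', ← Complex.ofReal_pow,
    ← Complex.ofReal_mul, Complex.ofReal_re]

/-- `a` solves `∂ₜ aₘ = -dₘ aₘ + i κ (T(t) a)ₘ` for every coordinate `m`. -/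
structure IsModeTraj (e : HilbertBasis ι ℂ H) (d : ι → ℝ) (κ : ℝ) (T : ℝ → H →L[ℂ] H)
    (a : ℝ → H) : Prop where
  cont : ContinuousOn a (Ici 0)
  contT : ContinuousOn (fun s => T s (a s)) (Ici 0)
  eq : ∀ m, ∀ t : ℝ, 0 ≤ t → e.repr (a t) m = e.repr (a 0) m +
    ∫ s in (0 : ℝ)..t, (-(d m : ℂ) * e.repr (a s) m + Complex.I * κ * e.repr (T s (a s)) m)

variable {e : HilbertBasis ι ℂ H} {d d₁ d₂ : ι → ℝ} {κ : ℝ} {T T₁ T₂ : ℝ → H →L[ℂ] H}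
  {a b : ℝ → H}

lemma IsModeTraj.continuousOn_coord (ha : IsModeTraj e d κ T a) (m : ι) :
    ContinuousOn (fun t => e.repr (a t) m) (Ici 0) :=
  (continuous_repr e m).comp_continuousOn ha.cont

lemma IsModeTraj.continuousOn_coordT (ha : IsModeTraj e d κ T a) (m : ι) :
    ContinuousOn (fun t => e.repr (T t (a t)) m) (Ici 0) :=
  (continuous_repr e m).comp_continuousOn ha.contT

/-- Continuity is known on `Ici 0` only, hence two-sided derivatives at positive times; the
fundamental theorem of calculus on [0, t] asks for no more. -/
lemma IsModeTraj.hasDerivAt (ha : IsModeTraj e d κ T a) (m : ι) {t : ℝ} (ht : 0 < t) :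
    HasDerivAt (fun t => e.repr (a t) m)
      (-(d m : ℂ) * e.repr (a t) m + Complex.I * κ * e.repr (T t (a t)) m) t := by
  have hc : ContinuousOn (fun s => -(d m : ℂ) * e.repr (a s) m +
      Complex.I * κ * e.repr (T s (a s)) m) (Ici 0) :=
    (continuousOn_const.mul (ha.continuousOn_coord m)).add
      (continuousOn_const.mul (ha.continuousOn_coordT m))
  have h1 : HasDerivAt (fun t => e.repr (a 0) m +
      ∫ s in (0 : ℝ)..t, (-(d m : ℂ) * e.repr (a s) m + Complex.I * κ * e.repr (T s (a s)) m))
      (-(d m : ℂ) * e.repr (a t) m + Complex.I * κ * e.repr (T t (a t)) m) t := by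
    refine HasDerivAt.const_add _ ?_
    refine intervalIntegral.integral_hasDerivAt_right ?_ ?_ ?_
    · refine (hc.mono ?_).intervalIntegrable
      rw [uIcc_of_le ht.le]
      exact Icc_subset_Ici_self
    · exact (hc.mono Ioi_subset_Ici_self).stronglyMeasurableAtFilter isOpen_Ioi _ ht
    · exact hc.continuousAt (Ici_mem_nhds ht)
  refine h1.congr_of_eventuallyEq ?_
  filter_upwards [Ioi_mem_nhds ht] with s hs
  exact ha.eq m s hs.le

lemma intervalIntegrable_of_continuousOn_Ici {E : Type*} [NormedAddCommGroup E] {f : ℝ → E}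
    (hf : ContinuousOn f (Ici 0)) {t : ℝ} (ht : 0 ≤ t) :
    IntervalIntegrable f volume 0 t := by
  refine (hf.mono ?_).intervalIntegrable
  rw [uIcc_of_le ht]
  exact Icc_subset_Ici_self

/-- Product rule for conj(aₘ) bₘ, integrated in time. The damping is kept apart on the left because
it is the only part that is unbounded in m. -/
lemma IsModeTraj.cross_coord (ha : IsModeTraj e d₁ κ T₁ a) (hb : IsModeTraj e d₂ κ T₂ b) (m : ι)
    {t : ℝ} (ht : 0 ≤ t) :
    ∫ s in (0 : ℝ)..t, ((d₁ m + d₂ m : ℝ) : ℂ) * (conj (e.repr (a s) m) * e.repr (b s) m) =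
      conj (e.repr (a 0) m) * e.repr (b 0) m - conj (e.repr (a t) m) * e.repr (b t) m +
      ∫ s in (0 : ℝ)..t, (conj (Complex.I * κ * e.repr (T₁ s (a s)) m) * e.repr (b s) m +
        conj (e.repr (a s) m) * (Complex.I * κ * e.repr (T₂ s (b s)) m)) := by
  have ca := ha.continuousOn_coord m
  have cb := hb.continuousOn_coord m
  have cTa := ha.continuousOn_coordT m
  have cTb := hb.continuousOn_coordT m
  have cca : ContinuousOn (fun s => conj (e.repr (a s) m)) (Ici 0) :=
    Complex.continuous_conj.comp_continuousOn ca
  have c1 : ContinuousOn (fun s => ((d₁ m + d₂ m : ℝ) : ℂ) *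
      (conj (e.repr (a s) m) * e.repr (b s) m)) (Ici 0) :=
    continuousOn_const.mul (cca.mul cb)
  have c2 : ContinuousOn (fun s => conj (Complex.I * κ * e.repr (T₁ s (a s)) m) * e.repr (b s) m +
        conj (e.repr (a s) m) * (Complex.I * κ * e.repr (T₂ s (b s)) m)) (Ici 0) :=
    ((Complex.continuous_conj.comp_continuousOn (continuousOn_const.mul cTa)).mul cb).add
      (cca.mul (continuousOn_const.mul cTb))
  have hF := intervalIntegral.integral_eq_sub_of_hasDerivAt_of_le ht
    (f := fun s => conj (e.repr (a s) m) * e.repr (b s) m)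
    (f' := fun s => (conj (Complex.I * κ * e.repr (T₁ s (a s)) m) * e.repr (b s) m +
        conj (e.repr (a s) m) * (Complex.I * κ * e.repr (T₂ s (b s)) m)) -
        ((d₁ m + d₂ m : ℝ) : ℂ) * (conj (e.repr (a s) m) * e.repr (b s) m))
    ((cca.mul cb).mono Icc_subset_Ici_self) ?_
    (intervalIntegrable_of_continuousOn_Ici (c2.sub c1) ht)
  · rw [intervalIntegral.integral_sub (intervalIntegrable_of_continuousOn_Ici c2 ht)
      (intervalIntegrable_of_continuousOn_Ici c1 ht)] at hF
    linear_combination -hF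
  · intro s hs
    have h1 := (ha.hasDerivAt m hs.1).star
    have h2 := h1.mul (hb.hasDerivAt m hs.1)
    convert! h2 using 1
    simp only [← starRingEnd_apply, map_add, map_mul, map_neg, Complex.conj_ofReal]
    push_cast
    ring

/-- Summing the coordinate identities with bounded weights. The right side converges because the
operators are bounded on H, and this forces the damping series on the left to converge although `d₁`
and `d₂` are unbounded. Taking b = a gives the energy balance; weight 1 and two different
trajectories give the comparison. -/
lemma IsModeTraj.cross_hasSum [Countable ι] (ha : IsModeTraj e d₁ κ T₁ a)
    (hb : IsModeTraj e d₂ κ T₂ b) (w : ι → ℝ) {B : ℝ} (hB : ∀ m, |w m| ≤ B) {t : ℝ} (ht : 0 ≤ t) :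
    HasSum (fun m => (w m : ℂ) *
        ∫ s in (0 : ℝ)..t, ((d₁ m + d₂ m : ℝ) : ℂ) * (conj (e.repr (a s) m) * e.repr (b s) m))
      (inner ℂ (diag e w hB (a 0)) (b 0) - inner ℂ (diag e w hB (a t)) (b t) +
        ∫ s in (0 : ℝ)..t, (inner ℂ (diag e w hB ((Complex.I * κ) • T₁ s (a s))) (b s) +
          inner ℂ (diag e w hB (a s)) ((Complex.I * κ) • T₂ s (b s)))) := by
  have hinner : ∀ x y : H, HasSum (fun m => (w m : ℂ) * (conj (e.repr x m) * e.repr y m))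
      (inner ℂ (diag e w hB x) y) := by
    intro x y
    have h := hasSum_repr_inner e (diag e w hB x) y
    simpa only [repr_diag, map_mul, Complex.conj_ofReal, mul_assoc] using h
  simp only [ha.cross_coord hb _ ht, mul_add, mul_sub]
  refine ((hinner _ _).sub (hinner _ _)).add ?_
  simp only [← intervalIntegral.integral_const_mul]
  have hB0 : ∀ _ : ι, 0 ≤ B := fun m => (abs_nonneg _).trans (hB m)
  -- The majorant comes from xy ≤ x² + y²; by Parseval it sums to a continuous function of time.
  have hbd : ∀ s, HasSum (fun m => B * |κ| * (‖e.repr (T₁ s (a s)) m‖ ^ 2 + ‖e.repr (b s) m‖ ^ 2 +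
      ‖e.repr (a s) m‖ ^ 2 + ‖e.repr (T₂ s (b s)) m‖ ^ 2))
      (B * |κ| * (‖T₁ s (a s)‖ ^ 2 + ‖b s‖ ^ 2 + ‖a s‖ ^ 2 + ‖T₂ s (b s)‖ ^ 2)) := fun s =>
    ((((hasSum_repr_sq e _).add (hasSum_repr_sq e _)).add (hasSum_repr_sq e _)).add
      (hasSum_repr_sq e _)).mul_left _
  refine intervalIntegral.hasSum_integral_of_dominated_convergence
    (fun m s => B * |κ| * (‖e.repr (T₁ s (a s)) m‖ ^ 2 + ‖e.repr (b s) m‖ ^ 2 +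
      ‖e.repr (a s) m‖ ^ 2 + ‖e.repr (T₂ s (b s)) m‖ ^ 2)) ?_ ?_ ?_ ?_ ?_
  · intro m
    have ca := ha.continuousOn_coord m
    have cb := hb.continuousOn_coord m
    have cTa := ha.continuousOn_coordT m
    have cTb := hb.continuousOn_coordT m
    have c2 : ContinuousOn (fun s => (w m : ℂ) *
        (conj (Complex.I * κ * e.repr (T₁ s (a s)) m) * e.repr (b s) m +
        conj (e.repr (a s) m) * (Complex.I * κ * e.repr (T₂ s (b s)) m))) (Ici 0) :=
      continuousOn_const.mul
        (((Complex.continuous_conj.comp_continuousOn (continuousOn_const.mul cTa)).mul cb).add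
        ((Complex.continuous_conj.comp_continuousOn ca).mul (continuousOn_const.mul cTb)))
    rw [uIoc_of_le ht]
    exact (c2.mono fun s hs => hs.1.le).aestronglyMeasurable measurableSet_Ioc
  · intro m
    refine Eventually.of_forall fun s _ => ?_
    rw [norm_mul, Complex.norm_real, Real.norm_eq_abs, mul_assoc B]
    refine mul_le_mul (hB m) ?_ (norm_nonneg _) (hB0 m)
    refine (norm_add_le _ _).trans ?_
    simp only [norm_mul, RCLike.norm_conj, Complex.norm_I, one_mul, Complex.norm_real,
      Real.norm_eq_abs]
    have h1 := two_mul_le_add_sq ‖e.repr (T₁ s (a s)) m‖ ‖e.repr (b s) m‖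
    have h2 := two_mul_le_add_sq ‖e.repr (a s) m‖ ‖e.repr (T₂ s (b s)) m‖
    have h3 : ‖e.repr (T₁ s (a s)) m‖ * ‖e.repr (b s) m‖ + ‖e.repr (a s) m‖ *
        ‖e.repr (T₂ s (b s)) m‖ ≤ ‖e.repr (T₁ s (a s)) m‖ ^ 2 + ‖e.repr (b s) m‖ ^ 2 +
        ‖e.repr (a s) m‖ ^ 2 + ‖e.repr (T₂ s (b s)) m‖ ^ 2 := by
      nlinarith [norm_nonneg (e.repr (T₁ s (a s)) m), norm_nonneg (e.repr (b s) m),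
        norm_nonneg (e.repr (a s) m), norm_nonneg (e.repr (T₂ s (b s)) m),
        mul_nonneg (norm_nonneg (e.repr (T₁ s (a s)) m)) (norm_nonneg (e.repr (b s) m)),
        mul_nonneg (norm_nonneg (e.repr (a s) m)) (norm_nonneg (e.repr (T₂ s (b s)) m))]
    calc _ = |κ| * (‖e.repr (T₁ s (a s)) m‖ * ‖e.repr (b s) m‖ + ‖e.repr (a s) m‖ *
        ‖e.repr (T₂ s (b s)) m‖) := by ring
      _ ≤ _ := mul_le_mul_of_nonneg_left h3 (abs_nonneg _)
  · exact Eventually.of_forall fun s _ => (hbd s).summable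
  · simp only [fun s => (hbd s).tsum_eq]
    refine intervalIntegrable_of_continuousOn_Ici ?_ ht
    exact continuousOn_const.mul ((((ha.contT.norm.pow 2).add (hb.cont.norm.pow 2)).add
      (ha.cont.norm.pow 2)).add (hb.contT.norm.pow 2))
  · refine Eventually.of_forall fun s _ => ?_
    have h1 := (hinner ((Complex.I * κ) • T₁ s (a s)) (b s)).add
      (hinner (a s) ((Complex.I * κ) • T₂ s (b s)))
    simpa only [map_smul, lp.coeFn_smul, Pi.smul_apply, smul_eq_mul, mul_add] using h1

end Core

end ShearFlow

/-! ### Weighted energy estimates and comparison of trajectories. -/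

namespace ShearFlow

open ComplexConjugate

/-- Grönwall's inequality in integral form. -/
lemma add_integral_le_mul_exp {φ : ℝ → ℝ} {Γ φ₀ : ℝ} (hφ : ContinuousOn φ (Ici 0)) (hΓ : 0 ≤ Γ)
    (h : ∀ t, 0 ≤ t → φ t ≤ φ₀ + Γ * ∫ s in (0 : ℝ)..t, φ s) {t : ℝ} (ht : 0 ≤ t) :
    φ₀ + Γ * ∫ s in (0 : ℝ)..t, φ s ≤ φ₀ * exp (Γ * t) := by
  -- The integrating factor makes the right-hand side nonincreasing. It is this side, not only φ,
  -- that is bounded, because it also dominates the dissipation.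
  let u : ℝ → ℝ := fun t => (φ₀ + Γ * ∫ s in (0 : ℝ)..t, φ s) * exp (-(Γ * t))
  have hd : ∀ t, 0 < t → HasDerivAt u
      (Γ * φ t * exp (-(Γ * t)) +
        (φ₀ + Γ * ∫ s in (0 : ℝ)..t, φ s) * (exp (-(Γ * t)) * (-Γ))) t := by
    intro t ht
    have h1 : HasDerivAt (fun t => ∫ s in (0 : ℝ)..t, φ s) (φ t) t :=
      intervalIntegral.integral_hasDerivAt_right (intervalIntegrable_of_continuousOn_Ici hφ ht.le)
        ((hφ.mono Ioi_subset_Ici_self).stronglyMeasurableAtFilter isOpen_Ioi _ ht)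
        (hφ.continuousAt (Ici_mem_nhds ht))
    have h2 : HasDerivAt (fun t => exp (-(Γ * t))) (exp (-(Γ * t)) * (-Γ)) t := by
      have := ((hasDerivAt_id t).const_mul Γ).neg.exp
      simpa using this
    exact ((h1.const_mul Γ).const_add φ₀).mul h2
  have hc : ContinuousOn u (Icc 0 t) := by
    have h1 : ContinuousOn (fun t => ∫ s in (0 : ℝ)..t, φ s) (Icc 0 t) := by
      have := intervalIntegral.continuousOn_primitive_interval (μ := volume) (f := φ) (a := 0)
        (b := t)
        (by rw [uIcc_of_le ht]
            exact (hφ.mono Icc_subset_Ici_self).integrableOn_Icc)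
      rwa [uIcc_of_le ht] at this
    refine (continuousOn_const.add (continuousOn_const.mul h1)).mul ?_
    fun_prop
  have hanti : AntitoneOn u (Icc 0 t) := by
    refine antitoneOn_of_deriv_nonpos (convex_Icc 0 t) hc ?_ ?_
    · intro s hs
      rw [interior_Icc] at hs
      exact (hd s hs.1).differentiableAt.differentiableWithinAt
    · intro s hs
      rw [interior_Icc] at hs
      rw [(hd s hs.1).deriv]
      have h3 := mul_le_mul_of_nonneg_left (h s hs.1.le) hΓ
      nlinarith [mul_le_mul_of_nonneg_right h3 (exp_pos (-(Γ * s))).le]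
  have h4 := hanti (left_mem_Icc.mpr ht) (right_mem_Icc.mpr ht) ht
  simp only [u, intervalIntegral.integral_same, mul_zero, add_zero, neg_zero, exp_zero,
    mul_one] at h4
  have h5 := mul_le_mul_of_nonneg_right h4 (exp_pos (Γ * t)).le
  rwa [mul_assoc, ← exp_add, neg_add_cancel, exp_zero, mul_one] at h5

section Core

variable {H : Type*} [NormedAddCommGroup H] [InnerProductSpace ℂ H] {ι : Type*}
  {e : HilbertBasis ι ℂ H} {d d₁ d₂ : ι → ℝ} {κ : ℝ} {T T₁ T₂ : ℝ → H →L[ℂ] H} {a b : ℝ → H}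

lemma ofReal_mul_integral_eq {f : ℝ → ℝ} (hf : ContinuousOn f (Ici 0)) (hf0 : ∀ s, 0 ≤ f s)
    {c : ℝ} (hc : 0 ≤ c) {t : ℝ} (ht : 0 ≤ t) :
    ENNReal.ofReal (c * ∫ s in (0 : ℝ)..t, f s) =
      ∫⁻ s in Ioc 0 t, ENNReal.ofReal (c * f s) := by
  rw [← intervalIntegral.integral_const_mul, intervalIntegral.integral_of_le ht,
    ofReal_integral_eq_lintegral_ofReal]
  · exact ((intervalIntegrable_iff_integrableOn_Ioc_of_le ht).mp
      (intervalIntegrable_of_continuousOn_Ici (continuousOn_const.mul hf) ht))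
  · exact Eventually.of_forall fun s => mul_nonneg hc (hf0 s)

/-- The cross identity with b = a reads φ(t) + dissipation = φ(0) + ∫ Re N, where φ is the weighted
energy. As Re N ≤ Γφ, both nonnegative terms on the left are at most φ(0) + Γ∫φ, which Grönwall
bounds. Values in `ℝ≥0∞` allow later summation over k and integration over the weights. -/
theorem IsModeTraj.energy [Countable ι] (ha : IsModeTraj e d κ T a) (hd : ∀ m, 0 ≤ d m)
    (w : ι → ℝ) (hw : ∀ m, 0 ≤ w m) {B : ℝ} (hB : ∀ m, |w m| ≤ B) {Γ : ℝ} (hΓ0 : 0 ≤ Γ)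
    (hΓ : ∀ s, 0 ≤ s → ∀ x, 2 * (inner ℂ (diag e w hB x) ((Complex.I * κ) • T s x)).re ≤
      Γ * (inner ℂ (diag e w hB x) x).re) {t : ℝ} (ht : 0 ≤ t) :
    (∑' m, ENNReal.ofReal (w m * ‖e.repr (a t) m‖ ^ 2) ≤
      ENNReal.ofReal (exp (Γ * t)) * ∑' m, ENNReal.ofReal (w m * ‖e.repr (a 0) m‖ ^ 2)) ∧
    ∑' m, ∫⁻ s in Ioc 0 t, ENNReal.ofReal (2 * w m * d m * ‖e.repr (a s) m‖ ^ 2) ≤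
      ENNReal.ofReal (exp (Γ * t)) * ∑' m, ENNReal.ofReal (w m * ‖e.repr (a 0) m‖ ^ 2) := by
  set φ : ℝ → ℝ := fun s => (inner ℂ (diag e w hB (a s)) (a s)).re with hφdef
  have hφs : ∀ s, HasSum (fun m => w m * ‖e.repr (a s) m‖ ^ 2) (φ s) := fun s =>
    hasSum_inner_diag_self e w hB (a s)
  have hφe : ∀ s, ∑' m, ENNReal.ofReal (w m * ‖e.repr (a s) m‖ ^ 2) = ENNReal.ofReal (φ s) := by
    intro s
    rw [← (hφs s).tsum_eq, ENNReal.ofReal_tsum_of_nonneg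
      (fun m => mul_nonneg (hw m) (by positivity)) (hφs s).summable]
  have hWa : ContinuousOn (fun s => diag e w hB (a s)) (Ici 0) :=
    (diag e w hB).continuous.comp_continuousOn ha.cont
  have hφc : ContinuousOn φ (Ici 0) :=
    Complex.continuous_re.comp_continuousOn (hWa.inner ha.cont)
  set N : ℝ → ℂ := fun s => inner ℂ (diag e w hB ((Complex.I * κ) • T s (a s))) (a s) +
          inner ℂ (diag e w hB (a s)) ((Complex.I * κ) • T s (a s)) with hN
  have hNc : ContinuousOn N (Ici 0) := by
    have h1 : ContinuousOn (fun s => (Complex.I * κ) • T s (a s)) (Ici 0) :=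
      continuousOn_const.smul ha.contT
    exact (((diag e w hB).continuous.comp_continuousOn h1).inner ha.cont).add (hWa.inner h1)
  have hNre : ∀ s, 0 ≤ s → (N s).re ≤ Γ * φ s := by
    intro s hs
    refine le_trans (le_of_eq ?_) (hΓ s hs (a s))
    -- The two pairings in N are complex conjugates since the weight is symmetric; this is the
    -- factor 2 in `hΓ`.
    simp only [hN, Complex.add_re]
    rw [inner_diag_comm, ← inner_conj_symm, Complex.conj_re, two_mul]
  have key : ∀ t, 0 ≤ t → HasSum (fun m => 2 * w m * d m *
      ∫ s in (0 : ℝ)..t, ‖e.repr (a s) m‖ ^ 2) (φ 0 - φ t + ∫ s in (0 : ℝ)..t, (N s).re) := by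
    intro t ht
    have h1 := Complex.hasSum_re (ha.cross_hasSum ha w hB ht)
    have h2 : (∫ s in (0 : ℝ)..t, N s).re = ∫ s in (0 : ℝ)..t, (N s).re :=
      (Complex.reCLM.intervalIntegral_comp_comm
        (intervalIntegrable_of_continuousOn_Ici hNc ht)).symm
    simp only [Complex.add_re, Complex.sub_re] at h1
    rw [← h2]
    convert! h1 using 2 with m
    rw [intervalIntegral.integral_const_mul]
    have h3 : ∫ s in (0 : ℝ)..t, conj (e.repr (a s) m) * e.repr (a s) m =
        ((∫ s in (0 : ℝ)..t, ‖e.repr (a s) m‖ ^ 2 : ℝ) : ℂ) := by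
      rw [← intervalIntegral.integral_ofReal]
      congr 1; ext s
      rw [Complex.conj_mul']; push_cast; rfl
    rw [h3, ← Complex.ofReal_mul, ← Complex.ofReal_mul, Complex.ofReal_re]
    ring
  have hint : ∀ t, 0 ≤ t → ∫ s in (0 : ℝ)..t, (N s).re ≤ Γ * ∫ s in (0 : ℝ)..t, φ s := by
    intro t ht
    rw [← intervalIntegral.integral_const_mul]
    refine intervalIntegral.integral_mono_on ht
      (intervalIntegrable_of_continuousOn_Ici
        (Complex.continuous_re.comp_continuousOn hNc) ht)
      (intervalIntegrable_of_continuousOn_Ici (continuousOn_const.mul hφc) ht)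
      fun s hs => hNre s hs.1
  have hpos : ∀ t, 0 ≤ t → ∀ m, 0 ≤ 2 * w m * d m * ∫ s in (0 : ℝ)..t, ‖e.repr (a s) m‖ ^ 2 := by
    intro t ht m
    have := hw m
    have := hd m
    have : 0 ≤ ∫ s in (0 : ℝ)..t, ‖e.repr (a s) m‖ ^ 2 :=
      intervalIntegral.integral_nonneg ht fun s _ => by positivity
    positivity
  have hgron : ∀ t, 0 ≤ t → φ 0 + Γ * ∫ s in (0 : ℝ)..t, φ s ≤ φ 0 * exp (Γ * t) := fun t ht =>
    add_integral_le_mul_exp hφc hΓ0 (fun s hs => by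
      have h1 := (key s hs).nonneg (hpos s hs)
      linarith [hint s hs]) ht
  have hφ0 : 0 ≤ φ t := (hφs t).nonneg fun m => mul_nonneg (hw m) (by positivity)
  rw [hφe, hφe, ← ENNReal.ofReal_mul (exp_pos _).le]
  have h1 := (key t ht).nonneg (hpos t ht)
  constructor
  · refine ENNReal.ofReal_le_ofReal ?_
    linarith [hgron t ht, hint t ht]
  · have h2 : ∀ m, ∫⁻ s in Ioc 0 t, ENNReal.ofReal (2 * w m * d m * ‖e.repr (a s) m‖ ^ 2) =
        ENNReal.ofReal (2 * w m * d m * ∫ s in (0 : ℝ)..t, ‖e.repr (a s) m‖ ^ 2) := by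
      intro m
      have := hw m
      have := hd m
      exact (ofReal_mul_integral_eq (f := fun s => ‖e.repr (a s) m‖ ^ 2)
        ((ha.continuousOn_coord m).norm.pow 2) (fun s => by positivity) (by positivity) ht).symm
    simp only [h2]
    rw [← ENNReal.ofReal_tsum_of_nonneg (hpos t ht) (key t ht).summable, (key t ht).tsum_eq]
    refine ENNReal.ofReal_le_ofReal ?_
    linarith [hgron t ht, hint t ht]

lemma diag_one (x : H) : diag e (fun _ => 1) (B := 1) (by simp) x = x :=
  repr_ext e fun m => by rw [repr_diag, Complex.ofReal_one, one_mul]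

/-- A symmetric operator has a real quadratic form, so multiplying by i makes it purely imaginary:
the transport term does no work in L². -/
lemma re_inner_I_smul_self {T : H →L[ℂ] H} (hT : ∀ x y, inner ℂ (T x) y = inner ℂ x (T y))
    (κ : ℝ) (x : H) : (inner ℂ x ((Complex.I * κ) • T x)).re = 0 := by
  have h1 : (inner ℂ x (T x)).im = 0 := by
    rw [← Complex.conj_eq_iff_im, inner_conj_symm, hT]
  rw [inner_smul_right]
  simp [h1]

/-- The `L²` norm does not increase. -/
theorem IsModeTraj.norm_le [Countable ι] (ha : IsModeTraj e d κ T a) (hd : ∀ m, 0 ≤ d m)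
    (hT : ∀ s, 0 ≤ s → ∀ x y, inner ℂ (T s x) y = inner ℂ x (T s y)) {t : ℝ} (ht : 0 ≤ t) :
    ‖a t‖ ≤ ‖a 0‖ := by
  have h := (ha.energy hd (fun _ => 1) (fun _ => zero_le_one) (B := 1) (by simp) le_rfl
    (fun s hs x => by rw [diag_one, re_inner_I_smul_self (hT s hs)]; simp) ht).1
  have h2 : ∀ s, ∑' m, ENNReal.ofReal (1 * ‖e.repr (a s) m‖ ^ 2) =
      ENNReal.ofReal (‖a s‖ ^ 2) := by
    intro s
    simp only [one_mul]
    rw [← (hasSum_repr_sq e (a s)).tsum_eq, ENNReal.ofReal_tsum_of_nonneg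
      (fun m => by positivity) (hasSum_repr_sq e (a s)).summable]
  rw [h2, h2, zero_mul, exp_zero, ENNReal.ofReal_one, one_mul,
    ENNReal.ofReal_le_ofReal_iff (by positivity)] at h
  exact (sq_le_sq₀ (norm_nonneg _) (norm_nonneg _)).mp h

/-- Comparison of two trajectories with the same initial value. -/
theorem IsModeTraj.dist_sq_le [Countable ι] (ha : IsModeTraj e d₁ κ T₁ a)
    (hb : IsModeTraj e d₂ κ T₂ b) (h0 : a 0 = b 0) (hd₁ : ∀ m, 0 ≤ d₁ m) (hd₂ : ∀ m, 0 ≤ d₂ m)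
    (hT₁ : ∀ s, 0 ≤ s → ∀ x y, inner ℂ (T₁ s x) y = inner ℂ x (T₁ s y))
    (hT₂ : ∀ s, 0 ≤ s → ∀ x y, inner ℂ (T₂ s x) y = inner ℂ x (T₂ s y))
    {δ t : ℝ} (hδ0 : 0 ≤ δ) (ht : 0 ≤ t)
    (hδ : ∀ s ∈ Icc 0 t, ∀ x, ‖T₂ s x - T₁ s x‖ ≤ δ * ‖x‖) :
    ENNReal.ofReal (‖a t - b t‖ ^ 2) ≤
      2 * (∑' m, ∫⁻ s in Ioc 0 t,
        ENNReal.ofReal ((d₁ m + d₂ m) * (‖e.repr (a s) m‖ * ‖e.repr (b s) m‖))) +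
      2 * ENNReal.ofReal (|κ| * δ * ‖a 0‖ ^ 2 * t) := by
  set f : ι → ℂ := fun m => ∫ s in (0 : ℝ)..t,
    ((d₁ m + d₂ m : ℝ) : ℂ) * (conj (e.repr (a s) m) * e.repr (b s) m) with hf
  set N : ℝ → ℂ := fun s => inner ℂ ((Complex.I * κ) • T₁ s (a s)) (b s) +
          inner ℂ (a s) ((Complex.I * κ) • T₂ s (b s)) with hN
  have hsum : HasSum f (inner ℂ (a 0) (b 0) - inner ℂ (a t) (b t) + ∫ s in (0 : ℝ)..t, N s) := by
    have h := ha.cross_hasSum hb (fun _ => 1) (B := 1) (by simp) ht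
    simpa only [diag_one, Complex.ofReal_one, one_mul] using h
  have hna : ∀ s, 0 ≤ s → ‖a s‖ ≤ ‖a 0‖ := fun s hs => ha.norm_le hd₁ hT₁ hs
  have hnb : ∀ s, 0 ≤ s → ‖b s‖ ≤ ‖a 0‖ := fun s hs => by
    rw [h0]; exact hb.norm_le hd₂ hT₂ hs
  have hNle : ‖∫ s in (0 : ℝ)..t, N s‖ ≤ |κ| * δ * ‖a 0‖ ^ 2 * |t - 0| := by
    refine intervalIntegral.norm_integral_le_of_norm_le_const fun s hs => ?_
    rw [uIoc_of_le ht] at hs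
    -- By symmetry of `T₁` the common part cancels and only the difference of the two operators
    -- remains.
    have h1 : N s = (Complex.I * κ) * inner ℂ (a s) (T₂ s (b s) - T₁ s (b s)) := by
      simp only [hN, inner_smul_left, inner_smul_right, inner_sub_right, map_mul, Complex.conj_I,
        Complex.conj_ofReal, hT₁ s hs.1.le]
      ring
    rw [h1, norm_mul, norm_mul, Complex.norm_I, one_mul, Complex.norm_real, Real.norm_eq_abs,
      mul_assoc]
    refine mul_le_mul_of_nonneg_left ?_ (abs_nonneg _)
    calc _ ≤ ‖a s‖ * ‖T₂ s (b s) - T₁ s (b s)‖ := norm_inner_le_norm _ _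
      _ ≤ ‖a 0‖ * (δ * ‖a 0‖) := by
        refine mul_le_mul (hna s hs.1.le) ?_ (norm_nonneg _) (norm_nonneg _)
        exact (hδ s ⟨hs.1.le, hs.2⟩ _).trans (mul_le_mul_of_nonneg_left (hnb s hs.1.le) hδ0)
      _ = _ := by ring
  rw [sub_zero, abs_of_nonneg ht] at hNle
  -- Expand the square and bound ‖a t‖² + ‖b t‖² by 2‖a 0‖² = 2 Re⟨a 0, b 0⟩; what is left is twice
  -- the decrease of Re⟨a, b⟩, given by the cross identity.
  have hre : ‖a t - b t‖ ^ 2 ≤ 2 * ‖∑' m, f m‖ + 2 * (|κ| * δ * ‖a 0‖ ^ 2 * t) := by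
    rw [hsum.tsum_eq]
    have h1 := norm_sub_sq (𝕜 := ℂ) (a t) (b t)
    have h2 : (inner ℂ (a 0) (b 0)).re = ‖a 0‖ ^ 2 := by
      rw [← h0]
      exact inner_self_eq_norm_sq (𝕜 := ℂ) (a 0)
    have h3 := Complex.re_le_norm (inner ℂ (a 0) (b 0) - inner ℂ (a t) (b t) +
      ∫ s in (0 : ℝ)..t, N s)
    have h4 := (abs_le.mp (Complex.abs_re_le_norm (∫ s in (0 : ℝ)..t, N s))).1
    simp only [Complex.add_re, Complex.sub_re, h2] at h3
    have h5 := pow_le_pow_left₀ (norm_nonneg _) (hna t ht) 2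
    have h6 := pow_le_pow_left₀ (norm_nonneg _) (hnb t ht) 2
    rw [h1]
    simp only [RCLike.re_to_complex]
    linarith
  refine (ENNReal.ofReal_le_ofReal hre).trans ?_
  rw [ENNReal.ofReal_add (by positivity) (by positivity), ENNReal.ofReal_mul (by norm_num),
    ENNReal.ofReal_mul (p := 2) (q := |κ| * δ * ‖a 0‖ ^ 2 * t) (by norm_num),
    ENNReal.ofReal_ofNat]
  gcongr
  rw [ofReal_norm]
  refine (enorm_tsum_le_tsum_enorm).trans (ENNReal.tsum_le_tsum fun m => ?_)
  rw [hf]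
  simp only
  rw [intervalIntegral.integral_of_le ht]
  refine (enorm_integral_le_lintegral_enorm _).trans (le_of_eq ?_)
  refine lintegral_congr fun s => ?_
  rw [← ofReal_norm, norm_mul, norm_mul, RCLike.norm_conj, Complex.norm_real, Real.norm_eq_abs,
    abs_of_nonneg (add_nonneg (hd₁ m) (hd₂ m))]

end Core

/-! ### The commutator estimate -/

section Commutator

variable {H : Type*} [NormedAddCommGroup H] [InnerProductSpace ℂ H] {e : HilbertBasis ℤ ℂ H}

/-- The resolvent weight `s X / (s + X)`, `X = κ² + m²`. -/
noncomputable def resWeight (s κ : ℝ) (m : ℤ) : ℝ :=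
  s * (κ ^ 2 + (m : ℝ) ^ 2) / (s + (κ ^ 2 + (m : ℝ) ^ 2))

lemma resWeight_nonneg {s : ℝ} (hs : 0 < s) (κ : ℝ) (m : ℤ) : 0 ≤ resWeight s κ m := by
  unfold resWeight; positivity

lemma abs_resWeight_le {s : ℝ} (hs : 0 < s) (κ : ℝ) (m : ℤ) : |resWeight s κ m| ≤ s := by
  rw [abs_of_nonneg (resWeight_nonneg hs κ m), resWeight, div_le_iff₀ (by positivity)]
  nlinarith

/-- The weight is s - s²(s+X)⁻¹ with X = κ² + D² and D multiplication by m; here `T'` is defined by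
T D = D T + i T'. Expanding ⟨Ax, iκTx⟩ through b = (s+X)⁻¹x and y = Db, all quadratic forms of T are
real and drop out after multiplication by i. Only s²κ Re⟨b, T'y⟩ survives, and s²(κ²‖b‖² + ‖y‖²) is
at most the weighted energy, so the bound depends on neither s nor κ. -/
theorem commutator_le {T T' : H →L[ℂ] H} (hT : ∀ x y, inner ℂ (T x) y = inner ℂ x (T y))
    (hT' : ∀ x y, (∀ m : ℤ, e.repr y m = m * e.repr x m) →
      ∀ m : ℤ, e.repr (T y) m = m * e.repr (T x) m + Complex.I * e.repr (T' x) m)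
    {Γ : ℝ} (hΓ0 : 0 ≤ Γ) (hΓ : ∀ x, ‖T' x‖ ≤ Γ * ‖x‖) {s : ℝ} (hs : 0 < s) (κ : ℝ) (x : H) :
    2 * (inner ℂ (diag e (resWeight s κ) (abs_resWeight_le hs κ) x)
      ((Complex.I * κ) • T x)).re ≤
      Γ * (inner ℂ (diag e (resWeight s κ) (abs_resWeight_le hs κ) x) x).re := by
  have hpos : ∀ m : ℤ, 0 < s + (κ ^ 2 + (m : ℝ) ^ 2) := fun m => by positivity
  have hbB : ∀ m : ℤ, |1 / (s + (κ ^ 2 + (m : ℝ) ^ 2))| ≤ 1 / s := by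
    intro m
    rw [abs_of_pos (by have := hpos m; positivity)]
    exact one_div_le_one_div_of_le hs (by nlinarith [sq_nonneg κ, sq_nonneg (m : ℝ)])
  have hdB : ∀ m : ℤ, |m / (s + (κ ^ 2 + (m : ℝ) ^ 2))| ≤ 1 / s + 1 := by
    intro m
    rw [abs_div, abs_of_pos (hpos m), div_le_iff₀ (hpos m)]
    have h1 : |(m : ℝ)| ≤ 1 + (m : ℝ) ^ 2 := by
      rw [← sq_abs]; nlinarith [sq_nonneg (|(m : ℝ)| - 1), abs_nonneg (m : ℝ)]
    have h2 : 1 / s * s = 1 := by field_simp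
    have h3 : 0 ≤ 1 / s := by positivity
    nlinarith [sq_nonneg κ, sq_nonneg (m : ℝ), mul_nonneg h3 (sq_nonneg κ),
      mul_nonneg h3 (sq_nonneg (m : ℝ))]
  have hpB : ∀ m : ℤ, |(m : ℝ) ^ 2 / (s + (κ ^ 2 + (m : ℝ) ^ 2))| ≤ 1 := by
    intro m
    rw [abs_of_nonneg (by have := hpos m; positivity), div_le_one (hpos m)]
    nlinarith [sq_nonneg κ]
  -- b, y = Db and p = D²b are images of x under bounded operators, so D itself never acts on a
  -- vector outside its domain.
  set b := diag e (fun m : ℤ => 1 / (s + (κ ^ 2 + (m : ℝ) ^ 2))) hbB x with hb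
  set y := diag e (fun m : ℤ => m / (s + (κ ^ 2 + (m : ℝ) ^ 2))) hdB x with hy
  set p := diag e (fun m : ℤ => (m : ℝ) ^ 2 / (s + (κ ^ 2 + (m : ℝ) ^ 2))) hpB x with hp
  set A := diag e (resWeight s κ) (abs_resWeight_le hs κ) x with hA
  have hposC : ∀ m : ℤ, ((s : ℂ) + (κ ^ 2 + (m : ℂ) ^ 2)) ≠ 0 := fun m => by
    exact_mod_cast (hpos m).ne'
  have eb : ∀ m, e.repr b m = ((1 / (s + (κ ^ 2 + (m : ℝ) ^ 2)) : ℝ) : ℂ) * e.repr x m :=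
    fun m => repr_diag e _ hbB x m
  have ey : ∀ m, e.repr y m = ((m / (s + (κ ^ 2 + (m : ℝ) ^ 2)) : ℝ) : ℂ) * e.repr x m :=
    fun m => repr_diag e _ hdB x m
  have ep : ∀ m, e.repr p m = (((m : ℝ) ^ 2 / (s + (κ ^ 2 + (m : ℝ) ^ 2)) : ℝ) : ℂ) * e.repr x m :=
    fun m => repr_diag e _ hpB x m
  have hAeq : A = (s : ℂ) • x - ((s ^ 2 : ℝ) : ℂ) • b := by
    refine repr_ext e fun m => ?_
    rw [hA, repr_diag]
    simp only [map_sub, map_smul, lp.coeFn_sub, lp.coeFn_smul, Pi.sub_apply, Pi.smul_apply,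
      smul_eq_mul, eb, resWeight]
    have := hposC m
    push_cast
    field_simp
    ring
  have hxeq : x = ((s + κ ^ 2 : ℝ) : ℂ) • b + p := by
    refine repr_ext e fun m => ?_
    simp only [map_add, map_smul, lp.coeFn_add, lp.coeFn_smul, Pi.add_apply, Pi.smul_apply,
      smul_eq_mul, eb, ep]
    have := hposC m
    push_cast
    field_simp
    ring
  have hpy : ∀ m : ℤ, e.repr p m = m * e.repr y m := by
    intro m
    rw [ep, ey]
    push_cast
    ring
  have hyb : ∀ m : ℤ, conj (e.repr b m) * m = conj (e.repr y m) := by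
    intro m
    rw [eb, ey, map_mul, map_mul, Complex.conj_ofReal, Complex.conj_ofReal]
    push_cast
    ring
  -- Since p = Dy, commute T past D and move D onto b, where it gives y.
  have hbp : inner ℂ b (T p) = inner ℂ y (T y) + Complex.I * inner ℂ b (T' y) := by
    refine (hasSum_repr_inner e b (T p)).unique ?_
    have h := (hasSum_repr_inner e y (T y)).add ((hasSum_repr_inner e b (T' y)).mul_left Complex.I)
    convert! h using 2 with m
    rw [hT' y p hpy m, ← hyb m]
    ring
  have hz : ∀ z : H, (inner ℂ z (T z)).im = 0 := fun z => by
    rw [← Complex.conj_eq_iff_im, inner_conj_symm, hT]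
  have hmain : (inner ℂ A ((Complex.I * κ) • T x)).re = s ^ 2 * κ * (inner ℂ b (T' y)).re := by
    have h1 : inner ℂ A ((Complex.I * κ) • T x) = Complex.I * κ * (s * inner ℂ x (T x) -
        ((s ^ 2 : ℝ) : ℂ) * (((s + κ ^ 2 : ℝ) : ℂ) * inner ℂ b (T b) + inner ℂ y (T y) +
          Complex.I * inner ℂ b (T' y))) := by
      rw [add_assoc, ← hbp, hAeq]
      simp only [inner_smul_right, inner_sub_left, inner_smul_left, Complex.conj_ofReal]
      have h2 : inner ℂ b (T x) = ((s + κ ^ 2 : ℝ) : ℂ) * inner ℂ b (T b) + inner ℂ b (T p) := by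
        conv_lhs => rw [hxeq]
        rw [map_add, map_smul, inner_add_right, inner_smul_right]
      rw [h2]
    rw [h1]
    simp only [Complex.mul_re, Complex.mul_im, Complex.I_re, Complex.I_im, Complex.ofReal_re,
      Complex.ofReal_im, Complex.sub_re, Complex.sub_im, Complex.add_re, Complex.add_im, hz]
    ring
  have hbd : |(inner ℂ b (T' y)).re| ≤ Γ * (‖b‖ * ‖y‖) := by
    calc _ ≤ ‖inner ℂ b (T' y)‖ := Complex.abs_re_le_norm _
      _ ≤ ‖b‖ * ‖T' y‖ := norm_inner_le_norm _ _
      _ ≤ ‖b‖ * (Γ * ‖y‖) := mul_le_mul_of_nonneg_left (hΓ y) (norm_nonneg _)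
      _ = _ := by ring
  -- Modewise, s²X/(s+X)² is the weight sX/(s+X) times s/(s+X) ≤ 1.
  have hsq : s ^ 2 * (κ ^ 2 * ‖b‖ ^ 2 + ‖y‖ ^ 2) ≤ (inner ℂ A x).re := by
    have h1 := (((hasSum_repr_sq e b).mul_left (κ ^ 2)).add (hasSum_repr_sq e y)).mul_left (s ^ 2)
    refine hasSum_le (fun m => ?_) h1
      (hasSum_inner_diag_self e (resWeight s κ) (abs_resWeight_le hs κ) x)
    rw [eb, ey, norm_mul, norm_mul, mul_pow, mul_pow, Complex.norm_real, Complex.norm_real,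
      Real.norm_eq_abs, Real.norm_eq_abs, sq_abs, sq_abs]
    have hp := hpos m
    have h2 : s ^ 2 * (κ ^ 2 * ((1 / (s + (κ ^ 2 + (m : ℝ) ^ 2))) ^ 2 * ‖e.repr x m‖ ^ 2) +
        (m / (s + (κ ^ 2 + (m : ℝ) ^ 2))) ^ 2 * ‖e.repr x m‖ ^ 2) =
        resWeight s κ m * (s / (s + (κ ^ 2 + (m : ℝ) ^ 2))) * ‖e.repr x m‖ ^ 2 := by
      unfold resWeight
      field_simp
    rw [h2]
    refine mul_le_mul_of_nonneg_right ?_ (by positivity)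
    refine mul_le_of_le_one_right (resWeight_nonneg hs κ m) ?_
    rw [div_le_one hp]
    nlinarith [sq_nonneg κ, sq_nonneg (m : ℝ)]
  rw [hmain]
  have h3 : s ^ 2 * κ * (inner ℂ b (T' y)).re ≤ s ^ 2 * (|κ| * (Γ * (‖b‖ * ‖y‖))) := by
    rw [mul_assoc]
    refine mul_le_mul_of_nonneg_left ?_ (by positivity)
    refine (le_abs_self _).trans ?_
    rw [abs_mul]
    exact mul_le_mul_of_nonneg_left hbd (abs_nonneg _)
  have h4 : 2 * (|κ| * (‖b‖ * ‖y‖)) ≤ κ ^ 2 * ‖b‖ ^ 2 + ‖y‖ ^ 2 := by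
    have := two_mul_le_add_sq (|κ| * ‖b‖) ‖y‖
    rw [mul_pow, sq_abs] at this
    linarith
  have h5 : Γ * (s ^ 2 * (2 * (|κ| * (‖b‖ * ‖y‖)))) ≤ Γ * (inner ℂ A x).re :=
    mul_le_mul_of_nonneg_left
      ((mul_le_mul_of_nonneg_left h4 (by positivity)).trans hsq) hΓ0
  linarith

end Commutator

end ShearFlow

namespace ShearFlow

open ComplexConjugate AddCircle

/-! ### Multiplication operators on `L²(𝕋)` -/

/-- `L²(𝕋; ℂ)` for the normalised measure. -/
abbrev CircL2 : Type := Lp ℂ 2 (haarAddCircle : Measure Circ)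

/-- Multiplication by a continuous function, linear in the function. -/
noncomputable def mulOp : C(Circ, ℂ) →L[ℂ] CircL2 →L[ℂ] CircL2 :=
  ((ContinuousLinearMap.mul ℂ ℂ).holderL haarAddCircle ⊤ 2 2).comp
    (ContinuousMap.toLp (E := ℂ) ⊤ haarAddCircle ℂ)

lemma coeFn_mulOp (G : C(Circ, ℂ)) (x : CircL2) :
    mulOp G x =ᵐ[haarAddCircle] fun y => G y * x y := by
  have h1 : mulOp G x = (ContinuousLinearMap.mul ℂ ℂ).holder 2
    (ContinuousMap.toLp (E := ℂ) ⊤ haarAddCircle ℂ G) x := rfl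
  rw [h1]
  filter_upwards [(ContinuousLinearMap.mul ℂ ℂ).coeFn_holder (r := 2)
    (ContinuousMap.toLp (E := ℂ) ⊤ haarAddCircle ℂ G) x,
    ContinuousMap.coeFn_toLp (p := ⊤) (𝕜 := ℂ) haarAddCircle G] with y h2 h3
  rw [h2, h3]
  rfl

lemma norm_mulOp_le (G : C(Circ, ℂ)) (x : CircL2) : ‖mulOp G x‖ ≤ ‖G‖ * ‖x‖ := by
  have h1 : mulOp G x = (ContinuousLinearMap.mul ℂ ℂ).holder 2
    (ContinuousMap.toLp (E := ℂ) ⊤ haarAddCircle ℂ G) x := rfl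
  have h2 : ‖ContinuousMap.toLp (E := ℂ) ⊤ (haarAddCircle : Measure Circ) ℂ G‖ ≤ ‖G‖ := by
    refine (ContinuousLinearMap.le_of_opNorm_le _ (ContinuousMap.toLp_norm_le _) G).trans ?_
    simp
  rw [h1]
  refine ((ContinuousLinearMap.mul ℂ ℂ).norm_holder_apply_apply_le _ _).trans ?_
  have h3 : ‖ContinuousLinearMap.mul ℂ ℂ‖ ≤ 1 := ContinuousLinearMap.opNorm_mul_le ℂ ℂ
  calc _ ≤ 1 * ‖G‖ * ‖x‖ := by gcongr
    _ = _ := by ring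

lemma inner_mulOp_left (G : C(Circ, ℂ)) (x y : CircL2) :
    inner ℂ (mulOp (star G) x) y = inner ℂ x (mulOp G y) := by
  rw [L2.inner_def, L2.inner_def]
  refine integral_congr_ae ?_
  filter_upwards [coeFn_mulOp (star G) x, coeFn_mulOp G y] with z h1 h2
  rw [h1, h2, RCLike.inner_apply, RCLike.inner_apply, ContinuousMap.star_apply, map_mul,
    RCLike.star_def, Complex.conj_conj]
  ring

lemma fourierBasis_apply (m : ℤ) :
    (fourierBasis (T := 2 * π)) m = fourierLp 2 m := by
  rw [coe_fourierBasis]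

lemma repr_mulOp_fourierLp (G : C(Circ, ℂ)) (m n : ℤ) :
    fourierBasis.repr (mulOp G (fourierLp 2 n)) m = fourierCoeff G (m - n) := by
  rw [fourierBasis_repr, fourierCoeff, fourierCoeff]
  refine integral_congr_ae ?_
  filter_upwards [coeFn_mulOp G (fourierLp 2 n), coeFn_fourierLp (T := 2 * π) 2 n] with z h1 h2
  rw [h1, h2, show -(m - n) = -m + n by ring, fourier_add, smul_eq_mul, smul_eq_mul]
  ring

/-- The convolution formula, obtained as Parseval's identity between x and the product of conj G
with the m-th exponential. -/
lemma hasSum_repr_mulOp (G : C(Circ, ℂ)) (x : CircL2) (m : ℤ) :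
    HasSum (fun n => fourierCoeff G (m - n) * fourierBasis.repr x n)
      (fourierBasis.repr (mulOp G x) m) := by
  have h := fourierBasis.hasSum_inner_mul_inner
    (mulOp (star G) ((fourierBasis (T := 2 * π)) m)) x
  rw [inner_mulOp_left, ← HilbertBasis.repr_apply_apply] at h
  simp only [inner_mulOp_left, ← HilbertBasis.repr_apply_apply] at h
  simpa only [fourierBasis_apply, repr_mulOp_fourierLp] using h

lemma repr_mulOp_fourier (j m : ℤ) (x : CircL2) :
    fourierBasis.repr (mulOp (fourier j) x) m = fourierBasis.repr x (m - j) := by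
  refine (hasSum_repr_mulOp (fourier j) x m).unique ?_
  have h : ∀ n, fourierCoeff (fourier (T := 2 * π) j) (m - n) = if n = m - j then 1 else 0 := by
    intro n
    rw [fourierCoeff_fourier, Pi.single_apply]
    congr 1
    rw [eq_iff_iff]
    constructor <;> intro h <;> omega
  simp only [h, ite_mul, one_mul, zero_mul]
  convert! hasSum_ite_eq (m - j) (fourierBasis.repr x (m - j)) using 2 with n
  split_ifs with h
  · rw [h]
  · rfl

/-- The commutation relation of a multiplication operator with `∂`, in Fourier variables. -/
lemma repr_mulOp_commute {G G' : C(Circ, ℂ)}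
    (hG : ∀ j : ℤ, fourierCoeff G' j = Complex.I * j * fourierCoeff G j) {x y : CircL2}
    (hxy : ∀ m : ℤ, fourierBasis.repr y m = m * fourierBasis.repr x m) (m : ℤ) :
    fourierBasis.repr (mulOp G y) m = m * fourierBasis.repr (mulOp G x) m +
      Complex.I * fourierBasis.repr (mulOp G' x) m := by
  refine (hasSum_repr_mulOp G y m).unique ?_
  have h := ((hasSum_repr_mulOp G x m).mul_left (m : ℂ)).add
    ((hasSum_repr_mulOp G' x m).mul_left Complex.I)
  convert! h using 2 with n
  rw [hG, hxy]
  push_cast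
  linear_combination (-(m - n : ℂ) * fourierCoeff G (m - n) * fourierBasis.repr x n) *
    Complex.I_mul_I

/-- A continuous real function as an element of `C(𝕋, ℂ)`. -/
noncomputable def toC (g : Circ → ℝ) (hg : Continuous g) : C(Circ, ℂ) :=
  ⟨fun x => (g x : ℂ), Complex.continuous_ofReal.comp hg⟩

lemma mulOp_toC_symm {g : Circ → ℝ} (hg : Continuous g) (x y : CircL2) :
    inner ℂ (mulOp (toC g hg) x) y = inner ℂ x (mulOp (toC g hg) y) := by
  rw [← inner_mulOp_left]
  congr 3
  ext z
  simp [toC]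

lemma norm_toC_le {g : Circ → ℝ} (hg : Continuous g) {C : ℝ} (hC : 0 ≤ C) (h : ∀ x, |g x| ≤ C) :
    ‖toC g hg‖ ≤ C := by
  refine (ContinuousMap.norm_le _ hC).mpr fun x => ?_
  simpa [toC] using h x

/-! ### Derivatives on the circle -/

/-- The derivative of a function on the circle. -/
noncomputable def circDeriv (g : Circ → ℝ) : Circ → ℝ :=
  Function.Periodic.lift (f := deriv fun x : ℝ => g (x : Circ)) (c := 2 * π) (by
    intro x
    rw [← deriv_comp_add_const]
    congr 1
    ext y
    simp)

lemma circDeriv_coe (g : Circ → ℝ) (x : ℝ) :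
    circDeriv g (x : Circ) = deriv (fun x : ℝ => g (x : Circ)) x := rfl

lemma SmoothCirc.circDeriv {g : Circ → ℝ} (hg : SmoothCirc g) :
    SmoothCirc (ShearFlow.circDeriv g) := by
  have h : (fun x : ℝ => ShearFlow.circDeriv g (x : Circ)) = deriv (fun x : ℝ => g (x : Circ)) :=
    rfl
  rw [SmoothCirc, h]
  exact ((contDiff_infty_iff_deriv (f := fun x : ℝ => g (x : Circ))).mp hg).2

lemma SmoothCirc.continuous {g : Circ → ℝ} (hg : SmoothCirc g) : Continuous g := by
  have h : Continuous fun x : ℝ => g (x : Circ) := ContDiff.continuous hg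
  exact (QuotientAddGroup.isQuotientMap_mk _).continuous_iff.mpr h

lemma SmoothCirc.hasDerivAt {g : Circ → ℝ} (hg : SmoothCirc g) (x : ℝ) :
    HasDerivAt (fun x : ℝ => g (x : Circ)) (ShearFlow.circDeriv g (x : Circ)) x := by
  have h : Differentiable ℝ (fun x : ℝ => g (x : Circ)) :=
    ContDiff.differentiable (n := ∞) hg (by simp)
  exact (h x).hasDerivAt

lemma supDeriv_circDeriv (j : ℕ) (g : Circ → ℝ) :
    supDeriv j (circDeriv g) = supDeriv (j + 1) g := by
  unfold supDeriv
  rw [iteratedDeriv_succ']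
  rfl

/-- A real supremum of an unbounded family is 0 by convention; compactness of the circle excludes
this. -/
lemma abs_le_supDeriv_zero {g : Circ → ℝ} (hg : Continuous g) (x : Circ) :
    |g x| ≤ supDeriv 0 g := by
  obtain ⟨y, rfl⟩ := QuotientAddGroup.mk_surjective x
  have hb : BddAbove (range fun x : Circ => |g x|) :=
    (isCompact_range (continuous_abs.comp hg)).bddAbove
  have hb2 : BddAbove (range fun x : ℝ => |iteratedDeriv 0 (fun y : ℝ => g (y : Circ)) x|) := by
    refine hb.mono ?_
    rintro _ ⟨x, rfl⟩
    exact ⟨x, by simp⟩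
  have := le_ciSup hb2 y
  simpa [supDeriv] using this

lemma supDeriv_nonneg (j : ℕ) (g : Circ → ℝ) : 0 ≤ supDeriv j g :=
  Real.iSup_nonneg fun _ => abs_nonneg _

lemma SmoothCirc.abs_sub_le {g : Circ → ℝ} (hg : SmoothCirc g) (x : Circ) (a b : ℝ) :
    |g (x - (a : Circ)) - g (x - (b : Circ))| ≤ supDeriv 1 g * |a - b| := by
  obtain ⟨y, rfl⟩ := QuotientAddGroup.mk_surjective x
  have h := Convex.norm_image_sub_le_of_norm_deriv_le (s := univ) (C := supDeriv 1 g)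
    (f := fun x : ℝ => g (x : Circ)) (x := y - b) (y := y - a)
    (fun z _ => (hg.hasDerivAt z).differentiableAt) (fun z _ => by
      rw [Real.norm_eq_abs, ← circDeriv_coe, ← supDeriv_circDeriv 0 g]
      exact abs_le_supDeriv_zero hg.circDeriv.continuous _) convex_univ (mem_univ _) (mem_univ _)
  simp only [Real.norm_eq_abs] at h
  have e : |y - a - (y - b)| = |a - b| := by rw [abs_sub_comm]; ring_nf
  rw [e] at h
  exact h

/-- Integration by parts over one period; the boundary terms cancel by periodicity. -/
lemma fourierCoeff_circDeriv {g : Circ → ℝ} (hg : SmoothCirc g) (j : ℤ) :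
    fourierCoeff (toC (circDeriv g) hg.circDeriv.continuous) j =
      Complex.I * j * fourierCoeff (toC g hg.continuous) j := by
  rw [fourierCoeff_eq_intervalIntegral _ _ 0, fourierCoeff_eq_intervalIntegral _ _ 0]
  have hπ : ((2 * π : ℝ) : ℂ) ≠ 0 := by exact_mod_cast Real.two_pi_pos.ne'
  have hd : ∀ x : ℝ, HasDerivAt (fun x : ℝ => fourier (-j) (x : Circ) * (g (x : Circ) : ℂ))
      (-(Complex.I * j) * (fourier (-j) (x : Circ) * (g (x : Circ) : ℂ)) +
        fourier (-j) (x : Circ) * (circDeriv g (x : Circ) : ℂ)) x := by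
    intro x
    have h1 := hasDerivAt_fourier_neg (2 * π) j x
    have h2 := (hg.hasDerivAt x).ofReal_comp
    convert! h1.mul h2 using 1
    push_cast at hπ ⊢
    field_simp
  have c0 : Continuous fun x : ℝ => (x : Circ) := continuous_quotient_mk'
  have c1 : Continuous fun x : ℝ => fourier (-j) (x : Circ) * (g (x : Circ) : ℂ) :=
    ((fourier (-j)).continuous.comp c0).mul
      (Complex.continuous_ofReal.comp (hg.continuous.comp c0))
  have c2 : Continuous fun x : ℝ => fourier (-j) (x : Circ) * (circDeriv g (x : Circ) : ℂ) :=
    ((fourier (-j)).continuous.comp c0).mul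
      (Complex.continuous_ofReal.comp (hg.circDeriv.continuous.comp c0))
  have c3 : Continuous fun x : ℝ =>
      -(Complex.I * j) * (fourier (-j) (x : Circ) * (g (x : Circ) : ℂ)) := continuous_const.mul c1
  have h3 := intervalIntegral.integral_eq_sub_of_hasDerivAt (a := 0) (b := 0 + 2 * π)
    (fun x _ => hd x) ((c3.add c2).intervalIntegrable _ _)
  rw [intervalIntegral.integral_add (c3.intervalIntegrable _ _)
    (c2.intervalIntegrable _ _), intervalIntegral.integral_const_mul] at h3
  have h4 : ((0 + 2 * π : ℝ) : Circ) = ((0 : ℝ) : Circ) := by simp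
  rw [h4, sub_self] at h3
  simp only [smul_eq_mul, toC, ContinuousMap.coe_mk, Complex.real_smul]
  linear_combination (((1 / (2 * π) : ℝ) : ℂ)) * h3

/-! ### The heat semigroup -/

open ProbabilityTheory

/-- Rescaling to one standard Gaussian couples all times on the same probability space, so heat
flows at different times can be compared under a single integral. -/
lemma heat_eq {g : Circ → ℝ} (hg : Continuous g) {s : ℝ} (hs : 0 ≤ s) (x : Circ) :
    heat s g x = ∫ z : ℝ, g (x - ((√(2 * s) * z : ℝ) : Circ)) ∂(gaussianReal 0 1) := by
  have h := gaussianReal_map_const_mul (μ := 0) (v := 1) √(2 * s)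
  have hv : NNReal.mk (√(2 * s) ^ 2) (sq_nonneg _) * 1 = (2 * s).toNNReal := by
    ext
    rw [mul_one, NNReal.coe_mk, Real.sq_sqrt (by positivity), Real.coe_toNNReal _ (by positivity)]
  rw [hv, mul_zero] at h
  rw [heat, ← h, integral_map (by fun_prop)]
  have c0 : Continuous fun x : ℝ => (x : Circ) := continuous_quotient_mk'
  exact (hg.comp (continuous_const.sub c0)).aestronglyMeasurable

lemma integrable_shift {g : Circ → ℝ} (hg : Continuous g) (x : Circ) (c : ℝ) (μ : Measure ℝ)
    [IsFiniteMeasure μ] : Integrable (fun z : ℝ => g (x - ((c * z : ℝ) : Circ))) μ := by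
  have c0 : Continuous fun x : ℝ => (x : Circ) := continuous_quotient_mk'
  have hc : Continuous fun z : ℝ => g (x - ((c * z : ℝ) : Circ)) := by fun_prop
  exact Integrable.of_bound hc.aestronglyMeasurable (supDeriv 0 g)
    (Eventually.of_forall fun z => abs_le_supDeriv_zero hg _)

lemma heat_zero (g : Circ → ℝ) (hg : Continuous g) : heat 0 g = g := by
  ext x
  rw [heat_eq hg le_rfl]
  simp

lemma abs_heat_le {g : Circ → ℝ} (hg : Continuous g) {s : ℝ} (hs : 0 ≤ s) (x : Circ) :
    |heat s g x| ≤ supDeriv 0 g := by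
  rw [heat_eq hg hs, ← Real.norm_eq_abs]
  refine (norm_integral_le_of_norm_le_const (C := supDeriv 0 g)
    (Eventually.of_forall fun z => abs_le_supDeriv_zero hg _)).trans ?_
  simp

/-- From |z| ≤ (1 + z²)/2 and unit variance; the exact first moment is not needed. -/
lemma integral_abs_gaussian_le : ∫ z : ℝ, |z| ∂(gaussianReal 0 1) ≤ 1 := by
  have hm : MemLp id 2 (gaussianReal 0 1) := memLp_id_gaussianReal 2
  have h2 : ∫ z : ℝ, z ^ 2 ∂(gaussianReal 0 1) = 1 := by
    have := variance_id_gaussianReal (μ := 0) (v := 1)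
    rw [variance_eq_sub hm] at this
    simpa [integral_id_gaussianReal] using this
  have hi : Integrable (fun z : ℝ => z ^ 2) (gaussianReal 0 1) := hm.integrable_sq
  have h3 : ∫ z : ℝ, |z| ∂(gaussianReal 0 1) ≤ ∫ z : ℝ, (1 / 2 + 1 / 2 * z ^ 2) ∂(gaussianReal 0 1) := by
    refine integral_mono (hm.integrable (by norm_num)).abs
      ((integrable_const _).add (hi.const_mul _)) fun z => ?_
    have := sq_nonneg (|z| - 1)
    simp only
    nlinarith [sq_abs z]
  rw [integral_add (integrable_const _) (hi.const_mul _), integral_const_mul, h2] at h3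
  simpa using h3.trans (by norm_num)

/-- With the common Gaussian z the two arguments differ by |√(2s) - √(2r)||z|, and g is Lipschitz.
For r = 0 this is the √ν-size error between the two transport velocities. -/
lemma SmoothCirc.abs_heat_sub_le {g : Circ → ℝ} (hg : SmoothCirc g) {s r : ℝ} (hs : 0 ≤ s)
    (hr : 0 ≤ r) (x : Circ) :
    |heat s g x - heat r g x| ≤ supDeriv 1 g * |√(2 * s) - √(2 * r)| := by
  rw [heat_eq hg.continuous hs, heat_eq hg.continuous hr,
    ← integral_sub (integrable_shift hg.continuous _ _ _) (integrable_shift hg.continuous _ _ _)]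
  have hm : MemLp id 2 (gaussianReal 0 1) := memLp_id_gaussianReal 2
  have hi : Integrable (fun z : ℝ => |z|) (gaussianReal 0 1) :=
    (hm.integrable (by norm_num)).abs
  rw [← Real.norm_eq_abs]
  refine (norm_integral_le_of_norm_le (hi.const_mul (supDeriv 1 g * |√(2 * s) - √(2 * r)|))
    (Eventually.of_forall fun z => ?_)).trans ?_
  · rw [Real.norm_eq_abs]
    refine (hg.abs_sub_le x _ _).trans (le_of_eq ?_)
    rw [← sub_mul, abs_mul]
    ring
  · rw [integral_const_mul]
    exact mul_le_of_le_one_right (mul_nonneg (supDeriv_nonneg _ _) (abs_nonneg _))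
      integral_abs_gaussian_le

lemma continuous_heat {g : Circ → ℝ} (hg : Continuous g) {s : ℝ} (hs : 0 ≤ s) :
    Continuous (heat s g) := by
  have h : heat s g = fun x => ∫ z : ℝ, g (x - ((√(2 * s) * z : ℝ) : Circ)) ∂(gaussianReal 0 1) :=
    funext fun x => heat_eq hg hs x
  rw [h]
  refine continuous_of_dominated (bound := fun _ => supDeriv 0 g)
    (fun x => (integrable_shift hg _ _ _).aestronglyMeasurable)
    (fun x => Eventually.of_forall fun z => abs_le_supDeriv_zero hg _)
    (integrable_const _) (Eventually.of_forall fun z => by fun_prop)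

/-- By Fubini each translation by z contributes a phase, whose Gaussian average is the
characteristic function at -j; variance 2s gives e^{-sj²}. -/
lemma fourierCoeff_heat {g : Circ → ℝ} (hg : Continuous g) {s : ℝ} (hs : 0 ≤ s) (j : ℤ) :
    fourierCoeff (toC (heat s g) (continuous_heat hg hs)) j =
      exp (-(s * (j : ℝ) ^ 2)) * fourierCoeff (toC g hg) j := by
  have c0 : Continuous fun x : ℝ => (x : Circ) := continuous_quotient_mk'
  set γ := gaussianReal 0 (2 * s).toNNReal with hγ
  have h1 : fourierCoeff (toC (heat s g) (continuous_heat hg hs)) j =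
      ∫ x : Circ, ∫ z : ℝ, fourier (-j) x * (g (x - (z : Circ)) : ℂ) ∂γ ∂haarAddCircle := by
    rw [fourierCoeff]
    refine integral_congr_ae (Eventually.of_forall fun x => ?_)
    simp only [toC, ContinuousMap.coe_mk, heat, smul_eq_mul]
    rw [integral_const_mul, integral_complex_ofReal]
  have hF : Continuous (Function.uncurry fun (x : Circ) (z : ℝ) =>
      fourier (-j) x * (g (x - (z : Circ)) : ℂ)) := by
    unfold Function.uncurry
    fun_prop
  have hint : Integrable (Function.uncurry fun (x : Circ) (z : ℝ) =>
      fourier (-j) x * (g (x - (z : Circ)) : ℂ)) (haarAddCircle.prod γ) := by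
    refine Integrable.of_bound hF.aestronglyMeasurable (supDeriv 0 g)
      (Eventually.of_forall fun p => ?_)
    simp only [Function.uncurry, norm_mul, Complex.norm_real, Real.norm_eq_abs]
    rw [fourier_apply, Circle.norm_coe, one_mul]
    exact abs_le_supDeriv_zero hg _
  rw [h1, integral_integral_swap hint]
  have h2 : ∀ z : ℝ, ∫ x : Circ, fourier (-j) x * (g (x - (z : Circ)) : ℂ) ∂haarAddCircle =
      fourier (-j) (z : Circ) * fourierCoeff (toC g hg) j := by
    intro z
    rw [← integral_add_right_eq_self _ (z : Circ), fourierCoeff, ← integral_const_mul]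
    refine integral_congr_ae (Eventually.of_forall fun x => ?_)
    simp only [add_sub_cancel_right, fourier_add_arg, toC, ContinuousMap.coe_mk, smul_eq_mul]
    ring
  simp only [h2]
  rw [integral_mul_const]
  congr 1
  have h3 : ∫ z : ℝ, fourier (-j) (z : Circ) ∂γ = charFun γ (-(j : ℝ)) := by
    rw [charFun_apply_real]
    refine integral_congr_ae (Eventually.of_forall fun z => ?_)
    simp only [fourier_coe_apply]
    congr 1
    have hπ : (π : ℂ) ≠ 0 := by exact_mod_cast Real.pi_ne_zero
    push_cast
    field_simp
  rw [h3, charFun_gaussianReal, Complex.ofReal_exp]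
  congr 1
  rw [Real.coe_toNNReal _ (by positivity)]
  push_cast
  ring

/-- The heat flow commutes with differentiation, so the commutator of the evolved velocity is
multiplication by the evolved g', still bounded by ‖g'‖_∞. -/
lemma fourierCoeff_heat_circDeriv {g : Circ → ℝ} (hg : SmoothCirc g) {s : ℝ} (hs : 0 ≤ s) (j : ℤ) :
    fourierCoeff (toC (heat s (circDeriv g)) (continuous_heat hg.circDeriv.continuous hs)) j =
      Complex.I * j * fourierCoeff (toC (heat s g) (continuous_heat hg.continuous hs)) j := by
  rw [fourierCoeff_heat hg.circDeriv.continuous hs, fourierCoeff_heat hg.continuous hs,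
    fourierCoeff_circDeriv hg]
  ring

end ShearFlow

namespace ShearFlow

open ComplexConjugate AddCircle

/-! ### Slices at a fixed first frequency -/

lemma integrable_mul_continuous {n : ℕ} {v : Torus n → ℂ} (hv : MemLp v 2 volume)
    {h : Torus n → ℂ} (hh : Continuous h) : Integrable (fun x => v x * h x) volume := by
  obtain ⟨C, hC⟩ := (isCompact_range hh.norm).bddAbove
  exact (hv.integrable (by norm_num)).mul_bdd (c := C) hh.aestronglyMeasurable
    (Eventually.of_forall fun x => hC ⟨x, rfl⟩)

lemma ccoeff_sub {n : ℕ} {u v : Torus n → ℂ} (hu : MemLp u 2 volume) (hv : MemLp v 2 volume)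
    (K : Fin n → ℤ) : ccoeff (fun x => u x - v x) K = ccoeff u K - ccoeff v K := by
  simp only [ccoeff, sub_mul]
  rw [integral_sub (integrable_mul_continuous hu (expo (-K)).continuous)
    (integrable_mul_continuous hv (expo (-K)).continuous), smul_sub]

lemma injective_slice (k : ℤ) : Function.Injective fun m : ℤ => (![k, m] : Fin 2 → ℤ) := by
  intro m n h
  exact congrFun h 1

/-- The function of the second variable that carries the frequencies `(k, ·)` of `v`. -/
noncomputable def slice (v : Torus 2 → ℂ) (k : ℤ) : CircL2 :=
  Classical.epsilon fun x : CircL2 => ∀ m, fourierBasis.repr x m = ccoeff v ![k, m]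

lemma repr_slice {v : Torus 2 → ℂ} (hv : MemLp v 2 volume) (k m : ℤ) :
    fourierBasis.repr (slice v k) m = ccoeff v ![k, m] := by
  have hs : Summable fun m : ℤ => ‖ccoeff v ![k, m]‖ ^ 2 := by
    have h := (hasSum_ccoeff_sq hv).summable
    have h2 := (summable_mul_left_iff (two_pi_pow_pos 2).ne').mp h
    exact h2.comp_injective (injective_slice k)
  exact Classical.epsilon_spec (p := fun x : CircL2 => ∀ m, fourierBasis.repr x m = ccoeff v ![k, m])
    (exists_repr_eq fourierBasis hs) m

/-- The choice in `slice` depends on its argument only through Fourier coefficients, so no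
integrability is needed. -/
lemma slice_congr {u v : Torus 2 → ℂ} (h : u =ᵐ[volume] v) (k : ℤ) : slice u k = slice v k := by
  have h1 : ∀ K, ccoeff u K = ccoeff v K := by
    intro K
    unfold ccoeff
    congr 1
    refine integral_congr_ae ?_
    filter_upwards [h] with x hx
    rw [hx]
  unfold slice
  simp only [h1]

lemma norm_slice_sub_le {u v : Torus 2 → ℂ} (hu : MemLp u 2 volume) (hv : MemLp v 2 volume)
    (k : ℤ) : ‖slice u k - slice v k‖ ≤ (eLpNorm (fun x => u x - v x) 2 volume).toReal := by
  have huv : MemLp (fun x => u x - v x) 2 volume := hu.sub hv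
  have h1 := hasSum_repr_sq fourierBasis (slice u k - slice v k)
  have h2 := hasSum_repr_sq (expoBasis 2) (huv.toLp _)
  rw [← Lp.norm_toLp _ huv]
  refine (sq_le_sq₀ (norm_nonneg _) (norm_nonneg _)).mp ?_
  refine hasSum_le_inj (fun m : ℤ => (![k, m] : Fin 2 → ℤ)) (injective_slice k)
    (fun _ _ => by positivity) (fun m => ?_) h1 h2
  rw [expoBasis_repr huv, ccoeff_sub hu hv, map_sub, lp.coeFn_sub, Pi.sub_apply, repr_slice hu,
    repr_slice hv, norm_mul, mul_pow, Complex.norm_real, Real.norm_eq_abs, sq_abs,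
    Real.sq_sqrt (two_pi_pow_pos 2).le]
  -- The full L² norm carries an extra (2π)² ≥ 1, which is dropped.
  refine le_mul_of_one_le_left (by positivity) (one_le_pow₀ ?_)
  linarith [Real.two_le_pi]

/-- Multiplication by a function of the second variable acts on slices. -/
lemma ccoeff_mul_eq_repr (G : C(Circ, ℂ)) {v : Torus 2 → ℂ} (hv : MemLp v 2 volume) (k m : ℤ) :
    ccoeff (fun y => G (y 1) * v y) ![k, m] = fourierBasis.repr (mulOp G (slice v k)) m := by
  have hc : ∀ G : C(Circ, ℂ), Continuous fun y : Torus 2 => G (y 1) * expo (-![k, m]) y :=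
    fun G => by fun_prop
  have hint : ∀ G : C(Circ, ℂ), Integrable
      (fun y : Torus 2 => v y * (G (y 1) * expo (-![k, m]) y)) volume :=
    fun G => integrable_mul_continuous hv (hc G)
  let Λ₀ : C(Circ, ℂ) →ₗ[ℂ] ℂ :=
    { toFun := fun G => ∫ y : Torus 2, v y * (G (y 1) * expo (-![k, m]) y)
      map_add' := fun G₁ G₂ => by
        rw [← integral_add (hint _) (hint _)]
        congr 1; ext y
        simp only [ContinuousMap.add_apply]; ring
      map_smul' := fun c G => by
        rw [RingHom.id_apply, smul_eq_mul, ← integral_const_mul]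
        congr 1; ext y
        simp only [ContinuousMap.smul_apply, smul_eq_mul]; ring }
  let Λ : C(Circ, ℂ) →L[ℂ] ℂ := Λ₀.mkContinuous (∫ y : Torus 2, ‖v y‖) fun G => by
    change ‖∫ y : Torus 2, v y * (G (y 1) * expo (-![k, m]) y)‖ ≤ _
    rw [← integral_mul_const]
    refine norm_integral_le_of_norm_le ((hv.integrable (by norm_num)).norm.mul_const _)
      (Eventually.of_forall fun y => ?_)
    rw [norm_mul, norm_mul, norm_expo, mul_one]
    exact mul_le_mul_of_nonneg_left (G.norm_coe_le_norm _) (norm_nonneg _)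
  let R : C(Circ, ℂ) →L[ℂ] ℂ :=
    (innerSL ℂ (fourierBasis (T := 2 * π) m)).comp (mulOp.flip (slice v k))
  have hR : ∀ G, R G = fourierBasis.repr (mulOp G (slice v k)) m := fun G => by
    rw [HilbertBasis.repr_apply_apply]; rfl
  have hdense : Dense ((Submodule.span ℂ (range (fourier (T := 2 * π))) : Submodule ℂ C(Circ, ℂ))
      : Set C(Circ, ℂ)) := by
    rw [Submodule.dense_iff_topologicalClosure_eq_top]
    exact span_fourier_closure_eq_top
  -- Both sides are continuous and linear in G, so they need comparing only for G an exponential,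
  -- where both shift the frequency m to m - j.
  have hmain : (((2 * π : ℝ) ^ 2)⁻¹ : ℝ) • Λ = R := by
    refine ContinuousLinearMap.ext_on hdense ?_
    rintro _ ⟨j, rfl⟩
    rw [hR, repr_mulOp_fourier, repr_slice hv]
    change (((2 * π : ℝ) ^ 2)⁻¹ : ℝ) • (∫ y : Torus 2, v y * (fourier j (y 1) * expo (-![k, m]) y)) = _
    rw [ccoeff]
    congr 2
    ext y
    congr 1
    simp only [expo_apply, Fin.prod_univ_two, Pi.neg_apply, Matrix.cons_val_zero,
      Matrix.cons_val_one]
    rw [show -(m - j) = j + -m by ring, fourier_add]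
    ring
  rw [← hR, ← hmain, ccoeff]
  change _ = (((2 * π : ℝ) ^ 2)⁻¹ : ℝ) • (∫ y : Torus 2, v y * (G (y 1) * expo (-![k, m]) y))
  congr 2
  ext y
  ring

/-! ### Trigonometric test functions -/

lemma hasDerivAt_expo_single {n : ℕ} (K : Fin n → ℤ) (x : Torus n) (i : Fin n) :
    HasDerivAt (fun s : ℝ => expo K (x + Pi.single i (s : Circ)))
      (Complex.I * K i * expo K x) 0 := by
  have h := (_root_.hasDerivAt_fourier (2 * π) (K i) 0).const_mul (expo K x)
  have hπ : ((2 * π : ℝ) : ℂ) ≠ 0 := by exact_mod_cast Real.two_pi_pos.ne'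
  have e : (fun s : ℝ => expo K (x + Pi.single i (s : Circ))) =
      fun s : ℝ => expo K x * fourier (K i) (s : Circ) := by
    funext s
    rw [expo_add_arg, expo_single]
  rw [e]
  convert! h using 1
  rw [QuotientAddGroup.mk_zero, fourier_eval_zero]
  push_cast at hπ ⊢
  field_simp

/-- The real trigonometric function `Re (c e^{i K·x})`. -/
noncomputable def trig {n : ℕ} (K : Fin n → ℤ) (c : ℂ) : Torus n → ℝ :=
  fun x => (c * expo K x).re

lemma pderiv_trig {n : ℕ} (K : Fin n → ℤ) (c : ℂ) (i : Fin n) :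
    pderiv i (trig K c) = trig K (Complex.I * K i * c) := by
  ext x
  have h := ((hasDerivAt_expo_single K x i).const_mul c)
  have h2 : HasDerivAt (fun s : ℝ => trig K c (x + Pi.single i (s : Circ)))
      (c * (Complex.I * K i * expo K x)).re 0 :=
    Complex.reCLM.hasFDerivAt.comp_hasDerivAt 0 h
  rw [pderiv, h2.deriv, trig]
  congr 1
  ring

lemma contDiff_expo {n : ℕ} (K : Fin n → ℤ) :
    ContDiff ℝ ∞ (fun v : Fin n → ℝ => expo K (fun i => (v i : Circ))) := by
  simp only [expo_apply, fourier_coe_apply]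
  refine contDiff_prod fun i _ => ?_
  refine ContDiff.cexp ?_
  have h1 : ContDiff ℝ ∞ (fun v : Fin n → ℝ => ((v i : ℝ) : ℂ)) :=
    Complex.ofRealCLM.contDiff.comp (contDiff_apply ℝ ℝ i)
  exact (contDiff_const.mul h1).div_const _

lemma smooth_trig {n : ℕ} (K : Fin n → ℤ) (c : ℂ) : Smooth (trig K c) :=
  Complex.reCLM.contDiff.comp (contDiff_const.mul (contDiff_expo K))

lemma integral_mul_trig {n : ℕ} {v : Torus n → ℝ} (hv : MemLp v 2 volume) (K : Fin n → ℤ) (c : ℂ) :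
    ∫ x, v x * trig (-K) c x = (c * ((2 * π : ℝ) ^ n * coeff v K)).re := by
  have hv' : MemLp (fun x => (v x : ℂ)) 2 volume := hv.ofReal
  have h1 : ((2 * π : ℝ) ^ n : ℂ) * coeff v K = ∫ x, (v x : ℂ) * expo (-K) x := by
    have h0 : ((2 * π : ℝ) ^ n : ℂ) ≠ 0 := by exact_mod_cast (two_pi_pow_pos n).ne'
    rw [coeff_eq_ccoeff, ccoeff, Complex.real_smul, ← mul_assoc, Complex.ofReal_inv,
      Complex.ofReal_pow, mul_inv_cancel₀ h0, one_mul]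
  have h2 := integrable_mul_continuous hv' (expo (-K)).continuous
  rw [h1, ← integral_const_mul]
  have h3 := integral_re (h2.const_mul c)
  simp only [RCLike.re_to_complex] at h3
  rw [← h3]
  congr 1
  ext x
  rw [trig, show c * ((v x : ℂ) * expo (-K) x) = (v x : ℂ) * (c * expo (-K) x) by ring,
    Complex.re_ofReal_mul]

end ShearFlow

namespace ShearFlow

open ComplexConjugate AddCircle

/-! ### The Navier–Stokes profile as a family of trajectories -/

/-- The heat evolution of `g` as a family of continuous functions. -/
noncomputable def heatC (g : Circ → ℝ) (hg : Continuous g) (s : ℝ) : C(Circ, ℂ) :=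
  -- Truncating at 0 gives a family continuous on all of ℝ; only s ≥ 0 is meaningful.
  toC (heat (max s 0) g) (continuous_heat hg (le_max_right _ _))

lemma heatC_apply {g : Circ → ℝ} (hg : Continuous g) {s : ℝ} (hs : 0 ≤ s) (x : Circ) :
    heatC g hg s x = (heat s g x : ℂ) := by
  simp [heatC, toC, max_eq_left hs]

lemma SmoothCirc.norm_heatC_sub_le {g : Circ → ℝ} (hg : SmoothCirc g) (s r : ℝ) :
    ‖heatC g hg.continuous s - heatC g hg.continuous r‖ ≤
      supDeriv 1 g * |√(2 * max s 0) - √(2 * max r 0)| := by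
  refine (ContinuousMap.norm_le _ (mul_nonneg (supDeriv_nonneg _ _) (abs_nonneg _))).mpr
    fun x => ?_
  have h := hg.abs_heat_sub_le (le_max_right s 0) (le_max_right r 0) x
  rw [ContinuousMap.sub_apply, heatC, heatC, toC, toC, ContinuousMap.coe_mk, ContinuousMap.coe_mk,
    ← Complex.ofReal_sub, Complex.norm_real, Real.norm_eq_abs]
  exact h

lemma SmoothCirc.continuous_heatC {g : Circ → ℝ} (hg : SmoothCirc g) :
    Continuous (heatC g hg.continuous) := by
  rw [continuous_iff_continuousAt]
  intro r
  rw [ContinuousAt, tendsto_iff_norm_sub_tendsto_zero]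
  have h1 : Tendsto (fun s : ℝ => supDeriv 1 g * |√(2 * max s 0) - √(2 * max r 0)|) (𝓝 r)
      (𝓝 (supDeriv 1 g * |√(2 * max r 0) - √(2 * max r 0)|)) := by
    refine Continuous.tendsto (f := fun s : ℝ => supDeriv 1 g * |√(2 * max s 0) - √(2 * max r 0)|)
      ?_ r
    fun_prop
  rw [sub_self, abs_zero, mul_zero] at h1
  exact squeeze_zero (fun _ => norm_nonneg _) (fun s => hg.norm_heatC_sub_le s r) h1

lemma ContInL2.continuousOn_slice {F : ℝ → Torus 2 → ℝ} (hF : ContInL2 (Ici 0) F) (k : ℤ) :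
    ContinuousOn (fun t => slice (fun y => (F t y : ℂ)) k) (Ici 0) := by
  intro t₀ ht₀
  have hm : ∀ t ∈ Ici (0 : ℝ), MemLp (fun y => (F t y : ℂ)) 2 volume := fun t ht =>
    (hF.1 t ht).ofReal
  rw [ContinuousWithinAt, tendsto_iff_norm_sub_tendsto_zero]
  have h1 := (ENNReal.tendsto_toReal ENNReal.zero_ne_top).comp (hF.2 t₀ ht₀)
  rw [ENNReal.toReal_zero] at h1
  refine squeeze_zero' (Eventually.of_forall fun _ => norm_nonneg _) ?_ h1
  filter_upwards [self_mem_nhdsWithin] with t ht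
  refine (norm_slice_sub_le (hm t ht) (hm t₀ ht₀) k).trans (le_of_eq ?_)
  rw [Function.comp_apply]
  congr 1
  refine eLpNorm_congr_norm_ae (Eventually.of_forall fun y => ?_)
  rw [← Complex.ofReal_sub, Complex.norm_real, Pi.sub_apply]

/-- The damping rates of the mode `(k, m)`. -/
noncomputable def damping (lam : ℤ) (ν : ℝ) (k m : ℤ) : ℝ :=
  ν * (((lam : ℝ) ^ 2 + 1) * (k : ℝ) ^ 2 + (m : ℝ) ^ 2)

lemma memLp_mul_fst {h : Circ → ℝ} (hh : Continuous h) {v : Torus 2 → ℝ} (hv : MemLp v 2 volume) :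
    MemLp (fun y => h (y 1) * v y) 2 volume := by
  have hm : Continuous fun y : Torus 2 => h (y 1) := by fun_prop
  exact hv.mul (p := ⊤) (MemLp.of_bound hm.aestronglyMeasurable (supDeriv 0 h)
    (Eventually.of_forall fun y => abs_le_supDeriv_zero hh _))

/-- Test the weak formulation with real parts of c e^{-iK·y}. Two derivatives give the damping with
a minus sign. The first-order term gives +ik times the coefficient of the product with the heat
flow, which is `mulOp` acting on the slice. -/
theorem IsProfile.isModeTraj {lam : ℤ} {ν : ℝ} {f : Torus 2 → ℝ} {g : Circ → ℝ}
    {F : ℝ → Torus 2 → ℝ} (hF : IsProfile lam ν f g F) (hg : SmoothCirc g) (hν : 0 < ν) (k : ℤ) :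
    IsModeTraj fourierBasis (damping lam ν k) k
      (fun s => mulOp (heatC g hg.continuous (ν * s)))
      (fun t => slice (fun y => (F t y : ℂ)) k) := by
  have hm : ∀ t, 0 ≤ t → MemLp (fun y => (F t y : ℂ)) 2 volume := fun t ht =>
    (hF.cont.1 t ht).ofReal
  have hc := hF.cont.continuousOn_slice k
  have hcT : ContinuousOn (fun s => mulOp (heatC g hg.continuous (ν * s))
      (slice (fun y => (F s y : ℂ)) k)) (Ici 0) := by
    have h1 : Continuous fun s : ℝ => mulOp (heatC g hg.continuous (ν * s)) :=
      mulOp.continuous.comp (hg.continuous_heatC.comp (by fun_prop))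
    exact h1.continuousOn.clm_apply hc
  refine ⟨hc, hcT, fun m t ht => ?_⟩
  set a : ℝ → ℂ := fun s => fourierBasis.repr (slice (fun y => (F s y : ℂ)) k) m with ha
  set b : ℝ → ℂ := fun s => fourierBasis.repr (mulOp (heatC g hg.continuous (ν * s))
      (slice (fun y => (F s y : ℂ)) k)) m with hb
  have hac : ContinuousOn a (Ici 0) := (continuous_repr _ m).comp_continuousOn hc
  have hbc : ContinuousOn b (Ici 0) := (continuous_repr _ m).comp_continuousOn hcT
  have haK : ∀ s, 0 ≤ s → coeff (F s) ![k, m] = a s := fun s hs =>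
    (repr_slice (hm s hs) k m).symm
  have hbK : ∀ s, 0 ≤ s → coeff (fun y => heat (ν * s) g (y 1) * F s y) ![k, m] = b s := by
    intro s hs
    rw [hb]
    simp only
    rw [← ccoeff_mul_eq_repr _ (hm s hs), coeff_eq_ccoeff]
    congr 1
    ext y
    rw [heatC_apply _ (by positivity)]
    push_cast
    rfl
  have hf0 : MemLp f 2 volume := (memLp_congr_ae hF.init).mp (hF.cont.1 0 (mem_Ici.mpr le_rfl))
  have hfa : coeff f ![k, m] = a 0 := by
    rw [← haK 0 le_rfl]
    unfold coeff
    congr 1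
    refine integral_congr_ae ?_
    filter_upwards [hF.init] with y hy
    rw [hy]
  set h : ℝ → ℂ := fun s => -(damping lam ν k m : ℂ) * a s + Complex.I * (k : ℝ) * b s with hh
  have hhc : ContinuousOn h (Ici 0) :=
    (continuousOn_const.mul hac).add (continuousOn_const.mul hbc)
  have hspace : ∀ (c : ℂ) (s : ℝ), 0 ≤ s → ∫ y, F s y *
        (ν * (((lam : ℝ) ^ 2 + 1) * pderiv 0 (pderiv 0 (trig (-![k, m]) c)) y +
          pderiv 1 (pderiv 1 (trig (-![k, m]) c)) y)
          - heat (ν * s) g (y 1) * pderiv 0 (trig (-![k, m]) c) y) =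
        (c * ((2 * π : ℝ) ^ 2 * h s)).re := by
    intro c s hs
    have hFs := hF.cont.1 s hs
    have hGF := memLp_mul_fst (continuous_heat hg.continuous (by positivity : 0 ≤ ν * s)) hFs
    have hint : ∀ {v : Torus 2 → ℝ} (_ : MemLp v 2 volume) (c : ℂ),
        Integrable (fun y => v y * trig (-![k, m]) c y) volume := by
      intro v hv c
      have h1 := integrable_mul_continuous (hv.ofReal (K := ℂ))
        (h := fun y => ((trig (-![k, m]) c y : ℝ) : ℂ)) (by
          have : Continuous (trig (-![k, m]) c) := by unfold trig; fun_prop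
          exact Complex.continuous_ofReal.comp this)
      simpa using h1.re
    simp only [pderiv_trig]
    set c₀ : ℂ := Complex.I * ((-![k, m]) 0 : ℤ) * c with hc₀
    set c₁ : ℂ := Complex.I * ((-![k, m]) 0 : ℤ) * c₀ with hc₁
    set c₂ : ℂ := Complex.I * ((-![k, m]) 1 : ℤ) * (Complex.I * ((-![k, m]) 1 : ℤ) * c) with hc₂
    have i1 : Integrable (fun y => ν * ((lam : ℝ) ^ 2 + 1) * (F s y * trig (-![k, m]) c₁ y)) volume :=
      (hint hFs _).const_mul _
    have i2 : Integrable (fun y => ν * (F s y * trig (-![k, m]) c₂ y)) volume :=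
      (hint hFs _).const_mul _
    have e1 : (fun y => F s y * (ν * (((lam : ℝ) ^ 2 + 1) * trig (-![k, m]) c₁ y +
          trig (-![k, m]) c₂ y) - heat (ν * s) g (y 1) * trig (-![k, m]) c₀ y)) =
        fun y => (ν * ((lam : ℝ) ^ 2 + 1) * (F s y * trig (-![k, m]) c₁ y) +
          ν * (F s y * trig (-![k, m]) c₂ y)) -
          (heat (ν * s) g (y 1) * F s y) * trig (-![k, m]) c₀ y := by
      ext y; ring
    have i3 : Integrable (fun y => ν * ((lam : ℝ) ^ 2 + 1) * (F s y * trig (-![k, m]) c₁ y) +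
        ν * (F s y * trig (-![k, m]) c₂ y)) volume := i1.add i2
    rw [e1, integral_sub i3 (hint hGF _), integral_add i1 i2, integral_const_mul,
      integral_const_mul, integral_mul_trig hFs, integral_mul_trig hFs, integral_mul_trig hGF,
      haK s hs, hbK s hs]
    simp only [hh, damping, hc₁, hc₂, hc₀]
    rw [← Complex.re_ofReal_mul, ← Complex.re_ofReal_mul, ← Complex.add_re, ← Complex.sub_re]
    congr 1
    simp only [Pi.neg_apply, Matrix.cons_val_zero, Matrix.cons_val_one]
    push_cast
    linear_combination (ν * ((lam : ℂ) ^ 2 + 1) * k ^ 2 * c * ((2 * π) ^ 2 * a s) +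
      ν * m ^ 2 * c * ((2 * π) ^ 2 * a s)) * Complex.I_mul_I
  have hweak : ∀ c : ℂ, (c * ((2 * π : ℝ) ^ 2 * a t)).re =
      (c * ((2 * π : ℝ) ^ 2 * (a 0 + ∫ s in (0 : ℝ)..t, h s))).re := by
    intro c
    have h1 := hF.weak (trig (-![k, m]) c) (smooth_trig _ _) t ht
    rw [integral_mul_trig (hF.cont.1 t ht), integral_mul_trig hf0, haK t ht, hfa] at h1
    have h2 : ∫ s in (0 : ℝ)..t, ∫ y, F s y *
        (ν * (((lam : ℝ) ^ 2 + 1) * pderiv 0 (pderiv 0 (trig (-![k, m]) c)) y +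
          pderiv 1 (pderiv 1 (trig (-![k, m]) c)) y)
          - heat (ν * s) g (y 1) * pderiv 0 (trig (-![k, m]) c) y) =
        ∫ s in (0 : ℝ)..t, (c * ((2 * π : ℝ) ^ 2 * h s)).re := by
      refine intervalIntegral.integral_congr fun s hs => ?_
      rw [uIcc_of_le ht] at hs
      exact hspace c s hs.1
    have hI : IntervalIntegrable (fun s => c * ((2 * π : ℝ) ^ 2 * h s)) volume 0 t :=
      intervalIntegrable_of_continuousOn_Ici
        (continuousOn_const.mul (continuousOn_const.mul hhc)) ht
    have h3 := Complex.reCLM.intervalIntegral_comp_comm hI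
    simp only [Complex.reCLM_apply, intervalIntegral.integral_const_mul] at h3
    rw [h2, h3] at h1
    rw [h1, ← Complex.add_re]
    congr 1
    ring
  have hfin : ((2 * π : ℝ) ^ 2 : ℂ) * a t =
      (2 * π : ℝ) ^ 2 * (a 0 + ∫ s in (0 : ℝ)..t, h s) := by
    -- The choices c = 1 and c = -i recover the real and the imaginary part.
    refine Complex.ext ?_ ?_
    · simpa using hweak 1
    · simpa using hweak (-Complex.I)
  have h0 : ((2 * π : ℝ) ^ 2 : ℂ) ≠ 0 := by exact_mod_cast (two_pi_pow_pos 2).ne'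
  exact mul_left_cancel₀ h0 hfin

/-! ### The Euler profile -/

/-- The shear map `y ↦ (y₁ + c(y₂), y₂)`. -/
noncomputable def shearMap (c : Circ → Circ) (y : Torus 2) : Torus 2 := ![y 0 + c (y 1), y 1]

/-- A skew product of translations. The general result moves the second factor, hence the swaps. -/
lemma measurePreserving_shearMap {c : Circ → Circ} (hc : Continuous c) :
    MeasurePreserving (shearMap c) volume volume := by
  have h1 := volume_preserving_finTwoArrow Circ
  have h2 : MeasurePreserving (fun p : Circ × Circ => (p.1, p.2 + c p.1))
      ((volume : Measure Circ).prod volume) ((volume : Measure Circ).prod volume) := by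
    refine (MeasurePreserving.id volume).skew_product (g := fun x y => y + c x) ?_ ?_
    · have : Continuous (Function.uncurry fun x y : Circ => y + c x) := by
        unfold Function.uncurry; fun_prop
      exact this.measurable
    · exact Eventually.of_forall fun x => map_add_right_eq_self volume (c x)
  have hs := Measure.measurePreserving_swap (μ := (volume : Measure Circ))
    (ν := (volume : Measure Circ))
  have h3 := (h1.symm).comp (hs.comp (h2.comp (hs.comp h1)))
  convert h3 using 1
  ext y i
  fin_cases i <;> rfl

/-- Change variables by the shear: the exponential picks up the phase e^{ikc(y₂)}, and c depends
only on the coordinate that the shear fixes. -/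
lemma ccoeff_comp_shearMap {c : Circ → Circ} (hc : Continuous c) {v : Torus 2 → ℂ}
    (hv : MemLp v 2 volume) (k m : ℤ) :
    ccoeff (fun y => v (shearMap c y)) ![k, m] =
      ccoeff (fun y => fourier k (c (y 1)) * v y) ![k, m] := by
  have hmp := measurePreserving_shearMap hc
  unfold ccoeff
  congr 1
  have h1 : ∀ y : Torus 2, v (shearMap c y) * expo (-![k, m]) y =
      fourier k (c ((shearMap c y) 1)) * v (shearMap c y) * expo (-![k, m]) (shearMap c y) := by
    intro y
    have h2 : fourier k (c (y 1)) * expo (-![k, m]) (shearMap c y) = expo (-![k, m]) y := by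
      simp only [expo_apply, Fin.prod_univ_two, Pi.neg_apply, Matrix.cons_val_zero,
        Matrix.cons_val_one, shearMap, fourier_add_arg]
      have h3 : fourier k (c (y 1)) * fourier (-k) (c (y 1)) = 1 := by
        rw [← fourier_add, add_neg_cancel, fourier_zero]
      linear_combination (fourier (-k) (y 0) * fourier (-m) (y 1)) * h3
    have h4 : (shearMap c y) 1 = y 1 := rfl
    rw [← h2, h4]
    ring
  simp only [h1]
  have hae : AEStronglyMeasurable (fun y : Torus 2 => fourier k (c (y 1)) * v y * expo (-![k, m]) y)
      (Measure.map (shearMap c) volume) := by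
    rw [hmp.map_eq]
    have hcc : Continuous fun y : Torus 2 => fourier k (c (y 1)) := by fun_prop
    exact (hcc.aestronglyMeasurable.mul hv.aestronglyMeasurable).mul
      (expo (-![k, m])).continuous.aestronglyMeasurable
  rw [← integral_map (f := fun y : Torus 2 => fourier k (c (y 1)) * v y * expo (-![k, m]) y)
    hmp.measurable.aemeasurable hae, hmp.map_eq]

/-- The Euler profile `f(y₁ + t g(y₂), y₂)`. -/
noncomputable def eulerProfile (f : Torus 2 → ℝ) (g : Circ → ℝ) (t : ℝ) : Torus 2 → ℝ :=
  fun y => f (shearMap (fun z => ((t * g z : ℝ) : Circ)) y)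

lemma continuous_shift {g : Circ → ℝ} (hg : Continuous g) (t : ℝ) :
    Continuous fun z : Circ => ((t * g z : ℝ) : Circ) := by
  have c0 : Continuous fun x : ℝ => (x : Circ) := continuous_quotient_mk'
  exact c0.comp (continuous_const.mul hg)

lemma memLp_eulerProfile {f : Torus 2 → ℝ} (hf : MemLp f 2 volume) {g : Circ → ℝ}
    (hg : Continuous g) (t : ℝ) : MemLp (eulerProfile f g t) 2 volume :=
  hf.comp_measurePreserving (measurePreserving_shearMap (continuous_shift hg t))

lemma mulOp_mul (G₁ G₂ : C(Circ, ℂ)) (x : CircL2) : mulOp (G₁ * G₂) x = mulOp G₁ (mulOp G₂ x) := by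
  apply Lp.ext
  filter_upwards [coeFn_mulOp (G₁ * G₂) x, coeFn_mulOp G₁ (mulOp G₂ x), coeFn_mulOp G₂ x]
    with y h1 h2 h3
  rw [h1, h2, h3, ContinuousMap.mul_apply, mul_assoc]

lemma exp_continuousMap_apply (G : C(Circ, ℂ)) (x : Circ) :
    NormedSpace.exp G x = Complex.exp (G x) := by
  have h := NormedSpace.map_exp (ContinuousMap.evalAlgHom ℂ ℂ x) (continuous_eval_const x) G
  rw [Complex.exp_eq_exp_ℂ]
  exact h

/-- At first frequency k, transport by t g is multiplication by e^{iktg}, written as an exponential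
in the Banach algebra C(𝕋, ℂ) so that it can be differentiated in t. -/
lemma slice_eulerProfile {f : Torus 2 → ℝ} (hf : MemLp f 2 volume) {g : Circ → ℝ}
    (hg : Continuous g) (t : ℝ) (k : ℤ) :
    slice (fun y => (eulerProfile f g t y : ℂ)) k =
      mulOp (NormedSpace.exp (t • ((Complex.I * k) • toC g hg)))
        (slice (fun y => (f y : ℂ)) k) := by
  refine repr_ext fourierBasis fun m => ?_
  have hf' : MemLp (fun y => (f y : ℂ)) 2 volume := hf.ofReal
  have hE : MemLp (fun y => (eulerProfile f g t y : ℂ)) 2 volume :=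
    (memLp_eulerProfile hf hg t).ofReal
  rw [repr_slice hE, ← ccoeff_mul_eq_repr _ hf']
  have h := ccoeff_comp_shearMap (continuous_shift hg t) hf' k m
  refine h.trans ?_
  congr 1
  ext y
  congr 1
  rw [exp_continuousMap_apply, fourier_coe_apply]
  congr 1
  simp only [ContinuousMap.smul_apply, toC, ContinuousMap.coe_mk, smul_eq_mul, Complex.real_smul]
  have hπ : (π : ℂ) ≠ 0 := by exact_mod_cast Real.pi_ne_zero
  push_cast
  field_simp

/-- The velocity is bounded on each slice, so t ↦ e^{iktg} is differentiable in operator norm and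
the equation holds in L²(𝕋) without any regularity of f. -/
theorem isModeTraj_eulerProfile {f : Torus 2 → ℝ} (hf : MemLp f 2 volume) {g : Circ → ℝ}
    (hg : Continuous g) (k : ℤ) :
    IsModeTraj fourierBasis (fun _ => 0) k (fun _ => mulOp (toC g hg))
      (fun t => slice (fun y => (eulerProfile f g t y : ℂ)) k) := by
  set x := (Complex.I * k) • toC g hg with hx
  set v := slice (fun y => (f y : ℂ)) k with hv
  have hd0 : ∀ t : ℝ, HasDerivAt (fun t : ℝ => NormedSpace.exp (t • x))
      (NormedSpace.exp (t • x) * x) t := fun t =>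
    hasDerivAt_exp_smul_const (𝕂 := ℝ) x t
  have hd : ∀ t : ℝ, HasDerivAt (fun t : ℝ => slice (fun y => (eulerProfile f g t y : ℂ)) k)
      ((Complex.I * k) • mulOp (toC g hg) (slice (fun y => (eulerProfile f g t y : ℂ)) k)) t := by
    intro t
    have h1 := (((mulOp.flip v).restrictScalars ℝ).hasFDerivAt.comp_hasDerivAt t (hd0 t))
    have h2 : (fun t : ℝ => slice (fun y => (eulerProfile f g t y : ℂ)) k) =
        fun t : ℝ => mulOp (NormedSpace.exp (t • x)) v := by
      funext t
      exact slice_eulerProfile hf hg t k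
    rw [h2]
    convert! h1 using 1
    change _ = mulOp (NormedSpace.exp (t • x) * x) v
    have h3 : mulOp x (mulOp (NormedSpace.exp (t • x)) v) =
        (Complex.I * k) • mulOp (toC g hg) (mulOp (NormedSpace.exp (t • x)) v) := by
      rw [hx, map_smul]
      rfl
    rw [mul_comm (NormedSpace.exp (t • x)) x, mulOp_mul, h3, slice_eulerProfile hf hg t k]
  have hc : Continuous fun t : ℝ => slice (fun y => (eulerProfile f g t y : ℂ)) k :=
    continuous_iff_continuousAt.mpr fun t => (hd t).continuousAt
  have hcT : Continuous fun t : ℝ => mulOp (toC g hg)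
      (slice (fun y => (eulerProfile f g t y : ℂ)) k) := (mulOp (toC g hg)).continuous.comp hc
  refine ⟨hc.continuousOn, hcT.continuousOn, fun m t ht => ?_⟩
  have hdm : ∀ t : ℝ, HasDerivAt
      (fun t : ℝ => fourierBasis.repr (slice (fun y => (eulerProfile f g t y : ℂ)) k) m)
      (-((0 : ℝ) : ℂ) * fourierBasis.repr (slice (fun y => (eulerProfile f g t y : ℂ)) k) m +
        Complex.I * (k : ℝ) * fourierBasis.repr (mulOp (toC g hg)
          (slice (fun y => (eulerProfile f g t y : ℂ)) k)) m) t := by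
    intro t
    have h1 := ((innerSL ℂ ((fourierBasis (T := 2 * π)) m)).restrictScalars
      ℝ).hasFDerivAt.comp_hasDerivAt t (hd t)
    simp only [HilbertBasis.repr_apply_apply]
    convert! h1 using 1
    simp
  have h4 := intervalIntegral.integral_eq_sub_of_hasDerivAt (a := 0) (b := t)
    (fun s _ => hdm s) ((Continuous.add (continuous_const.mul ((continuous_repr _ m).comp hc))
      (continuous_const.mul ((continuous_repr _ m).comp hcT))).intervalIntegrable _ _)
  rw [h4]
  ring

end ShearFlow

namespace ShearFlow

open ComplexConjugate AddCircle

/-! ### From resolvent weights to powers -/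

/-- `∫₀^∞ r^{l-2} · r/(r+1) dr`. -/
noncomputable def resConst (l : ℝ) : ℝ≥0∞ :=
  ∫⁻ r in Ioi (0 : ℝ), ENNReal.ofReal (r ^ (l - 2) * (r / (r + 1)))

lemma resConst_ne_zero (l : ℝ) : resConst l ≠ 0 := by
  rw [resConst, Ne, lintegral_eq_zero_iff' (by fun_prop)]
  intro h
  rw [Filter.EventuallyEq, ae_restrict_iff' measurableSet_Ioi] at h
  have h2 : (volume : Measure ℝ) (Ioi 0) = 0 := by
    refine measure_mono_null (fun r hr => ?_) h
    have hr0 : 0 < r := hr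
    have : 0 < r ^ (l - 2) * (r / (r + 1)) := by positivity
    simpa [hr0] using this
  simp at h2

/-- The integrand is at most r^{l-1} near 0 and r^{l-2} at infinity: convergence needs l > 0 at one
end and l < 1 at the other. -/
lemma resConst_ne_top {l : ℝ} (h0 : 0 < l) (h1 : l < 1) : resConst l ≠ ⊤ := by
  have hm : AEStronglyMeasurable (fun r : ℝ => r ^ (l - 2) * (r / (r + 1))) volume :=
    Measurable.aestronglyMeasurable (by fun_prop)
  have i1 : IntegrableOn (fun r : ℝ => r ^ (l - 2) * (r / (r + 1))) (Ioc 0 1) := by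
    have h2 : IntegrableOn (fun r : ℝ => r ^ (l - 1)) (Ioc 0 1) :=
      (intervalIntegrable_iff_integrableOn_Ioc_of_le zero_le_one).mp
        (intervalIntegral.intervalIntegrable_rpow' (by linarith))
    refine h2.mono' hm.restrict ?_
    rw [ae_restrict_iff' measurableSet_Ioc]
    refine Eventually.of_forall fun r hr => ?_
    have hr0 : 0 < r := hr.1
    rw [Real.norm_of_nonneg (by positivity), show l - 1 = (l - 2) + 1 by ring,
      Real.rpow_add_one hr0.ne']
    exact mul_le_mul_of_nonneg_left (div_le_self hr0.le (by linarith)) (by positivity)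
  have i2 : IntegrableOn (fun r : ℝ => r ^ (l - 2) * (r / (r + 1))) (Ioi 1) := by
    refine (integrableOn_Ioi_rpow_of_lt (a := l - 2) (by linarith) one_pos).mono' hm.restrict ?_
    rw [ae_restrict_iff' measurableSet_Ioi]
    refine Eventually.of_forall fun r hr => ?_
    have hr0 : 0 < r := one_pos.trans hr
    rw [Real.norm_of_nonneg (by positivity)]
    refine mul_le_of_le_one_right (by positivity) ?_
    rw [div_le_one (by positivity)]
    linarith
  have i3 := i1.union i2
  rw [Ioc_union_Ioi_eq_Ioi zero_le_one] at i3
  have h4 := i3.lintegral_lt_top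
  exact h4.ne

/-- Substituting s = x r extracts the factor x^l. At x = 0 both sides vanish because l > 0. -/
lemma lintegral_resolvent {l x : ℝ} (h0 : 0 < l) (hx : 0 ≤ x) :
    ∫⁻ s in Ioi (0 : ℝ), ENNReal.ofReal (s ^ (l - 2) * (s * x / (s + x))) =
      ENNReal.ofReal (x ^ l) * resConst l := by
  rcases hx.eq_or_lt with rfl | hx
  · simp [Real.zero_rpow h0.ne']
  · have himg : (fun r : ℝ => x * r) '' Ioi 0 = Ioi 0 := by
      rw [image_mul_left_Ioi hx, mul_zero]
    have h := lintegral_image_eq_lintegral_abs_deriv_mul (s := Ioi (0 : ℝ)) measurableSet_Ioi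
      (f := fun r : ℝ => x * r) (f' := fun _ => x)
      (fun r _ => by simpa using ((hasDerivAt_id r).const_mul x).hasDerivWithinAt)
      (fun a _ b _ hab => mul_left_cancel₀ hx.ne' hab)
      (fun s => ENNReal.ofReal (s ^ (l - 2) * (s * x / (s + x))))
    rw [himg] at h
    rw [h, resConst, ← lintegral_const_mul' _ _ ENNReal.ofReal_ne_top]
    refine setLIntegral_congr_fun measurableSet_Ioi fun r hr => ?_
    have hr0 : 0 < r := hr
    rw [← ENNReal.ofReal_mul (abs_nonneg _), ← ENNReal.ofReal_mul (by positivity), abs_of_pos hx,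
      Real.mul_rpow hx.le hr0.le]
    congr 1
    have e1 : x ^ l = x ^ (l - 2) * x ^ 2 := by
      rw [← Real.rpow_natCast x 2, ← Real.rpow_add hx]
      congr 1
      push_cast
      ring
    rw [e1]
    field_simp

/-- An inequality valid for every resolvent weight integrates against s^{l-2} ds to the same
inequality for the power weight; the finite nonzero constant `resConst l` cancels. -/
theorem tsum_rpow_le {ι : Type*} [Countable ι] {X : ι → ℝ} (hX : ∀ i, 0 ≤ X i)
    {p q : ι → ℝ≥0∞} {C : ℝ≥0∞} (hC : C ≠ ⊤)
    (h : ∀ s : ℝ, 0 < s → ∑' i, ENNReal.ofReal (s * X i / (s + X i)) * p i ≤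
      C * ∑' i, ENNReal.ofReal (s * X i / (s + X i)) * q i) {l : ℝ} (h0 : 0 < l) (h1 : l < 1) :
    ∑' i, ENNReal.ofReal (X i ^ l) * p i ≤ C * ∑' i, ENNReal.ofReal (X i ^ l) * q i := by
  have key : ∀ p : ι → ℝ≥0∞, resConst l * ∑' i, ENNReal.ofReal (X i ^ l) * p i =
      ∫⁻ s in Ioi (0 : ℝ), ENNReal.ofReal (s ^ (l - 2)) *
        ∑' i, ENNReal.ofReal (s * X i / (s + X i)) * p i := by
    intro p
    rw [← ENNReal.tsum_mul_left]
    simp only [← ENNReal.tsum_mul_left]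
    rw [lintegral_tsum fun i => by fun_prop]
    refine tsum_congr fun i => ?_
    rw [← mul_assoc, mul_comm (resConst l), ← lintegral_resolvent h0 (hX i),
      ← lintegral_mul_const _ (by fun_prop)]
    refine setLIntegral_congr_fun measurableSet_Ioi fun s hs => ?_
    have hs0 : 0 < s := hs
    rw [ENNReal.ofReal_mul (by positivity), mul_assoc]
  refine (ENNReal.mul_le_mul_iff_right (resConst_ne_zero l) (resConst_ne_top h0 h1)).mp ?_
  rw [mul_left_comm, key, key]
  rw [← lintegral_const_mul' _ _ hC]
  refine setLIntegral_mono' measurableSet_Ioi fun s hs => ?_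
  rw [mul_left_comm]
  gcongr
  exact h s hs

/-! ### Weighted sums of Fourier coefficients -/

/-- `∑ p(K) |v̂(K)|²`. -/
noncomputable def wSum {n : ℕ} (p : (Fin n → ℤ) → ℝ) (v : Torus n → ℝ) : ℝ≥0∞ :=
  ∑' K, ENNReal.ofReal (p K) * ENNReal.ofReal (‖coeff v K‖ ^ 2)

lemma freqSq_nonneg {n : ℕ} (K : Fin n → ℤ) : 0 ≤ freqSq K :=
  Finset.sum_nonneg fun _ _ => sq_nonneg _

lemma freqSq_eq_zero_or_one_le {n : ℕ} (K : Fin n → ℤ) : freqSq K = 0 ∨ 1 ≤ freqSq K := by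
  have h : freqSq K = ((∑ i, (K i) ^ 2 : ℤ) : ℝ) := by simp [freqSq]
  rw [h]
  have h0 : 0 ≤ ∑ i, (K i) ^ 2 := Finset.sum_nonneg fun _ _ => sq_nonneg _
  rcases h0.eq_or_lt with h1 | h1
  · left; rw [← h1]; simp
  · right; exact_mod_cast h1

lemma freqSq_pair (k m : ℤ) : freqSq ![k, m] = (k : ℝ) ^ 2 + (m : ℝ) ^ 2 := by
  simp [freqSq, Fin.sum_univ_two]

/-- Nonzero frequencies have |K| ≥ 1; at K = 0 both powers vanish, which needs r > 0. -/
lemma freqSq_rpow_mono {n : ℕ} (K : Fin n → ℤ) {r s : ℝ} (hr : 0 < r) (hrs : r ≤ s) :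
    freqSq K ^ r ≤ freqSq K ^ s := by
  rcases freqSq_eq_zero_or_one_le K with h | h
  · rw [h, Real.zero_rpow hr.ne', Real.zero_rpow (hr.trans_le hrs).ne']
  · exact Real.rpow_le_rpow_of_exponent_le h hrs

lemma wSum_mono {n : ℕ} {p q : (Fin n → ℤ) → ℝ} (h : ∀ K, p K ≤ q K) (v : Torus n → ℝ) :
    wSum p v ≤ wSum q v :=
  ENNReal.tsum_le_tsum fun K => by
    gcongr
    exact h K

lemma tsum_fin_two (f : (Fin 2 → ℤ) → ℝ≥0∞) : ∑' K, f K = ∑' k, ∑' m, f ![k, m] := by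
  rw [← ENNReal.tsum_prod (f := fun k m => f ![k, m]), ← (finTwoArrowEquiv ℤ).symm.tsum_eq]
  rfl

/-! ### Propagation of regularity and dissipation for families of slices. -/

/-- A family of real functions whose slices solve the mode equations. -/
structure IsModeFamily (d : ℤ → ℤ → ℝ) (T : ℝ → CircL2 →L[ℂ] CircL2) (Γ : ℝ)
    (F : ℝ → Torus 2 → ℝ) : Prop where
  memLp : ∀ t, 0 ≤ t → MemLp (F t) 2 volume
  traj : ∀ k : ℤ, IsModeTraj fourierBasis (d k) k T (fun t => slice (fun y => (F t y : ℂ)) k)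
  nonneg : ∀ k m, 0 ≤ d k m
  gamma_nonneg : 0 ≤ Γ
  symm : ∀ s, 0 ≤ s → ∀ x y, inner ℂ (T s x) y = inner ℂ x (T s y)
  comm : ∀ (s κ : ℝ) (hs : 0 < s), ∀ r, 0 ≤ r → ∀ x,
    2 * (inner ℂ (diag fourierBasis (resWeight s κ) (abs_resWeight_le hs κ) x)
      ((Complex.I * κ) • T r x)).re ≤
      Γ * (inner ℂ (diag fourierBasis (resWeight s κ) (abs_resWeight_le hs κ) x) x).re

lemma IsModeFamily.repr_eq {d : ℤ → ℤ → ℝ} {T : ℝ → CircL2 →L[ℂ] CircL2} {Γ : ℝ}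
    {F : ℝ → Torus 2 → ℝ} (hF : IsModeFamily d T Γ F) {t : ℝ} (ht : 0 ≤ t) (k m : ℤ) :
    fourierBasis.repr (slice (fun y => (F t y : ℂ)) k) m = coeff (F t) ![k, m] := by
  have h : MemLp (fun y => (F t y : ℂ)) 2 volume := (hF.memLp t ht).ofReal
  exact repr_slice h k m

lemma IsModeFamily.continuousOn_coeff {d : ℤ → ℤ → ℝ} {T : ℝ → CircL2 →L[ℂ] CircL2} {Γ : ℝ}
    {F : ℝ → Torus 2 → ℝ} (hF : IsModeFamily d T Γ F) (K : Fin 2 → ℤ) :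
    ContinuousOn (fun t => coeff (F t) K) (Ici 0) := by
  have h := (hF.traj (K 0)).continuousOn_coord (K 1)
  refine h.congr fun t ht => ?_
  refine (congrArg (coeff (F t)) ?_).trans (hF.repr_eq ht (K 0) (K 1)).symm
  ext i
  fin_cases i <;> rfl

lemma IsModeFamily.aemeasurable_coeff {d : ℤ → ℤ → ℝ} {T : ℝ → CircL2 →L[ℂ] CircL2} {Γ : ℝ}
    {F : ℝ → Torus 2 → ℝ} (hF : IsModeFamily d T Γ F) (K : Fin 2 → ℤ) (t : ℝ) :
    AEMeasurable (fun r => ENNReal.ofReal (‖coeff (F r) K‖ ^ 2)) (volume.restrict (Ioc 0 t)) := by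
  have h : ContinuousOn (fun r => ENNReal.ofReal (‖coeff (F r) K‖ ^ 2)) (Ioc 0 t) :=
    ENNReal.continuous_ofReal.comp_continuousOn
      (((hF.continuousOn_coeff K).mono fun s hs => hs.1.le).norm.pow 2)
  exact h.aemeasurable measurableSet_Ioc

/-- On the slice k take κ = k, so that the one-dimensional weight is the one of |K|² = k² + m². The
growth rate Γ is the same for all k, so the slices can be summed. -/
theorem IsModeFamily.resolvent_energy {d : ℤ → ℤ → ℝ} {T : ℝ → CircL2 →L[ℂ] CircL2} {Γ : ℝ}
    {F : ℝ → Torus 2 → ℝ} (hF : IsModeFamily d T Γ F) {s t : ℝ} (hs : 0 < s) (ht : 0 ≤ t) :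
    (wSum (fun K => s * freqSq K / (s + freqSq K)) (F t) ≤ ENNReal.ofReal (exp (Γ * t)) *
      wSum (fun K => s * freqSq K / (s + freqSq K)) (F 0)) ∧
    ∑' K, ENNReal.ofReal (s * freqSq K / (s + freqSq K)) * ∫⁻ r in Ioc 0 t,
        ENNReal.ofReal (2 * d (K 0) (K 1)) * ENNReal.ofReal (‖coeff (F r) K‖ ^ 2) ≤
      ENNReal.ofReal (exp (Γ * t)) * wSum (fun K => s * freqSq K / (s + freqSq K)) (F 0) := by
  have hw : ∀ k m : ℤ, s * freqSq ![k, m] / (s + freqSq ![k, m]) = resWeight s k m := by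
    intro k m
    rw [freqSq_pair, resWeight]
  have h := fun k : ℤ => (hF.traj k).energy (hF.nonneg k) (resWeight s k)
    (resWeight_nonneg hs k) (abs_resWeight_le hs k) hF.gamma_nonneg (hF.comm s k hs) ht
  have hsum : ∀ t, 0 ≤ t → ∑' k : ℤ, ∑' m : ℤ, ENNReal.ofReal (resWeight s k m *
      ‖fourierBasis.repr (slice (fun y => (F t y : ℂ)) k) m‖ ^ 2) =
      wSum (fun K => s * freqSq K / (s + freqSq K)) (F t) := by
    intro t ht
    rw [wSum, tsum_fin_two]
    refine tsum_congr fun k => tsum_congr fun m => ?_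
    rw [hF.repr_eq ht, hw, ENNReal.ofReal_mul (resWeight_nonneg hs _ _)]
  rw [← hsum t ht, ← hsum 0 le_rfl, ← ENNReal.tsum_mul_left, tsum_fin_two]
  refine ⟨ENNReal.tsum_le_tsum fun k => (h k).1, ENNReal.tsum_le_tsum fun k =>
    le_trans (le_of_eq (tsum_congr fun m => ?_)) (h k).2⟩
  rw [hw, ← lintegral_const_mul' _ _ ENNReal.ofReal_ne_top]
  refine setLIntegral_congr_fun measurableSet_Ioc fun r hr => ?_
  simp only [Matrix.cons_val_zero, Matrix.cons_val_one]
  rw [hF.repr_eq hr.1.le, ← ENNReal.ofReal_mul (mul_nonneg zero_le_two (hF.nonneg k m)),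
    ← ENNReal.ofReal_mul (resWeight_nonneg hs _ _)]
  congr 1
  ring

/-- Propagation of fractional Sobolev regularity. -/
theorem IsModeFamily.sobolev_energy {d : ℤ → ℤ → ℝ} {T : ℝ → CircL2 →L[ℂ] CircL2} {Γ : ℝ}
    {F : ℝ → Torus 2 → ℝ} (hF : IsModeFamily d T Γ F) {l t : ℝ} (h0 : 0 < l) (h1 : l < 1)
    (ht : 0 ≤ t) :
    (wSum (fun K => freqSq K ^ l) (F t) ≤ ENNReal.ofReal (exp (Γ * t)) *
      wSum (fun K => freqSq K ^ l) (F 0)) ∧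
    ∑' K, ENNReal.ofReal (freqSq K ^ l) * ∫⁻ r in Ioc 0 t,
        ENNReal.ofReal (2 * d (K 0) (K 1)) * ENNReal.ofReal (‖coeff (F r) K‖ ^ 2) ≤
      ENNReal.ofReal (exp (Γ * t)) * wSum (fun K => freqSq K ^ l) (F 0) :=
  ⟨tsum_rpow_le freqSq_nonneg ENNReal.ofReal_ne_top (fun _ hs => (hF.resolvent_energy hs ht).1) h0 h1,
    tsum_rpow_le freqSq_nonneg ENNReal.ofReal_ne_top (fun _ hs => (hF.resolvent_energy hs ht).2) h0 h1⟩

/-- The viscous dissipation of a family with damping at least `ν |K|²`. -/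
theorem IsModeFamily.dissipation_le {d : ℤ → ℤ → ℝ} {T : ℝ → CircL2 →L[ℂ] CircL2} {Γ : ℝ}
    {F : ℝ → Torus 2 → ℝ} (hF : IsModeFamily d T Γ F) {ν l t : ℝ} (hν : 0 < ν)
    (hd : ∀ k m : ℤ, ν * freqSq ![k, m] ≤ d k m) (h0 : 0 < l) (h1 : l < 1) (ht : 0 ≤ t) :
    ENNReal.ofReal ν * ∫⁻ r in Ioc 0 t, wSum freqSq (F r) ≤
      ENNReal.ofReal (ν ^ l * ((t + 1) * exp (Γ * t))) * wSum (fun K => freqSq K ^ l) (F 0) := by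
  -- At this s the weight is A = X/(1+νX): comparable to X while νX ≤ 1 and saturating at 1/ν
  -- beyond.
  set s : ℝ := 1 / ν with hs
  have hs0 : 0 < s := by positivity
  set A : (Fin 2 → ℤ) → ℝ := fun K => s * freqSq K / (s + freqSq K) with hA
  have hA0 : ∀ K, 0 ≤ A K := fun K => by
    have := freqSq_nonneg K
    simp only [hA]
    positivity
  have hνs : ν * s = 1 := by rw [hs]; field_simp
  have hsplit : ∀ K, freqSq K = A K + ν * (A K * freqSq K) := by
    intro K
    have h2 := freqSq_nonneg K
    have e : A K = freqSq K / (1 + ν * freqSq K) := by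
      simp only [hA, hs]
      field_simp
    have h4 : 1 + ν * freqSq K ≠ 0 := by positivity
    rw [e]
    field_simp
  -- With y = νX this is y/(1+y) ≤ y^l, for y ≤ 1 from y ≤ y^l and for y ≥ 1 from 1 ≤ y^l.
  have hAle : ∀ K, ν * A K ≤ ν ^ l * freqSq K ^ l := by
    intro K
    have h2 := freqSq_nonneg K
    rcases h2.eq_or_lt with h3 | h3
    · simp only [hA]
      rw [← h3]
      simp [Real.zero_rpow h0.ne']
    · rw [← Real.mul_rpow hν.le h2]
      set y := ν * freqSq K with hy
      have hy0 : 0 < y := by positivity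
      have e : ν * A K = y / (1 + y) := by
        simp only [hA, hy, hs]
        field_simp
      rw [e, div_le_iff₀ (by positivity)]
      have h5 : 0 < y ^ l := by positivity
      rcases le_total y 1 with h4 | h4
      · have : y ≤ y ^ l := by
          calc y = y ^ (1 : ℝ) := (Real.rpow_one y).symm
            _ ≤ y ^ l := Real.rpow_le_rpow_of_exponent_ge hy0 h4 h1.le
        nlinarith
      · have : 1 ≤ y ^ l := Real.one_le_rpow h4 h0.le
        nlinarith
  have hE := hF.resolvent_energy hs0 ht
  have hE1 : ∀ r ∈ Ioc 0 t, wSum A (F r) ≤ ENNReal.ofReal (exp (Γ * t)) * wSum A (F 0) := by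
    intro r hr
    refine (hF.resolvent_energy hs0 hr.1.le).1.trans ?_
    gcongr
    · exact hF.gamma_nonneg
    · exact hr.2
  have hI1 : ∫⁻ r in Ioc 0 t, wSum A (F r) ≤
      ENNReal.ofReal t * (ENNReal.ofReal (exp (Γ * t)) * wSum A (F 0)) := by
    refine (setLIntegral_mono' measurableSet_Ioc hE1).trans (le_of_eq ?_)
    rw [setLIntegral_const, Real.volume_Ioc, sub_zero, mul_comm]
  have hI2 : ∫⁻ r in Ioc 0 t, wSum (fun K => ν * (A K * freqSq K)) (F r) ≤
      ENNReal.ofReal (exp (Γ * t)) * wSum A (F 0) := by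
    refine le_trans ?_ hE.2
    unfold wSum
    rw [lintegral_tsum fun K => (hF.aemeasurable_coeff K t).const_mul _]
    refine ENNReal.tsum_le_tsum fun K => ?_
    rw [← lintegral_const_mul' _ _ ENNReal.ofReal_ne_top]
    refine lintegral_mono fun r => ?_
    simp only
    rw [← mul_assoc (ENNReal.ofReal _), ← ENNReal.ofReal_mul (hA0 K)]
    refine mul_le_mul_left (ENNReal.ofReal_le_ofReal ?_) _
    have h3 : ν * freqSq K ≤ d (K 0) (K 1) := by
      have h4 := hd (K 0) (K 1)
      have h5 : (![K 0, K 1] : Fin 2 → ℤ) = K := by ext i; fin_cases i <;> rfl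
      rwa [h5] at h4
    have h6 := hF.nonneg (K 0) (K 1)
    have h7 := mul_le_mul_of_nonneg_left (show ν * freqSq K ≤ 2 * d (K 0) (K 1) by linarith) (hA0 K)
    linarith
  have hsum : ∀ r, wSum freqSq (F r) =
      wSum A (F r) + wSum (fun K => ν * (A K * freqSq K)) (F r) := by
    intro r
    unfold wSum
    rw [← ENNReal.tsum_add]
    refine tsum_congr fun K => ?_
    rw [← add_mul, ← ENNReal.ofReal_add (hA0 K)
      (mul_nonneg hν.le (mul_nonneg (hA0 K) (freqSq_nonneg K))), ← hsplit]
  have hmeas : AEMeasurable (fun r => wSum A (F r)) (volume.restrict (Ioc 0 t)) := by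
    unfold wSum
    exact AEMeasurable.tsum fun K => (hF.aemeasurable_coeff K t).const_mul _
  have hfin : ENNReal.ofReal ν * wSum A (F 0) ≤
      ENNReal.ofReal (ν ^ l) * wSum (fun K => freqSq K ^ l) (F 0) := by
    unfold wSum
    rw [← ENNReal.tsum_mul_left, ← ENNReal.tsum_mul_left]
    refine ENNReal.tsum_le_tsum fun K => ?_
    rw [← mul_assoc, ← mul_assoc, ← ENNReal.ofReal_mul hν.le,
      ← ENNReal.ofReal_mul (p := ν ^ l) (by positivity)]
    exact mul_le_mul_left (ENNReal.ofReal_le_ofReal (hAle K)) _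
  simp only [hsum]
  rw [lintegral_add_left' hmeas]
  calc _ ≤ ENNReal.ofReal ν * (ENNReal.ofReal t * (ENNReal.ofReal (exp (Γ * t)) * wSum A (F 0)) +
        ENNReal.ofReal (exp (Γ * t)) * wSum A (F 0)) := by gcongr
    _ = ENNReal.ofReal ((t + 1) * exp (Γ * t)) * (ENNReal.ofReal ν * wSum A (F 0)) := by
      rw [ENNReal.ofReal_mul (p := t + 1) (by positivity), ENNReal.ofReal_add ht zero_le_one,
        ENNReal.ofReal_one]
      ring
    _ ≤ ENNReal.ofReal ((t + 1) * exp (Γ * t)) *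
        (ENNReal.ofReal (ν ^ l) * wSum (fun K => freqSq K ^ l) (F 0)) := by gcongr
    _ = _ := by
      rw [ENNReal.ofReal_mul (p := ν ^ l) (by positivity)]
      ring

end ShearFlow

namespace ShearFlow

open ComplexConjugate AddCircle

/-! ### The two profiles as families of trajectories -/

lemma commutator_mulOp_le {h h' : Circ → ℝ} (hh : Continuous h) (hh' : Continuous h')
    (hcoeff : ∀ j : ℤ, fourierCoeff (toC h' hh') j = Complex.I * j * fourierCoeff (toC h hh) j)
    {Γ : ℝ} (hΓ0 : 0 ≤ Γ) (hΓ : ∀ x, |h' x| ≤ Γ) {s : ℝ} (hs : 0 < s) (κ : ℝ) (x : CircL2) :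
    2 * (inner ℂ (diag fourierBasis (resWeight s κ) (abs_resWeight_le hs κ) x)
      ((Complex.I * κ) • mulOp (toC h hh) x)).re ≤
      Γ * (inner ℂ (diag fourierBasis (resWeight s κ) (abs_resWeight_le hs κ) x) x).re :=
  commutator_le (mulOp_toC_symm hh) (T' := mulOp (toC h' hh'))
    (fun _ _ hxy => repr_mulOp_commute hcoeff hxy) hΓ0
    (fun x => (norm_mulOp_le _ x).trans
      (mul_le_mul_of_nonneg_right (norm_toC_le hh' hΓ0 hΓ) (norm_nonneg _))) hs κ x

lemma freqSq_mul_le_damping (lam : ℤ) {ν : ℝ} (hν : 0 ≤ ν) (k m : ℤ) :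
    ν * freqSq ![k, m] ≤ damping lam ν k m := by
  rw [freqSq_pair, damping]
  refine mul_le_mul_of_nonneg_left ?_ hν
  nlinarith [mul_nonneg (sq_nonneg (lam : ℝ)) (sq_nonneg (k : ℝ))]

lemma damping_le (lam : ℤ) {ν : ℝ} (hν : 0 ≤ ν) (k m : ℤ) :
    damping lam ν k m ≤ ((lam : ℝ) ^ 2 + 1) * (ν * freqSq ![k, m]) := by
  rw [freqSq_pair, damping, mul_left_comm]
  refine mul_le_mul_of_nonneg_left ?_ hν
  nlinarith [mul_nonneg (sq_nonneg (lam : ℝ)) (sq_nonneg (m : ℝ))]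

variable {lam : ℤ} {ν : ℝ} {f : Torus 2 → ℝ} {g : Circ → ℝ} {F : ℝ → Torus 2 → ℝ}

/-- One Γ serves all times and all ν, since averaging by the heat kernel does not increase ‖g'‖_∞.
-/
theorem IsProfile.isModeFamily (hF : IsProfile lam ν f g F) (hg : SmoothCirc g) (hν : 0 < ν) :
    IsModeFamily (damping lam ν) (fun s => mulOp (heatC g hg.continuous (ν * s)))
      (supDeriv 1 g) F where
  memLp := fun t ht => hF.cont.1 t ht
  traj := hF.isModeTraj hg hν
  nonneg := fun k m => (mul_nonneg hν.le (freqSq_nonneg _)).trans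
    (freqSq_mul_le_damping lam hν.le k m)
  gamma_nonneg := supDeriv_nonneg 1 g
  symm := fun _ _ => mulOp_toC_symm _
  comm := fun s κ hs r _ => commutator_mulOp_le _
    (continuous_heat hg.circDeriv.continuous (le_max_right _ _))
    (fourierCoeff_heat_circDeriv hg (le_max_right _ _)) (supDeriv_nonneg 1 g)
    (fun x => by
      rw [← supDeriv_circDeriv 0 g]
      exact abs_heat_le hg.circDeriv.continuous (le_max_right _ _) x) hs κ

theorem isModeFamily_eulerProfile (hf : MemLp f 2 volume) (hg : SmoothCirc g) :
    IsModeFamily (fun _ _ => 0) (fun _ => mulOp (toC g hg.continuous)) (supDeriv 1 g)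
      (eulerProfile f g) where
  memLp := fun t _ => memLp_eulerProfile hf hg.continuous t
  traj := isModeTraj_eulerProfile hf hg.continuous
  nonneg := fun _ _ => le_rfl
  gamma_nonneg := supDeriv_nonneg 1 g
  symm := fun _ _ => mulOp_toC_symm _
  comm := fun s κ hs r _ => commutator_mulOp_le _ hg.circDeriv.continuous
    (fourierCoeff_circDeriv hg) (supDeriv_nonneg 1 g)
    (fun x => by
      rw [← supDeriv_circDeriv 0 g]
      exact abs_le_supDeriv_zero hg.circDeriv.continuous x) hs κ

/-! ### Comparison of the Navier–Stokes and Euler profiles. -/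

lemma coeff_congr_ae {n : ℕ} {u v : Torus n → ℝ} (h : u =ᵐ[volume] v) (K : Fin n → ℤ) :
    coeff u K = coeff v K := by
  unfold coeff
  congr 1
  refine integral_congr_ae ?_
  filter_upwards [h] with y hy
  rw [hy]

lemma wSum_congr_ae {n : ℕ} {u v : Torus n → ℝ} (h : u =ᵐ[volume] v) (p : (Fin n → ℤ) → ℝ) :
    wSum p u = wSum p v := by
  unfold wSum
  simp only [coeff_congr_ae h]

lemma eulerProfile_zero (f : Torus 2 → ℝ) (g : Circ → ℝ) : eulerProfile f g 0 = f := by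
  funext y
  have h : shearMap (fun z => ((0 * g z : ℝ) : Circ)) y = y := by
    ext i
    fin_cases i
    · simp [shearMap]
    · rfl
  rw [eulerProfile, h]

lemma coeff_sub {n : ℕ} {u v : Torus n → ℝ} (hu : MemLp u 2 volume) (hv : MemLp v 2 volume)
    (K : Fin n → ℤ) : coeff (fun x => u x - v x) K = coeff u K - coeff v K := by
  have hu' : MemLp (fun x => (u x : ℂ)) 2 volume := hu.ofReal
  have hv' : MemLp (fun x => (v x : ℂ)) 2 volume := hv.ofReal
  rw [coeff_eq_ccoeff, coeff_eq_ccoeff, coeff_eq_ccoeff, ← ccoeff_sub hu' hv']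
  simp only [Complex.ofReal_sub]

lemma IsProfile.memLp_init (hF : IsProfile lam ν f g F) : MemLp f 2 volume :=
  (memLp_congr_ae hF.init).mp (hF.cont.1 0 (mem_Ici.mpr le_rfl))

lemma wSum_one_eq_tsum_slice {u v : Torus 2 → ℝ} (hu : MemLp u 2 volume) (hv : MemLp v 2 volume) :
    wSum (fun _ => 1) (fun y => u y - v y) = ∑' k : ℤ, ENNReal.ofReal
      (‖slice (fun y => (u y : ℂ)) k - slice (fun y => (v y : ℂ)) k‖ ^ 2) := by
  have hu' : MemLp (fun x => (u x : ℂ)) 2 volume := hu.ofReal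
  have hv' : MemLp (fun x => (v x : ℂ)) 2 volume := hv.ofReal
  rw [wSum, tsum_fin_two]
  refine tsum_congr fun k => ?_
  have h := hasSum_repr_sq fourierBasis
    (slice (fun y => (u y : ℂ)) k - slice (fun y => (v y : ℂ)) k)
  rw [← h.tsum_eq, ENNReal.ofReal_tsum_of_nonneg (fun _ => by positivity) h.summable]
  refine tsum_congr fun m => ?_
  rw [map_sub, lp.coeFn_sub, Pi.sub_apply, repr_slice hu', repr_slice hv', ENNReal.ofReal_one,
    one_mul, coeff_sub hu hv]
  rfl

/-- The damping term in the comparison of the two profiles. -/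
lemma damping_mul_le {lam : ℤ} {ν : ℝ} (hν : 0 < ν) (k m : ℤ) {x y : ℝ} :
    2 * ((damping lam ν k m + 0) * (x * y)) ≤ √ν * ((lam : ℝ) ^ 2 + 1) *
      (freqSq ![k, m] ^ (1 / 2 : ℝ) * (2 * damping lam ν k m * x ^ 2) +
        freqSq ![k, m] ^ (1 / 2 : ℝ) * y ^ 2) := by
  set X := freqSq ![k, m] with hX
  have hX0 : 0 ≤ X := freqSq_nonneg _
  have h1 : ν * X ≤ damping lam ν k m := freqSq_mul_le_damping lam hν.le k m
  have h2 : damping lam ν k m ≤ ((lam : ℝ) ^ 2 + 1) * (ν * X) := damping_le lam hν.le k m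
  have hd0 : 0 ≤ damping lam ν k m := (by positivity : 0 ≤ ν * X).trans h1
  have hs : √ν * √ν = ν := Real.mul_self_sqrt hν.le
  have hq : √X * √X = X := Real.mul_self_sqrt hX0
  have hs0 : 0 < √ν := Real.sqrt_pos.mpr hν
  have hq0 : 0 ≤ √X := Real.sqrt_nonneg _
  rw [← Real.sqrt_eq_rpow, add_zero]
  set a := √ν
  set q := √X
  set μ : ℝ := (lam : ℝ) ^ 2 + 1 with hμ
  have hμ0 : 0 < μ := by positivity
  have h3 : 2 * (x * y) ≤ 2 * (|x| * |y|) := by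
    rw [← abs_mul]; linarith [le_abs_self (x * y)]
  have h4 : 2 * (damping lam ν k m * (x * y)) ≤ 2 * (μ * (ν * X) * (|x| * |y|)) := by
    have := mul_le_mul_of_nonneg_right h2 (mul_nonneg (abs_nonneg x) (abs_nonneg y))
    have h5 := mul_le_mul_of_nonneg_left h3 hd0
    linarith
  have h6 : 2 * (μ * (ν * X) * (|x| * |y|)) ≤ a * μ * (q * (ν * X * x ^ 2) + q * y ^ 2) := by
    -- Young's inequality for √ν X^{1/2}|x| and |y|, then multiplied by √ν X^{1/2}(lam² + 1).
    have h7 := two_mul_le_add_sq (a * q * |x|) |y|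
    rw [mul_pow, sq_abs, sq_abs, mul_pow] at h7
    have h8 := mul_le_mul_of_nonneg_left h7 (by positivity : 0 ≤ a * μ * q)
    have e1 : a * μ * q * (2 * (a * q * |x|) * |y|) = 2 * (μ * (ν * X) * (|x| * |y|)) := by
      rw [← hs, ← hq]; ring
    have e2 : a * μ * q * (a ^ 2 * q ^ 2 * x ^ 2 + y ^ 2) =
        a * μ * (q * (ν * X * x ^ 2) + q * y ^ 2) := by
      rw [← hs, ← hq]; ring
    linarith
  have h9 : a * μ * (q * (ν * X * x ^ 2) + q * y ^ 2) ≤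
      a * μ * (q * (2 * damping lam ν k m * x ^ 2) + q * y ^ 2) := by
    have : ν * X ≤ 2 * damping lam ν k m := by linarith
    gcongr
  linarith

/-- The `L²` distance of the two profiles. -/
theorem IsProfile.wSum_sub_le (hF : IsProfile lam ν f g F) (hg : SmoothCirc g) (hν : 0 < ν)
    {t : ℝ} (ht : 0 ≤ t) :
    wSum (fun _ => 1) (fun y => F t y - eulerProfile f g t y) ≤
      ENNReal.ofReal (√ν * (((lam : ℝ) ^ 2 + 1) * ((1 + t) * exp (supDeriv 1 g * t)) +
        2 * (supDeriv 1 g * √(2 * t) * t))) * wSum (fun K => freqSq K ^ (1 / 2 : ℝ)) f := by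
  have hf := hF.memLp_init
  have hFm := hF.isModeFamily hg hν
  have hEm := isModeFamily_eulerProfile hf hg
  set Γ := supDeriv 1 g with hΓ
  have hΓ0 : 0 ≤ Γ := supDeriv_nonneg 1 g
  set E := eulerProfile f g with hE
  set W := wSum (fun K => freqSq K ^ (1 / 2 : ℝ)) f with hW
  set a : ℤ → ℝ → CircL2 := fun k t => slice (fun y => (F t y : ℂ)) k with ha
  set b : ℤ → ℝ → CircL2 := fun k t => slice (fun y => (E t y : ℂ)) k with hb
  have hE0 : E 0 = f := eulerProfile_zero f g
  have h0 : ∀ k, a k 0 = b k 0 := by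
    intro k
    simp only [ha, hb, hE0]
    refine slice_congr ?_ k
    filter_upwards [hF.init] with y hy
    rw [hy]
  have hW0 : wSum (fun K => freqSq K ^ (1 / 2 : ℝ)) (F 0) = W := wSum_congr_ae hF.init _
  -- The constant δ bounds ‖e^{νs∂²}g - g‖_∞ for s ≤ t, by the Hölder estimate between the times 0
  -- and νs.
  have hdist := fun k : ℤ => (hFm.traj k).dist_sq_le (hEm.traj k) (h0 k) (hFm.nonneg k)
    (fun _ => le_rfl) hFm.symm hEm.symm (δ := Γ * √(2 * (ν * t))) (t := t) (by positivity) ht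
    (fun s hs x => by
      rw [← sub_apply, ← map_sub]
      refine (norm_mulOp_le _ x).trans (mul_le_mul_of_nonneg_right ?_ (norm_nonneg _))
      have h1 : toC g hg.continuous = heatC g hg.continuous 0 := by
        ext z
        rw [heatC_apply hg.continuous le_rfl, heat_zero g hg.continuous]
        rfl
      rw [h1]
      refine (hg.norm_heatC_sub_le 0 (ν * s)).trans (mul_le_mul_of_nonneg_left ?_ hΓ0)
      rw [max_self, mul_zero, Real.sqrt_zero, zero_sub, abs_neg, abs_of_nonneg (Real.sqrt_nonneg _),
        max_eq_left (mul_nonneg hν.le hs.1)]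
      have := hs.2
      gcongr)
  rw [wSum_one_eq_tsum_slice (hFm.memLp t ht) (hEm.memLp t ht)]
  refine (ENNReal.tsum_le_tsum hdist).trans ?_
  rw [ENNReal.tsum_add, ENNReal.tsum_mul_left, ENNReal.tsum_mul_left]
  set c : ℝ := √ν * ((lam : ℝ) ^ 2 + 1) with hc
  have hc0 : 0 ≤ c := by positivity
  -- the damping term
  have hA : 2 * ∑' k : ℤ, ∑' m : ℤ, ∫⁻ s in Ioc 0 t, ENNReal.ofReal ((damping lam ν k m + 0) *
      (‖fourierBasis.repr (a k s) m‖ * ‖fourierBasis.repr (b k s) m‖)) ≤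
      ENNReal.ofReal c * (ENNReal.ofReal (exp (Γ * t)) * W +
        ENNReal.ofReal t * (ENNReal.ofReal (exp (Γ * t)) * W)) := by
    have hpt : ∀ k m : ℤ, 2 * ∫⁻ s in Ioc 0 t, ENNReal.ofReal ((damping lam ν k m + 0) *
        (‖fourierBasis.repr (a k s) m‖ * ‖fourierBasis.repr (b k s) m‖)) ≤
        ENNReal.ofReal c * ((ENNReal.ofReal (freqSq ![k, m] ^ (1 / 2 : ℝ)) * ∫⁻ s in Ioc 0 t,
          ENNReal.ofReal (2 * damping lam ν k m) *
            ENNReal.ofReal (‖coeff (F s) ![k, m]‖ ^ 2)) +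
          ∫⁻ s in Ioc 0 t, ENNReal.ofReal (freqSq ![k, m] ^ (1 / 2 : ℝ)) *
            ENNReal.ofReal (‖coeff (E s) ![k, m]‖ ^ 2)) := by
      intro k m
      have hd0 := hFm.nonneg k m
      have hX0 := freqSq_nonneg ![k, m]
      rw [← lintegral_const_mul' _ _ (by simp), ← lintegral_const_mul' _ _ ENNReal.ofReal_ne_top,
        ← lintegral_add_right' _ ((hEm.aemeasurable_coeff _ t).const_mul _),
        ← lintegral_const_mul' _ _ ENNReal.ofReal_ne_top]
      refine setLIntegral_mono' measurableSet_Ioc fun s hs => ?_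
      have e1 : fourierBasis.repr (a k s) m = coeff (F s) ![k, m] := hFm.repr_eq hs.1.le k m
      have e2 : fourierBasis.repr (b k s) m = coeff (E s) ![k, m] := hEm.repr_eq hs.1.le k m
      rw [e1, e2, ← ENNReal.ofReal_ofNat 2, ← ENNReal.ofReal_mul zero_le_two,
        ← ENNReal.ofReal_mul (p := 2 * damping lam ν k m) (by positivity),
        ← ENNReal.ofReal_mul (p := freqSq ![k, m] ^ (1 / 2 : ℝ)) (by positivity),
        ← ENNReal.ofReal_mul (p := freqSq ![k, m] ^ (1 / 2 : ℝ)) (by positivity),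
        ← ENNReal.ofReal_add (by positivity) (by positivity), ← ENNReal.ofReal_mul hc0]
      exact ENNReal.ofReal_le_ofReal (damping_mul_le hν k m)
    have hE1 : ∫⁻ s in Ioc 0 t, wSum (fun K => freqSq K ^ (1 / 2 : ℝ)) (E s) ≤
        ENNReal.ofReal t * (ENNReal.ofReal (exp (Γ * t)) * W) := by
      have h1 : ∀ s ∈ Ioc 0 t, wSum (fun K => freqSq K ^ (1 / 2 : ℝ)) (E s) ≤
          ENNReal.ofReal (exp (Γ * t)) * W := by
        intro s hs
        have := (hEm.sobolev_energy (l := 1 / 2) (by norm_num) (by norm_num) hs.1.le).1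
        rw [hE0] at this
        refine this.trans ?_
        have h2 := hs.2
        gcongr
      refine (setLIntegral_mono' measurableSet_Ioc h1).trans (le_of_eq ?_)
      rw [setLIntegral_const, Real.volume_Ioc, sub_zero, mul_comm]
    -- The dissipation of F in H^{1/2} pays for the viscous factor; the Euler profile is not
    -- dissipated and contributes its H^{1/2} energy integrated over [0, t].
    have hF1 := (hFm.sobolev_energy (l := 1 / 2) (by norm_num) (by norm_num) ht).2
    rw [hW0] at hF1
    simp only [← ENNReal.tsum_mul_left]
    refine (ENNReal.tsum_le_tsum fun k => ENNReal.tsum_le_tsum fun m => hpt k m).trans ?_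
    simp only [ENNReal.tsum_mul_left, ENNReal.tsum_add]
    refine mul_le_mul_right (add_le_add ?_ ?_) _
    · rw [tsum_fin_two] at hF1
      exact hF1
    · refine le_trans (le_of_eq ?_) hE1
      unfold wSum
      rw [lintegral_tsum fun K => (hEm.aemeasurable_coeff K t).const_mul _, tsum_fin_two]
  -- the forcing term
  have hB : ∑' k : ℤ, ENNReal.ofReal (|((k : ℝ))| * (Γ * √(2 * (ν * t))) * ‖a k 0‖ ^ 2 * t) ≤
      ENNReal.ofReal (√ν * (Γ * √(2 * t) * t)) * W := by
    have h1 : √(2 * (ν * t)) = √ν * √(2 * t) := by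
      rw [← Real.sqrt_mul hν.le]
      congr 1
      ring
    rw [← hW0, wSum, tsum_fin_two, ← ENNReal.tsum_mul_left]
    refine ENNReal.tsum_le_tsum fun k => ?_
    rw [h1, show |((k : ℝ))| * (Γ * (√ν * √(2 * t))) * ‖a k 0‖ ^ 2 * t =
      (√ν * (Γ * √(2 * t) * t)) * (|(k : ℝ)| * ‖a k 0‖ ^ 2) by ring,
      ENNReal.ofReal_mul (p := √ν * (Γ * √(2 * t) * t)) (by positivity)]
    refine mul_le_mul_right ?_ _
    have h2 := (hasSum_repr_sq fourierBasis (a k 0)).mul_left |(k : ℝ)|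
    rw [← h2.tsum_eq, ENNReal.ofReal_tsum_of_nonneg (fun _ => by positivity) h2.summable]
    refine ENNReal.tsum_le_tsum fun m => ?_
    have e1 : fourierBasis.repr (a k 0) m = coeff (F 0) ![k, m] := hFm.repr_eq le_rfl k m
    rw [e1, ENNReal.ofReal_mul (abs_nonneg _)]
    refine mul_le_mul_left (ENNReal.ofReal_le_ofReal ?_) _
    -- The growth |k| of the forcing is absorbed by |K|, half a derivative in the squared norm.
    rw [← Real.sqrt_eq_rpow, freqSq_pair]
    exact Real.abs_le_sqrt (by nlinarith [sq_nonneg (m : ℝ)])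
  calc _ ≤ ENNReal.ofReal c * (ENNReal.ofReal (exp (Γ * t)) * W +
        ENNReal.ofReal t * (ENNReal.ofReal (exp (Γ * t)) * W)) +
        2 * (ENNReal.ofReal (√ν * (Γ * √(2 * t) * t)) * W) := by
        exact add_le_add hA (mul_le_mul_right hB _)
    _ = (ENNReal.ofReal (c * ((1 + t) * exp (Γ * t))) +
        ENNReal.ofReal (2 * (√ν * (Γ * √(2 * t) * t)))) * W := by
        rw [ENNReal.ofReal_mul hc0, ENNReal.ofReal_mul (p := 1 + t) (by positivity),
          ENNReal.ofReal_add zero_le_one ht, ENNReal.ofReal_one,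
          ENNReal.ofReal_mul (p := 2) zero_le_two, ENNReal.ofReal_ofNat]
        ring
    _ = _ := by
        rw [← ENNReal.ofReal_add (by positivity) (by positivity)]
        congr 2
        simp only [hc]
        ring

/-- Interpolation of the difference of the profiles between `L²` and `Ḣ^l`. -/
theorem IsProfile.wSum_rpow_sub_le (hF : IsProfile lam ν f g F) (hg : SmoothCirc g) (hν : 0 < ν)
    {l l' t : ℝ} (hl : 1 / 2 ≤ l) (hl1 : l < 1) (hl'0 : 0 ≤ l') (hl' : l' < l) (ht : 0 ≤ t) :
    wSum (fun K => freqSq K ^ l') (fun y => F t y - eulerProfile f g t y) ≤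
      ENNReal.ofReal (ν ^ ((1 / 2 : ℝ) * (1 - l' / l)) *
        (((lam : ℝ) ^ 2 + 1) * ((1 + t) * exp (supDeriv 1 g * t)) +
        2 * (supDeriv 1 g * √(2 * t) * t) + 4 * exp (supDeriv 1 g * t))) *
        wSum (fun K => freqSq K ^ l) f := by
  have hl0 : 0 < l := by linarith
  have hf := hF.memLp_init
  have hFm := hF.isModeFamily hg hν
  have hEm := isModeFamily_eulerProfile hf hg
  have hD := hF.wSum_sub_le hg hν ht
  set Γ := supDeriv 1 g with hΓ
  have hΓ0 : 0 ≤ Γ := supDeriv_nonneg 1 g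
  set E := eulerProfile f g with hE
  set W := wSum (fun K => freqSq K ^ l) f with hW
  set M : ℝ := ((lam : ℝ) ^ 2 + 1) * ((1 + t) * exp (Γ * t)) + 2 * (Γ * √(2 * t) * t) with hM
  have hM0 : 0 ≤ M := by positivity
  have hFW := (hFm.sobolev_energy hl0 hl1 ht).1
  have hEW := (hEm.sobolev_energy hl0 hl1 ht).1
  rw [wSum_congr_ae hF.init] at hFW
  rw [hE, eulerProfile_zero] at hEW
  have hlow : wSum (fun K => freqSq K ^ (1 / 2 : ℝ)) f ≤ W :=
    wSum_mono (fun K => freqSq_rpow_mono K (by norm_num) hl) f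
  have hhigh : wSum (fun K => freqSq K ^ l) (fun y => F t y - E t y) ≤
      ENNReal.ofReal (4 * exp (Γ * t)) * W := by
    have h1 : wSum (fun K => freqSq K ^ l) (fun y => F t y - E t y) ≤
        2 * wSum (fun K => freqSq K ^ l) (F t) + 2 * wSum (fun K => freqSq K ^ l) (E t) := by
      unfold wSum
      rw [← ENNReal.tsum_mul_left, ← ENNReal.tsum_mul_left, ← ENNReal.tsum_add]
      refine ENNReal.tsum_le_tsum fun K => ?_
      rw [coeff_sub (hFm.memLp t ht) (hEm.memLp t ht), mul_left_comm, mul_left_comm 2, ← mul_add]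
      refine mul_le_mul_right ?_ _
      rw [← ENNReal.ofReal_ofNat 2, ← ENNReal.ofReal_mul zero_le_two,
        ← ENNReal.ofReal_mul zero_le_two, ← ENNReal.ofReal_add (by positivity) (by positivity)]
      refine ENNReal.ofReal_le_ofReal ?_
      have h2 := norm_sub_le (coeff (F t) K) (coeff (E t) K)
      have h3 := pow_le_pow_left₀ (norm_nonneg _) h2 2
      nlinarith [sq_nonneg (‖coeff (F t) K‖ - ‖coeff (E t) K‖)]
    refine h1.trans ((add_le_add (mul_le_mul_right hFW 2) (mul_le_mul_right hEW 2)).trans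
      (le_of_eq ?_))
    rw [ENNReal.ofReal_mul (by norm_num), ENNReal.ofReal_ofNat]
    ring
  -- The cutoff on |K|² for which R^l = ν^{-1/2}, so that the low part R^{l'}√ν and the high part
  -- R^{l'-l} have equal size.
  set R : ℝ := ν ^ (-(1 / (2 * l))) with hR
  have hR0 : 0 < R := by positivity
  have hRl : ∀ p : ℝ, R ^ p = ν ^ (-(1 / (2 * l)) * p) := fun p => by
    rw [hR, ← Real.rpow_mul hν.le]
  have hint : ∀ K : Fin 2 → ℤ, freqSq K ^ l' ≤ R ^ l' * 1 + R ^ (l' - l) * freqSq K ^ l := by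
    intro K
    have hX := freqSq_nonneg K
    rcases le_total (freqSq K) R with h | h
    · have h1 := Real.rpow_le_rpow hX h hl'0
      have h2 : 0 ≤ R ^ (l' - l) * freqSq K ^ l := by positivity
      linarith
    · have hX0 : 0 < freqSq K := hR0.trans_le h
      have h1 : freqSq K ^ l' = freqSq K ^ (l' - l) * freqSq K ^ l := by
        rw [← Real.rpow_add hX0]; ring_nf
      have h2 : freqSq K ^ (l' - l) ≤ R ^ (l' - l) :=
        Real.rpow_le_rpow_of_nonpos hR0 h (by linarith)
      have h3 : 0 ≤ R ^ l' * 1 := by positivity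
      have h4 : 0 ≤ freqSq K ^ l := by positivity
      rw [h1]
      nlinarith [mul_le_mul_of_nonneg_right h2 h4]
  have hsplit : wSum (fun K => freqSq K ^ l') (fun y => F t y - E t y) ≤
      ENNReal.ofReal (R ^ l') * wSum (fun _ => 1) (fun y => F t y - E t y) +
        ENNReal.ofReal (R ^ (l' - l)) * wSum (fun K => freqSq K ^ l) (fun y => F t y - E t y) := by
    unfold wSum
    rw [← ENNReal.tsum_mul_left, ← ENNReal.tsum_mul_left, ← ENNReal.tsum_add]
    refine ENNReal.tsum_le_tsum fun K => ?_
    rw [← mul_assoc, ← mul_assoc, ← add_mul, ← ENNReal.ofReal_mul (p := R ^ l') (by positivity),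
      ← ENNReal.ofReal_mul (p := R ^ (l' - l)) (by positivity),
      ← ENNReal.ofReal_add (by positivity)
        (mul_nonneg (by positivity) (Real.rpow_nonneg (freqSq_nonneg K) _))]
    exact mul_le_mul_left (ENNReal.ofReal_le_ofReal (hint K)) _
  have e1 : R ^ l' * √ν = ν ^ ((1 / 2 : ℝ) * (1 - l' / l)) := by
    rw [hRl, Real.sqrt_eq_rpow, ← Real.rpow_add hν]
    congr 1
    field_simp
    ring
  have e2 : R ^ (l' - l) = ν ^ ((1 / 2 : ℝ) * (1 - l' / l)) := by
    rw [hRl]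
    congr 1
    field_simp
    ring
  calc _ ≤ ENNReal.ofReal (R ^ l') * (ENNReal.ofReal (√ν * M) * W) +
        ENNReal.ofReal (R ^ (l' - l)) * (ENNReal.ofReal (4 * exp (Γ * t)) * W) := by
        refine hsplit.trans (add_le_add (mul_le_mul_right ?_ _) (mul_le_mul_right hhigh _))
        exact hD.trans (mul_le_mul_right hlow _)
    _ = (ENNReal.ofReal (R ^ l' * √ν * M) + ENNReal.ofReal (R ^ (l' - l) * (4 * exp (Γ * t)))) *
        W := by
        rw [mul_assoc (R ^ l'), ENNReal.ofReal_mul (p := R ^ l') (by positivity),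
          ENNReal.ofReal_mul (p := R ^ (l' - l)) (by positivity)]
        ring
    _ = _ := by
        rw [← ENNReal.ofReal_add (by positivity) (by positivity), e1, e2, ← mul_add]

end ShearFlow

namespace ShearFlow

open ComplexConjugate AddCircle

/-! ### Functions of two variables as functions on `𝕋³` -/

/-- The projection `x ↦ (lam x₁ + x₂, x₃)` from `𝕋³` to `𝕋²`. -/
noncomputable def proj (lam : ℤ) (x : Torus 3) : Torus 2 := ![lam • x 0 + x 1, x 2]

lemma continuous_proj (lam : ℤ) : Continuous (proj lam) := by
  unfold proj
  refine continuous_pi fun i => ?_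
  fin_cases i <;> simp <;> fun_prop

/-- A continuous surjective homomorphism of compact groups carries Haar measure to a Haar measure;
the factor is the ratio (2π)³/(2π)² of the masses. -/
lemma measurePreserving_proj (lam : ℤ) :
    MeasurePreserving (proj lam) volume (ENNReal.ofReal (2 * π) • volume) := by
  let φ : Torus 3 →+ Torus 2 :=
    { toFun := proj lam
      map_zero' := by ext i; fin_cases i <;> simp [proj]
      map_add' := fun x y => by
        ext i
        fin_cases i
        · simp [proj, smul_add]; abel
        · simp [proj] }
  have : ((ENNReal.ofReal (2 * π)) • (volume : Measure (Torus 2))).IsAddHaarMeasure :=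
    Measure.IsAddHaarMeasure.smul _ (by simp [Real.pi_pos]) ENNReal.ofReal_ne_top
  refine AddMonoidHom.measurePreserving (f := φ) (continuous_proj lam) (fun y => ?_) ?_
  · exact ⟨![0, y 0, y 1], by ext i; fin_cases i <;> simp [φ, proj]⟩
  · rw [Measure.smul_apply, torus_volume_univ, torus_volume_univ, smul_eq_mul,
      ← ENNReal.ofReal_mul Real.two_pi_pos.le]
    congr 1; ring

lemma measurePreserving_last :
    MeasurePreserving (fun x : Torus 3 => x 2) volume
      (ENNReal.ofReal ((2 * π) ^ 3) • haarAddCircle) := by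
  have : ((ENNReal.ofReal ((2 * π) ^ 3)) • (haarAddCircle : Measure Circ)).IsAddHaarMeasure :=
    Measure.IsAddHaarMeasure.smul _ (by simp; positivity) ENNReal.ofReal_ne_top
  refine AddMonoidHom.measurePreserving (f := Pi.evalAddMonoidHom (fun _ : Fin 3 => Circ) 2)
    (continuous_apply 2) (fun y => ⟨fun _ => y, rfl⟩) ?_
  rw [Measure.smul_apply, torus_volume_univ, measure_univ, smul_eq_mul, mul_one]

lemma _root_.MeasureTheory.MemLp.comp_proj {v : Torus 2 → ℝ} (hv : MemLp v 2 volume) (lam : ℤ) :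
    MemLp (fun x => v (proj lam x)) 2 volume :=
  (hv.smul_measure ENNReal.ofReal_ne_top).comp_measurePreserving (measurePreserving_proj lam)

lemma memLp_comp_last {h : Circ → ℝ} (hh : Continuous h) :
    MemLp (fun x : Torus 3 => h (x 2)) 2 volume :=
  (hh.comp (continuous_apply 2)).memLp_of_hasCompactSupport (HasCompactSupport.of_compactSpace _)

/-- The function is invariant under translation by (-y, lam y, 0), while the exponential acquires a
nontrivial phase unless K₀ = lam K₁. -/
lemma coeff_comp_proj_of_ne {lam : ℤ} (v : Torus 2 → ℝ) {K : Fin 3 → ℤ} (hK : K 0 ≠ lam * K 1) :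
    coeff (fun x => v (proj lam x)) K = 0 := by
  obtain ⟨y, hy⟩ := exists_fourier_ne_one (sub_ne_zero.mpr hK)
  rw [coeff_eq_ccoeff, ccoeff, integral_eq_zero_of_translate (z := ![-y, lam • y, 0]) hy, smul_zero]
  intro x
  have h1 : proj lam (x + ![-y, lam • y, 0]) = proj lam x := by
    ext i
    fin_cases i
    · simp [proj, smul_add]; abel
    · simp [proj]
  have h2 : expo (-K) ![-y, lam • y, 0] = fourier (K 0 - lam * K 1) y := by
    rw [expo_apply, Fin.prod_univ_three]
    simp only [fourier_apply, ← Circle.coe_mul, ← AddCircle.toCircle_add, Pi.neg_apply]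
    congr 2
    simp [add_smul, neg_smul, mul_smul, smul_comm (K 1) lam, sub_eq_add_neg]
  rw [h1, expo_add_arg, h2]
  ring

/-- The exponential of (lam k, k, m) is that of (k, m) composed with `proj`; the factor 2π in the
image measure corrects the normalisation. -/
lemma coeff_comp_proj {lam : ℤ} {v : Torus 2 → ℝ} (hv : MemLp v 2 volume) (k m : ℤ) :
    coeff (fun x => v (proj lam x)) ![lam * k, k, m] = coeff v ![k, m] := by
  have h1 : ∀ x, expo (-![lam * k, k, m]) x = expo (-![k, m]) (proj lam x) := by
    intro x
    rw [expo_apply, expo_apply, Fin.prod_univ_three, Fin.prod_univ_two]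
    simp only [fourier_apply, ← Circle.coe_mul, ← AddCircle.toCircle_add, Pi.neg_apply, proj]
    congr 2
    simp [smul_add, mul_smul, smul_comm k lam]
  have hi : Integrable (fun y => (v y : ℂ) * expo (-![k, m]) y) volume :=
    integrable_mul_continuous hv.ofReal (expo _).continuous
  have h2 := (measurePreserving_proj lam).map_eq
  rw [coeff_eq_ccoeff, coeff_eq_ccoeff, ccoeff, ccoeff]
  simp only [h1]
  rw [← integral_map (φ := proj lam) (continuous_proj lam).aemeasurable
    (f := fun y => (v y : ℂ) * expo (-![k, m]) y) (by
      rw [h2]; exact hi.aestronglyMeasurable.smul_measure _), h2, integral_smul_measure,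
    ENNReal.toReal_ofReal Real.two_pi_pos.le, smul_smul]
  congr 1
  field_simp

lemma coeff_comp_last_of_ne (h : Circ → ℝ) {K : Fin 3 → ℤ} {i : Fin 3} (hi : i ≠ 2)
    (hK : K i ≠ 0) : coeff (fun x : Torus 3 => h (x 2)) K = 0 := by
  obtain ⟨y, hy⟩ := exists_fourier_ne_one (neg_ne_zero.mpr hK)
  rw [coeff_eq_ccoeff, ccoeff, integral_eq_zero_of_translate (z := Pi.single i y) hy, smul_zero]
  intro x
  rw [expo_add_arg, expo_single, Pi.neg_apply, Pi.add_apply, Pi.single_eq_of_ne hi.symm, add_zero]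
  ring

lemma coeff_comp_last {h : Circ → ℝ} (hh : Continuous h) (r : ℤ) :
    coeff (fun x : Torus 3 => h (x 2)) ![0, 0, r] = fourierCoeff (toC h hh) r := by
  have h1 : ∀ x : Torus 3, expo (-![0, 0, r]) x = fourier (-r) (x 2) := by
    intro x
    rw [expo_apply, Fin.prod_univ_three]
    simp
  have h2 := measurePreserving_last.map_eq
  rw [coeff_eq_ccoeff, ccoeff, fourierCoeff]
  simp only [h1]
  have hc : Continuous fun y => (h y : ℂ) * fourier (-r) y := by fun_prop
  rw [← integral_map (φ := fun x : Torus 3 => x 2) (continuous_apply 2).aemeasurable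
    (f := fun y => (h y : ℂ) * fourier (-r) y) hc.aestronglyMeasurable, h2, integral_smul_measure,
    ENNReal.toReal_ofReal (two_pi_pow_pos 3).le, smul_smul, inv_mul_cancel₀ (two_pi_pow_pos 3).ne',
    one_smul]
  refine integral_congr_ae (Eventually.of_forall fun y => ?_)
  simp [toC, mul_comm]

lemma freqSq_triple (a b c : ℤ) : freqSq ![a, b, c] = (a : ℝ) ^ 2 + (b : ℝ) ^ 2 + (c : ℝ) ^ 2 := by
  simp [freqSq, Fin.sum_univ_three]

/-- Only the frequencies (lam k, k, m) contribute, and their square is at most (lam² + 1)(k² + m²).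
-/
theorem homSobolevSq_comp_proj_le (lam : ℤ) {v : Torus 2 → ℝ} (hv : MemLp v 2 volume) {s : ℝ}
    (hs : 0 ≤ s) :
    homSobolevSq s (fun x => v (proj lam x)) ≤
      ENNReal.ofReal ((2 * π) ^ 3 * ((lam : ℝ) ^ 2 + 1) ^ s) *
        wSum (fun K => freqSq K ^ s) v := by
  let ι : (Fin 2 → ℤ) → Fin 3 → ℤ := fun K => ![lam * K 0, K 0, K 1]
  have hι : Function.Injective ι := by
    intro K L h
    have h1 := congrFun h 1
    have h2 := congrFun h 2
    ext i
    fin_cases i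
    · simpa [ι] using h1
    · simpa [ι] using h2
  rw [homSobolevSq, ← hι.tsum_eq, wSum, ← ENNReal.tsum_mul_left]
  · refine ENNReal.tsum_le_tsum fun K => ?_
    have hK : K = ![K 0, K 1] := by ext i; fin_cases i <;> rfl
    have hc : coeff (fun x => v (proj lam x)) (ι K) = coeff v K := by
      conv_rhs => rw [hK]
      exact coeff_comp_proj hv _ _
    have hq : freqSq (ι K) ^ s ≤ ((lam : ℝ) ^ 2 + 1) ^ s * freqSq K ^ s := by
      rw [← Real.mul_rpow (by positivity) (freqSq_nonneg K)]
      refine Real.rpow_le_rpow (freqSq_nonneg _) ?_ hs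
      rw [hK, freqSq_pair, freqSq_triple]
      push_cast
      nlinarith [sq_nonneg ((lam : ℝ) * K 1)]
    have hq0 : 0 ≤ freqSq K ^ s := Real.rpow_nonneg (freqSq_nonneg K) s
    rw [hc, ← ENNReal.ofReal_mul hq0, ← ENNReal.ofReal_mul (by positivity)]
    refine ENNReal.ofReal_le_ofReal ?_
    calc (2 * π) ^ 3 * (freqSq (ι K) ^ s * ‖coeff v K‖ ^ 2)
        ≤ (2 * π) ^ 3 * ((((lam : ℝ) ^ 2 + 1) ^ s * freqSq K ^ s) * ‖coeff v K‖ ^ 2) := by gcongr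
      _ = _ := by ring
  · intro K hK
    refine ⟨![K 1, K 2], ?_⟩
    by_cases h : K 0 = lam * K 1
    · ext i
      fin_cases i <;> simp [ι, h]
    · simp [coeff_comp_proj_of_ne v h] at hK

theorem homSobolevSq_comp_last {h : Circ → ℝ} (hh : Continuous h) (s : ℝ) :
    homSobolevSq s (fun x : Torus 3 => h (x 2)) =
      ENNReal.ofReal ((2 * π) ^ 3) *
        ∑' r : ℤ, ENNReal.ofReal (((r : ℝ) ^ 2) ^ s * ‖fourierCoeff (toC h hh) r‖ ^ 2) := by
  let ι : ℤ → Fin 3 → ℤ := fun r => ![0, 0, r]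
  have hι : Function.Injective ι := fun r s h => by simpa [ι] using congrFun h 2
  rw [homSobolevSq, ← hι.tsum_eq, ← ENNReal.tsum_mul_left]
  · refine tsum_congr fun r => ?_
    rw [← ENNReal.ofReal_mul (two_pi_pow_pos 3).le, coeff_comp_last hh, freqSq_triple]
    simp
  · intro K hK
    refine ⟨K 2, ?_⟩
    have h0 : K 0 = 0 := by
      by_contra h0
      simp [coeff_comp_last_of_ne h (by decide) h0] at hK
    have h1 : K 1 = 0 := by
      by_contra h1
      simp [coeff_comp_last_of_ne h (by decide) h1] at hK
    ext i
    fin_cases i <;> simp [ι, h0, h1]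

/-- Bessel's inequality on the circle. -/
lemma tsum_fourierCoeff_sq_le {h : Circ → ℝ} (hh : Continuous h) :
    ∑' r : ℤ, ENNReal.ofReal (‖fourierCoeff (toC h hh) r‖ ^ 2) ≤
      ENNReal.ofReal (supDeriv 0 h ^ 2) := by
  have H := hasSum_sq_fourierCoeff (ContinuousMap.toLp (E := ℂ) 2 haarAddCircle ℂ (toC h hh))
  simp only [fourierCoeff_toLp] at H
  rw [← ENNReal.ofReal_tsum_of_nonneg (fun _ => by positivity) H.summable, H.tsum_eq]
  refine ENNReal.ofReal_le_ofReal ?_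
  have h1 : ∫ t, ‖ContinuousMap.toLp (E := ℂ) 2 haarAddCircle ℂ (toC h hh) t‖ ^ 2 ∂haarAddCircle =
      ∫ t : Circ, h t ^ 2 ∂haarAddCircle := by
    refine integral_congr_ae ?_
    filter_upwards [ContinuousMap.coeFn_toLp (p := 2) (𝕜 := ℂ) haarAddCircle (toC h hh)] with t ht
    rw [ht]
    simp [toC]
  rw [h1]
  have h2 : ∫ t : Circ, h t ^ 2 ∂haarAddCircle ≤
      ∫ _ : Circ, supDeriv 0 h ^ 2 ∂haarAddCircle := by
    refine integral_mono_of_nonneg (Eventually.of_forall fun t => sq_nonneg _)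
      (integrable_const _) (Eventually.of_forall fun t => ?_)
    exact sq_le_sq' (by linarith [abs_le.mp (abs_le_supDeriv_zero hh t)])
      (abs_le.mp (abs_le_supDeriv_zero hh t)).2
  simpa using h2

lemma homSobolevSq_one_heat_le {g : Circ → ℝ} (hg : SmoothCirc g) {s : ℝ} (hs : 0 ≤ s) :
    homSobolevSq 1 (fun x : Torus 3 => heat s g (x 2)) ≤
      ENNReal.ofReal ((2 * π) ^ 3 * supDeriv 1 g ^ 2) := by
  rw [homSobolevSq_comp_last (continuous_heat hg.continuous hs),
    ENNReal.ofReal_mul (two_pi_pow_pos 3).le, ← supDeriv_circDeriv 0]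
  gcongr
  refine le_trans (ENNReal.tsum_le_tsum fun r => ENNReal.ofReal_le_ofReal ?_)
    (tsum_fourierCoeff_sq_le hg.circDeriv.continuous)
  rw [fourierCoeff_circDeriv hg, fourierCoeff_heat hg.continuous hs, Real.rpow_one]
  simp only [norm_mul, Complex.norm_I, Complex.norm_intCast, one_mul, mul_pow, sq_abs,
    Complex.norm_real, Real.norm_eq_abs]
  have : exp (-(s * (r : ℝ) ^ 2)) ^ 2 ≤ 1 := by
    apply pow_le_one₀ (exp_nonneg _)
    rw [Real.exp_le_one_iff]
    nlinarith [sq_nonneg (r : ℝ)]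
  gcongr
  nlinarith [sq_nonneg ‖fourierCoeff (toC g hg.continuous) r‖]

/-- Use |e^{-sr²} - 1| ≤ s r² and, for r ≠ 0, |r|^p ≤ |r|: altogether three derivatives, which is
where g''' enters. At r = 0 the heat factor vanishes, which also covers p = 0. -/
lemma homSobolevSq_heat_sub_le {g : Circ → ℝ} (hg : SmoothCirc g) {s : ℝ} (hs : 0 ≤ s) {p : ℝ}
    (hp : p ≤ 1) :
    homSobolevSq p (fun x : Torus 3 => heat s g (x 2) - g (x 2)) ≤
      ENNReal.ofReal ((2 * π) ^ 3 * (s ^ 2 * supDeriv 3 g ^ 2)) := by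
  have hc := (continuous_heat hg.continuous hs).sub hg.continuous
  have h3 : supDeriv 3 g = supDeriv 0 (circDeriv (circDeriv (circDeriv g))) := by
    rw [supDeriv_circDeriv, supDeriv_circDeriv, supDeriv_circDeriv]
  have hcoef : ∀ r, fourierCoeff (toC (fun x => heat s g x - g x) hc) r =
      ((exp (-(s * (r : ℝ) ^ 2)) - 1 : ℝ) : ℂ) * fourierCoeff (toC g hg.continuous) r := by
    intro r
    have : fourierCoeff (toC (fun x => heat s g x - g x) hc) r =
        fourierCoeff (toC (heat s g) (continuous_heat hg.continuous hs)) r -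
          fourierCoeff (toC g hg.continuous) r := by
      rw [fourierCoeff, fourierCoeff, fourierCoeff, ← integral_sub]
      · refine integral_congr_ae (Eventually.of_forall fun x => ?_)
        simp [toC, mul_sub]
      · exact (Continuous.integrable_of_hasCompactSupport (by fun_prop)
          (HasCompactSupport.of_compactSpace _))
      · exact (Continuous.integrable_of_hasCompactSupport (by fun_prop)
          (HasCompactSupport.of_compactSpace _))
    rw [this, fourierCoeff_heat hg.continuous hs]
    push_cast
    ring
  rw [homSobolevSq_comp_last (h := fun x => heat s g x - g x) hc,
    ENNReal.ofReal_mul (two_pi_pow_pos 3).le, ENNReal.ofReal_mul (sq_nonneg s), h3]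
  gcongr
  refine le_trans ?_ (mul_le_mul_right (tsum_fourierCoeff_sq_le
    hg.circDeriv.circDeriv.circDeriv.continuous) _)
  rw [← ENNReal.tsum_mul_left]
  refine ENNReal.tsum_le_tsum fun r => ?_
  rw [← ENNReal.ofReal_mul (sq_nonneg s)]
  refine ENNReal.ofReal_le_ofReal ?_
  rw [hcoef, fourierCoeff_circDeriv hg.circDeriv.circDeriv, fourierCoeff_circDeriv hg.circDeriv,
    fourierCoeff_circDeriv hg]
  simp only [norm_mul, Complex.norm_I, Complex.norm_intCast, one_mul, mul_pow, sq_abs,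
    Complex.norm_real, Real.norm_eq_abs]
  rcases eq_or_ne r 0 with rfl | hr
  · simp
  have hr1 : 1 ≤ (r : ℝ) ^ 2 := by
    have := Int.one_le_abs hr
    rw [← sq_abs]
    exact one_le_pow₀ (by exact_mod_cast this)
  have h1 : ((r : ℝ) ^ 2) ^ p ≤ (r : ℝ) ^ 2 := by
    simpa using Real.rpow_le_rpow_of_exponent_le hr1 hp
  have h2 : (exp (-(s * (r : ℝ) ^ 2)) - 1) ^ 2 ≤ (s * (r : ℝ) ^ 2) ^ 2 := by
    have e1 := Real.add_one_le_exp (-(s * (r : ℝ) ^ 2))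
    have e2 : exp (-(s * (r : ℝ) ^ 2)) ≤ 1 := by
      rw [Real.exp_le_one_iff]; nlinarith
    exact sq_le_sq' (by linarith) (by nlinarith)
  calc ((r : ℝ) ^ 2) ^ p * ((exp (-(s * (r : ℝ) ^ 2)) - 1) ^ 2 *
        ‖fourierCoeff (toC g hg.continuous) r‖ ^ 2)
      ≤ (r : ℝ) ^ 2 * ((s * (r : ℝ) ^ 2) ^ 2 * ‖fourierCoeff (toC g hg.continuous) r‖ ^ 2) := by
        gcongr
    _ = _ := by ring

end ShearFlow

namespace ShearFlow

open ComplexConjugate AddCircle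

/-! ### Weak gradients and Fourier coefficients -/

lemma isOpenQuotientMap_torus (n : ℕ) :
    IsOpenQuotientMap (fun (v : Fin n → ℝ) (i : Fin n) => (v i : Circ)) :=
  IsOpenQuotientMap.piMap fun _ => QuotientAddGroup.isOpenQuotientMap_mk

lemma Smooth.continuous {n : ℕ} {φ : Torus n → ℝ} (hφ : Smooth φ) : Continuous φ :=
  (isOpenQuotientMap_torus n).isQuotientMap.continuous_iff.mpr (ContDiff.continuous hφ)

lemma coe_add_single {n : ℕ} (v : Fin n → ℝ) (i : Fin n) (s : ℝ) :
    (fun j => (v j : Circ)) + Pi.single i (s : Circ) =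
      fun j => (((v + s • Pi.single i (1 : ℝ) : Fin n → ℝ) j : ℝ) : Circ) := by
  ext j
  by_cases h : j = i
  · subst h; simp
  · simp [Pi.single_eq_of_ne h]

lemma Smooth.pderiv_coe {n : ℕ} {φ : Torus n → ℝ} (hφ : Smooth φ) (i : Fin n) (v : Fin n → ℝ) :
    HasDerivAt (fun s : ℝ => φ ((fun j => (v j : Circ)) + Pi.single i (s : Circ)))
      (fderiv ℝ (fun v : Fin n → ℝ => φ (fun i => (v i : Circ))) v (Pi.single i 1)) 0 := by
  simp only [coe_add_single]
  have h1 : HasFDerivAt (fun v : Fin n → ℝ => φ (fun i => (v i : Circ)))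
      (fderiv ℝ (fun v : Fin n → ℝ => φ (fun i => (v i : Circ))) v)
      (v + (0 : ℝ) • Pi.single i (1 : ℝ)) := by
    rw [zero_smul, add_zero]
    exact (ContDiff.differentiable hφ (by simp) v).hasFDerivAt
  have h2 : HasDerivAt (fun s : ℝ => v + s • Pi.single i (1 : ℝ)) (Pi.single i (1 : ℝ)) 0 := by
    simpa using ((hasDerivAt_id (0 : ℝ)).smul_const (Pi.single i (1 : ℝ))).const_add v
  exact h1.comp_hasDerivAt 0 h2

lemma Smooth.continuous_pderiv {n : ℕ} {φ : Torus n → ℝ} (hφ : Smooth φ) (i : Fin n) :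
    Continuous (pderiv i φ) := by
  refine (isOpenQuotientMap_torus n).isQuotientMap.continuous_iff.mpr ?_
  have h : pderiv i φ ∘ (fun (v : Fin n → ℝ) (i : Fin n) => (v i : Circ)) =
      fun v => fderiv ℝ (fun v : Fin n → ℝ => φ (fun i => (v i : Circ))) v (Pi.single i 1) :=
    funext fun v => (hφ.pderiv_coe i v).deriv
  rw [h]
  exact (ContDiff.continuous_fderiv hφ (by simp)).clm_apply continuous_const

lemma Smooth.hasDerivAt {n : ℕ} {φ : Torus n → ℝ} (hφ : Smooth φ) (i : Fin n) (x : Torus n)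
    (s : ℝ) : HasDerivAt (fun r : ℝ => φ (x + Pi.single i (r : Circ)))
      (pderiv i φ (x + Pi.single i (s : Circ))) s := by
  obtain ⟨v, hv⟩ := (isOpenQuotientMap_torus n).surjective (x + Pi.single i (s : Circ))
  have h := hφ.pderiv_coe i v
  have h0 : pderiv i φ (x + Pi.single i (s : Circ)) =
      fderiv ℝ (fun v : Fin n → ℝ => φ (fun i => (v i : Circ))) v (Pi.single i 1) := by
    rw [← hv]; exact h.deriv
  dsimp only at hv
  rw [hv, ← h0] at h
  have h1 := HasDerivAt.comp_sub_const s s (by simpa using h)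
  refine h1.congr_of_eventuallyEq (Eventually.of_forall fun r => ?_)
  simp only [add_assoc, ← Pi.single_add, ← AddCircle.coe_add, add_sub_cancel]

/-- Translating φ by z multiplies its coefficient by e^{iK·z}. Differentiating this at z = 0 along
the i-th axis, under the integral, replaces integration by parts. -/
lemma ccoeff_pderiv {n : ℕ} {φ : Torus n → ℝ} (hφ : Smooth φ) (i : Fin n) (K : Fin n → ℤ) :
    ccoeff (fun x => (pderiv i φ x : ℂ)) K =
      Complex.I * K i * ccoeff (fun x => (φ x : ℂ)) K := by
  have hc := hφ.continuous
  have hc' := hφ.continuous_pderiv i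
  obtain ⟨B, hB⟩ := (isCompact_range hc'.norm).bddAbove
  have hF : ∀ s : ℝ,
      Continuous fun x : Torus n => (φ (x + Pi.single i (s : Circ)) : ℂ) * expo (-K) x := fun s =>
    (Complex.continuous_ofReal.comp (hc.comp (continuous_add_const _))).mul (expo (-K)).continuous
  have hF' : ∀ s : ℝ,
      Continuous fun x : Torus n => (pderiv i φ (x + Pi.single i (s : Circ)) : ℂ) * expo (-K) x :=
    fun s => (Complex.continuous_ofReal.comp (hc'.comp (continuous_add_const _))).mul
      (expo (-K)).continuous
  have hbd : ∀ (x : Torus n) (s : ℝ),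
      ‖(pderiv i φ (x + Pi.single i (s : Circ)) : ℂ) * expo (-K) x‖ ≤ B := fun x s => by
    rw [norm_mul, norm_expo, mul_one, Complex.norm_real]
    exact hB ⟨_, rfl⟩
  have hd : ∀ (x : Torus n) (s : ℝ),
      HasDerivAt (fun s : ℝ => (φ (x + Pi.single i (s : Circ)) : ℂ) * expo (-K) x)
        ((pderiv i φ (x + Pi.single i (s : Circ)) : ℂ) * expo (-K) x) s := fun x s =>
    (hφ.hasDerivAt i x s).ofReal_comp.mul_const _
  have h1 : HasDerivAt
      (fun s : ℝ => ∫ x : Torus n, (φ (x + Pi.single i (s : Circ)) : ℂ) * expo (-K) x)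
      (∫ x : Torus n, (pderiv i φ (x + Pi.single i ((0 : ℝ) : Circ)) : ℂ) * expo (-K) x) 0 :=
    (hasDerivAt_integral_of_dominated_loc_of_deriv_le (s := univ) (bound := fun _ => B) univ_mem
      (Eventually.of_forall fun s => (hF s).aestronglyMeasurable)
      ((hF 0).integrable_of_hasCompactSupport (HasCompactSupport.of_compactSpace _))
      (hF' 0).aestronglyMeasurable (Eventually.of_forall fun x s _ => hbd x s)
      (integrable_const _) (Eventually.of_forall fun x s _ => hd x s)).2
  have h2 : ∀ z : Torus n, ∫ x, (φ (x + z) : ℂ) * expo (-K) x =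
      expo K (0 + z) * ∫ x, (φ x : ℂ) * expo (-K) x := by
    intro z
    have h3 : ∀ (ψ : Torus n → ℂ) (w : Torus n), ∫ x, ψ (x + w) = ∫ x, ψ x :=
      fun ψ w => integral_add_right_eq_self ψ w
    rw [← integral_const_mul, ← h3 (fun x => expo K (0 + z) *
      ((φ x : ℂ) * expo (-K) x)) z]
    refine integral_congr_ae (Eventually.of_forall fun x => ?_)
    have h4 : expo (-K) (x + z) * expo K z =
        expo (-K) x := by
      rw [expo_add_arg, mul_assoc, ← expo_add, neg_add_cancel, expo_zero, mul_one]
    simp only [zero_add]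
    linear_combination -(φ (x + z) : ℂ) * h4
  simp only [h2] at h1
  have h4 := h1.unique ((hasDerivAt_expo_single K 0 i).mul_const (∫ x, (φ x : ℂ) * expo (-K) x))
  have h5 : expo K (0 : Torus n) = 1 := by simp [expo_apply]
  rw [h5] at h4
  simp only [AddCircle.coe_zero, Pi.single_zero, add_zero] at h4
  rw [ccoeff, ccoeff, h4, mul_one, mul_smul_comm]

/-- `gradSq` is an infimum, so one weak gradient suffices for an upper bound. Riesz–Fischer builds
it from the coefficients iK_i v̂(K), and Parseval verifies the weak identity. Taking real parts can
only decrease the norm, so the reality of the constructed functions need not be shown. -/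
theorem gradSq_le_homSobolevSq {n : ℕ} {v : Torus n → ℝ} (hv : MemLp v 2 volume) :
    gradSq v ≤ homSobolevSq 1 v := by
  by_cases htop : homSobolevSq 1 v = ⊤
  · rw [htop]; exact le_top
  have hsum : Summable fun K => (2 * π) ^ n * (freqSq K * ‖coeff v K‖ ^ 2) := by
    have := ENNReal.summable_toReal htop
    simp only [Real.rpow_one] at this
    refine this.congr fun K => ENNReal.toReal_ofReal ?_
    have := freqSq_nonneg K
    positivity
  have hc : ∀ i : Fin n, Summable fun K : Fin n → ℤ => ‖Complex.I * K i * coeff v K‖ ^ 2 := by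
    intro i
    refine Summable.of_nonneg_of_le (fun _ => by positivity) (fun K => ?_)
      (hsum.mul_left ((2 * π) ^ n)⁻¹)
    rw [inv_mul_cancel_left₀ (two_pi_pow_pos n).ne']
    simp only [norm_mul, Complex.norm_I, Complex.norm_intCast, one_mul, mul_pow, sq_abs]
    gcongr
    exact Finset.single_le_sum (f := fun i => (K i : ℝ) ^ 2) (fun _ _ => sq_nonneg _)
      (Finset.mem_univ i)
  choose W hW hWc using fun i => exists_memLp_ccoeff (hc i)
  have hweak : ∀ i, IsWeakPDeriv i v (fun x => (W i x).re) := by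
    intro i
    refine ⟨hv.integrable (by norm_num), (hW i).re.integrable (by norm_num), fun φ hφ => ?_⟩
    have hφ2 : MemLp (fun x => (φ x : ℂ)) 2 volume :=
      (Complex.continuous_ofReal.comp hφ.continuous).memLp_of_hasCompactSupport
        (HasCompactSupport.of_compactSpace _)
    have hφ3 : MemLp (fun x => (pderiv i φ x : ℂ)) 2 volume :=
      (Complex.continuous_ofReal.comp (hφ.continuous_pderiv i)).memLp_of_hasCompactSupport
        (HasCompactSupport.of_compactSpace _)
    have hv' : MemLp (fun x => (v x : ℂ)) 2 volume := hv.ofReal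
    have h1 := hasSum_ccoeff_mul hφ3 hv'
    have h2 := (hasSum_ccoeff_mul hφ2 (hW i)).neg
    have h3 := h1.unique (h2.congr_fun (fun K => by
      rw [ccoeff_pderiv hφ, hWc, ← coeff_eq_ccoeff v]
      simp only [map_mul, Complex.conj_I, map_intCast]
      ring))
    have h4 := congrArg Complex.re h3
    have h5 : Integrable (fun x => conj ((φ x : ℝ) : ℂ) * W i x) volume := by
      simp only [Complex.conj_ofReal]
      simp only [mul_comm _ (W i _)]
      exact integrable_mul_continuous (hW i) (Complex.continuous_ofReal.comp hφ.continuous)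
    have h6 : (∫ x, conj ((φ x : ℝ) : ℂ) * W i x).re = ∫ x, (W i x).re * φ x := by
      rw [← RCLike.re_eq_complex_re, ← integral_re h5]
      refine integral_congr_ae (Eventually.of_forall fun x => ?_)
      simp [mul_comm]
    have h7 : (∫ x, conj ((pderiv i φ x : ℝ) : ℂ) * (v x : ℂ)).re = ∫ x, v x * pderiv i φ x := by
      rw [← Complex.ofReal_re (∫ x, v x * pderiv i φ x), ← integral_complex_ofReal]
      congr 2
      ext x
      simp [mul_comm]
    rw [Complex.neg_re, h6] at h4
    rw [← h4, ← h7]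
  refine (iInf₂_le _ hweak).trans ?_
  calc ∫⁻ x, ENNReal.ofReal (∑ i, (W i x).re ^ 2)
      ≤ ∫⁻ x, ∑ i, ENNReal.ofReal (‖W i x‖ ^ 2) := by
        refine lintegral_mono fun x => ?_
        rw [← ENNReal.ofReal_sum_of_nonneg fun _ _ => sq_nonneg _]
        refine ENNReal.ofReal_le_ofReal (Finset.sum_le_sum fun i _ => ?_)
        rw [← sq_abs]
        gcongr
        exact Complex.abs_re_le_norm _
    _ = ∑ i, ∫⁻ x, ENNReal.ofReal (‖W i x‖ ^ 2) := by
        refine lintegral_finsetSum' _ fun i _ => ?_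
        exact ((hW i).aestronglyMeasurable.norm.aemeasurable.pow_const 2).ennreal_ofReal
    _ = ∑ i, ∑' K, ENNReal.ofReal ((2 * π) ^ n * ‖ccoeff (W i) K‖ ^ 2) :=
        Finset.sum_congr rfl fun i _ => lintegral_sq_eq_tsum (hW i)
    _ = ∑' K, ∑ i, ENNReal.ofReal ((2 * π) ^ n * ‖ccoeff (W i) K‖ ^ 2) :=
        (Summable.tsum_finsetSum fun _ _ => ENNReal.summable).symm
    _ = homSobolevSq 1 v := by
        refine tsum_congr fun K => ?_
        rw [← ENNReal.ofReal_sum_of_nonneg fun _ _ => by positivity, Real.rpow_one]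
        congr 1
        simp only [hWc, norm_mul, Complex.norm_I, Complex.norm_intCast, one_mul, mul_pow, sq_abs]
        rw [← Finset.mul_sum, ← Finset.sum_mul, freqSq]

/-! ### The `L²` norm of a vector field -/

lemma lintegral_sq_eq_homSobolevSq {n : ℕ} {v : Torus n → ℝ} (hv : MemLp v 2 volume) :
    ∫⁻ x, ENNReal.ofReal (v x ^ 2) = homSobolevSq 0 v := by
  have h := lintegral_sq_eq_tsum (v := fun x => (v x : ℂ)) hv.ofReal
  simpa [homSobolevSq, coeff_eq_ccoeff] using h

theorem eLpNorm_eq_homSobolevNormVec {n m : ℕ} {u : Torus n → EuclideanSpace ℝ (Fin m)}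
    (hu : ∀ j, MemLp (fun x => u x j) 2 volume) :
    eLpNorm u 2 volume = homSobolevNormVec 0 u := by
  rw [eLpNorm_eq_lintegral_rpow_enorm_toReal (by norm_num) (by norm_num), homSobolevNormVec,
    ENNReal.toReal_ofNat]
  congr 1
  simp only [← lintegral_sq_eq_homSobolevSq (hu _)]
  rw [← lintegral_finsetSum' _ fun j _ =>
    ((hu j).aestronglyMeasurable.aemeasurable.pow_const 2).ennreal_ofReal]
  refine lintegral_congr fun x => ?_
  rw [← ofReal_norm, ENNReal.ofReal_rpow_of_nonneg (norm_nonneg _) (by norm_num),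
    ← ENNReal.ofReal_sum_of_nonneg fun _ _ => sq_nonneg _, EuclideanSpace.norm_eq]
  congr 1
  rw [Real.rpow_ofNat, Real.sq_sqrt (Finset.sum_nonneg fun _ _ => sq_nonneg _)]
  simp

end ShearFlow

namespace ShearFlow

open ComplexConjugate AddCircle

/-! ### Continuity in time with values in `L²` -/

lemma ContInL2.mono {n : ℕ} {E : Type*} [NormedAddCommGroup E] {I J : Set ℝ}
    {v : ℝ → Torus n → E} (hv : ContInL2 J v) (h : I ⊆ J) : ContInL2 I v :=
  ⟨fun t ht => hv.1 t (h ht), fun t ht => (hv.2 t (h ht)).mono_left (nhdsWithin_mono _ h)⟩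

lemma ContInL2.sub {n : ℕ} {E : Type*} [NormedAddCommGroup E] {I : Set ℝ}
    {u v : ℝ → Torus n → E} (hu : ContInL2 I u) (hv : ContInL2 I v) :
    ContInL2 I (fun t => u t - v t) := by
  refine ⟨fun t ht => (hu.1 t ht).sub (hv.1 t ht), fun t₀ ht₀ => ?_⟩
  refine tendsto_of_tendsto_of_tendsto_of_le_of_le' tendsto_const_nhds
    (by simpa using (hu.2 t₀ ht₀).add (hv.2 t₀ ht₀)) (Eventually.of_forall fun _ => zero_le) ?_
  filter_upwards [self_mem_nhdsWithin] with t ht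
  rw [sub_sub_sub_comm]
  exact eLpNorm_sub_le ((hu.1 t ht).sub (hu.1 t₀ ht₀)).aestronglyMeasurable
    ((hv.1 t ht).sub (hv.1 t₀ ht₀)).aestronglyMeasurable (by norm_num)

lemma ContInL2.const_mul {n : ℕ} {I : Set ℝ} {v : ℝ → Torus n → ℝ} (hv : ContInL2 I v) (c : ℝ) :
    ContInL2 I (fun t x => c * v t x) := by
  refine ⟨fun t ht => (hv.1 t ht).const_mul c, fun t₀ ht₀ => ?_⟩
  have h := ENNReal.Tendsto.const_mul (a := ‖c‖ₑ) (hv.2 t₀ ht₀) (Or.inr enorm_ne_top)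
  rw [mul_zero] at h
  refine h.congr fun t => ?_
  rw [← eLpNorm_const_smul]
  congr 1
  ext x
  simp [mul_sub]

lemma contInL2_const {n : ℕ} {E : Type*} [NormedAddCommGroup E] {v : Torus n → E}
    (hv : MemLp v 2 volume) (I : Set ℝ) : ContInL2 I (fun _ => v) :=
  ⟨fun _ _ => hv, fun _ _ => by simpa using tendsto_const_nhds⟩

lemma ContInL2.comp_proj {I : Set ℝ} {v : ℝ → Torus 2 → ℝ} (hv : ContInL2 I v) (lam : ℤ) :
    ContInL2 I (fun t x => v t (proj lam x)) := by
  refine ⟨fun t ht => (hv.1 t ht).comp_proj lam, fun t₀ ht₀ => ?_⟩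
  have hfin : ENNReal.ofReal (2 * π) ^ (1 / (2 : ℝ≥0∞)).toReal ≠ ⊤ :=
    ENNReal.rpow_ne_top_of_nonneg (by positivity) ENNReal.ofReal_ne_top
  have h := ENNReal.Tendsto.const_mul (hv.2 t₀ ht₀) (Or.inr hfin)
  rw [mul_zero] at h
  refine h.congr' ?_
  filter_upwards [self_mem_nhdsWithin] with t ht
  rw [← smul_eq_mul, ← eLpNorm_smul_measure_of_ne_top (by norm_num),
    ← eLpNorm_comp_measurePreserving
      (((hv.1 t ht).sub (hv.1 t₀ ht₀)).aestronglyMeasurable.smul_measure _)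
      (measurePreserving_proj lam)]
  rfl

/-- Continuity in time for the uniform norm implies continuity with values in `L²`. -/
lemma tendsto_eLpNorm_sub_of_bound {n : ℕ} {v : ℝ → Torus n → ℝ} {l : Filter ℝ} {b : ℝ → ℝ}
    (hb : Tendsto b l (𝓝 0)) {v₀ : Torus n → ℝ} (h : ∀ᶠ t in l, ∀ x, |v t x - v₀ x| ≤ b t) :
    Tendsto (fun t => eLpNorm (v t - v₀) 2 volume) l (𝓝 0) := by
  have hfin : (volume : Measure (Torus n)) univ ^ (2 : ℝ≥0∞).toReal⁻¹ ≠ ⊤ :=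
    ENNReal.rpow_ne_top_of_nonneg (by positivity) (measure_ne_top _ _)
  have h1 := ENNReal.Tendsto.const_mul (ENNReal.tendsto_ofReal hb) (Or.inr hfin)
  rw [ENNReal.ofReal_zero, mul_zero] at h1
  refine tendsto_of_tendsto_of_tendsto_of_le_of_le' tendsto_const_nhds h1
    (Eventually.of_forall fun _ => zero_le) ?_
  filter_upwards [h] with t ht
  exact eLpNorm_le_of_ae_bound (Eventually.of_forall ht)

lemma contInL2_heat {g : Circ → ℝ} (hg : SmoothCirc g) {ν : ℝ} (hν : 0 ≤ ν) :
    ContInL2 (Ici 0) (fun t (x : Torus 3) => heat (ν * t) g (x 2)) := by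
  refine ⟨fun t ht => memLp_comp_last (continuous_heat hg.continuous (mul_nonneg hν ht)),
    fun t₀ ht₀ => ?_⟩
  refine tendsto_eLpNorm_sub_of_bound
    (b := fun t => supDeriv 1 g * |√(2 * (ν * t)) - √(2 * (ν * t₀))|) ?_ ?_
  · have hc : Continuous fun t => supDeriv 1 g * |√(2 * (ν * t)) - √(2 * (ν * t₀))| := by fun_prop
    simpa using (hc.tendsto t₀).mono_left nhdsWithin_le_nhds
  · filter_upwards [self_mem_nhdsWithin] with t ht x
    exact hg.abs_heat_sub_le (mul_nonneg hν ht) (mul_nonneg hν ht₀) _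

/-- Approximate f in L² by a bounded continuous φ. Shears preserve measure, so the error stays ε/3
at all times; for φ the motion is continuous in the uniform norm because the torus is compact. -/
lemma contInL2_eulerProfile {f : Torus 2 → ℝ} (hf : MemLp f 2 volume) {g : Circ → ℝ}
    (hg : Continuous g) (I : Set ℝ) : ContInL2 I (eulerProfile f g) := by
  refine ⟨fun t _ => memLp_eulerProfile hf hg t, fun t₀ _ => ?_⟩
  rw [ENNReal.tendsto_nhds_zero]
  intro ε hε
  have hε3 : ε / 3 ≠ 0 := (ENNReal.div_pos hε.ne' (by norm_num)).ne'
  obtain ⟨φ, hφ, hφ2⟩ := hf.exists_boundedContinuous_eLpNorm_sub_le (by norm_num) hε3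
  have c0 : Continuous fun x : ℝ => (x : Circ) := continuous_quotient_mk'
  let G : C(ℝ, C(Torus 2, ℝ)) := ContinuousMap.curry
    ⟨fun p : ℝ × Torus 2 => eulerProfile φ g p.1 p.2, by
      refine φ.continuous.comp (continuous_pi fun i => ?_)
      fin_cases i
      · exact ((continuous_apply 0).comp continuous_snd).add
          (c0.comp (continuous_fst.mul (hg.comp ((continuous_apply 1).comp continuous_snd))))
      · change Continuous fun p : ℝ × Torus 2 => p.2 1
        fun_prop⟩
  have h1 : Tendsto (fun t => eLpNorm (eulerProfile φ g t - eulerProfile φ g t₀) 2 volume)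
      (𝓝[I] t₀) (𝓝 0) := by
    refine tendsto_eLpNorm_sub_of_bound (b := fun t => dist (G t) (G t₀)) ?_
      (Eventually.of_forall fun t x => ?_)
    · have hc : Continuous fun t => dist (G t) (G t₀) := by fun_prop
      simpa using (hc.tendsto t₀).mono_left nhdsWithin_le_nhds
    · exact ContinuousMap.dist_apply_le_dist (f := G t) (g := G t₀) x
  have h2 : ∀ t, eLpNorm (eulerProfile f g t - eulerProfile φ g t) 2 volume ≤ ε / 3 := by
    intro t
    have h := eLpNorm_comp_measurePreserving (p := 2) (hf.sub hφ2).aestronglyMeasurable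
      (measurePreserving_shearMap (continuous_shift hg t))
    exact h.trans_le hφ
  filter_upwards [(ENNReal.tendsto_nhds_zero.mp h1) (ε / 3) (pos_iff_ne_zero.mpr hε3)] with t ht
  have hm : ∀ {ψ : Torus 2 → ℝ}, MemLp ψ 2 volume → ∀ t, AEStronglyMeasurable (eulerProfile ψ g t) :=
    fun hψ t => (memLp_eulerProfile hψ hg t).aestronglyMeasurable
  calc eLpNorm (eulerProfile f g t - eulerProfile f g t₀) 2 volume
      = eLpNorm ((eulerProfile f g t - eulerProfile φ g t) +
          (eulerProfile φ g t - eulerProfile φ g t₀) -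
          (eulerProfile f g t₀ - eulerProfile φ g t₀)) 2 volume := by
        congr 1; abel
    _ ≤ ε / 3 + ε / 3 + ε / 3 := by
        refine (eLpNorm_sub_le (((hm hf t).sub (hm hφ2 t)).add ((hm hφ2 t).sub (hm hφ2 t₀)))
          ((hm hf t₀).sub (hm hφ2 t₀)) (by norm_num)).trans (add_le_add ?_ (h2 t₀))
        exact (eLpNorm_add_le ((hm hf t).sub (hm hφ2 t)) ((hm hφ2 t).sub (hm hφ2 t₀))
          (by norm_num)).trans (add_le_add (h2 t) ht)
    _ = ε := ENNReal.add_thirds ε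

lemma homSobolevSq_zero_eq {n : ℕ} {v : Torus n → ℝ} (hv : MemLp v 2 volume) :
    homSobolevSq 0 v = eLpNorm v 2 volume ^ (2 : ℝ) := by
  rw [← lintegral_sq_eq_homSobolevSq hv, eLpNorm_eq_lintegral_rpow_enorm_toReal (by norm_num)
    (by norm_num), ← ENNReal.rpow_mul, ENNReal.toReal_ofNat, one_div, inv_mul_cancel₀ two_ne_zero,
    ENNReal.rpow_one]
  refine lintegral_congr fun x => ?_
  rw [← ofReal_norm, ENNReal.ofReal_rpow_of_nonneg (norm_nonneg _) (by norm_num), Real.rpow_ofNat,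
    Real.norm_eq_abs, sq_abs]

/-- A vector field is continuous in time with values in `L²` if its components are. -/
lemma contInL2_of_components {n m : ℕ} {I : Set ℝ} {u : ℝ → Torus n → EuclideanSpace ℝ (Fin m)}
    (hu : ∀ j, ContInL2 I (fun t x => u t x j)) : ContInL2 I u := by
  refine ⟨fun t ht => MemLp.of_eval_piLp fun j => (hu j).1 t ht, fun t₀ ht₀ => ?_⟩
  have h1 : Tendsto (fun t => (∑ j, eLpNorm ((fun x => u t x j) - fun x => u t₀ x j) 2 volume ^
      (2 : ℝ)) ^ (1 / 2 : ℝ)) (𝓝[I] t₀) (𝓝 ((∑ _j : Fin m, 0 ^ (2 : ℝ)) ^ (1 / 2 : ℝ))) := by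
    refine (ENNReal.continuous_rpow_const.tendsto _).comp (tendsto_finsetSum _ fun j _ => ?_)
    exact (ENNReal.continuous_rpow_const.tendsto _).comp ((hu j).2 t₀ ht₀)
  have h0 : ((∑ _j : Fin m, (0 : ℝ≥0∞) ^ (2 : ℝ)) ^ (1 / 2 : ℝ)) = 0 := by simp
  rw [h0] at h1
  refine h1.congr' ?_
  filter_upwards [self_mem_nhdsWithin] with t ht
  have hd : ∀ j, MemLp (fun x => (u t - u t₀) x j) 2 volume := fun j =>
    ((hu j).1 t ht).sub ((hu j).1 t₀ ht₀)
  rw [eLpNorm_eq_homSobolevNormVec hd, homSobolevNormVec]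
  congr 1
  exact Finset.sum_congr rfl fun j _ => (homSobolevSq_zero_eq (hd j)).symm

/-! ### The shear flows on `𝕋³` -/

section Flows

variable {lam : ℤ} {ν : ℝ} {f : Torus 2 → ℝ} {g : Circ → ℝ} {F : ℝ → Torus 2 → ℝ}

lemma uE_eq (lam : ℤ) (f : Torus 2 → ℝ) (g : Circ → ℝ) (t : ℝ) (x : Torus 3) :
    uE lam f g t x = !₂[eulerProfile f g t (proj lam x),
      -(lam : ℝ) * eulerProfile f g t (proj lam x) - g (x 2), 0] := rfl

lemma uNS_eq (lam : ℤ) (ν : ℝ) (g : Circ → ℝ) (F : ℝ → Torus 2 → ℝ) (t : ℝ) (x : Torus 3) :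
    uNS lam ν g F t x = !₂[F t (proj lam x),
      -(lam : ℝ) * F t (proj lam x) - heat (ν * t) g (x 2), 0] := rfl

theorem IsProfile.contInL2_uNS (hF : IsProfile lam ν f g F) (hg : SmoothCirc g) (hν : 0 ≤ ν) :
    ContInL2 (Ici 0) (uNS lam ν g F) := by
  refine contInL2_of_components fun j => ?_
  have h := hF.cont.comp_proj lam
  fin_cases j
  · exact h
  · change ContInL2 _ (fun t x => -(lam : ℝ) * F t (proj lam x) - heat (ν * t) g (x 2))
    exact (h.const_mul (-(lam : ℝ))).sub (contInL2_heat hg hν)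
  · change ContInL2 _ (fun (_ : ℝ) (_ : Torus 3) => (0 : ℝ))
    exact contInL2_const (v := fun _ : Torus 3 => (0 : ℝ)) MemLp.zero' _

theorem contInL2_uE (hf : MemLp f 2 volume) (hg : Continuous g) (I : Set ℝ) :
    ContInL2 I (uE lam f g) := by
  refine contInL2_of_components fun j => ?_
  have h := (contInL2_eulerProfile hf hg I).comp_proj lam
  fin_cases j
  · exact h
  · change ContInL2 _ (fun t x => -(lam : ℝ) * eulerProfile f g t (proj lam x) - g (x 2))
    exact (h.const_mul (-(lam : ℝ))).sub (contInL2_const (memLp_comp_last hg) I)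
  · change ContInL2 _ (fun (_ : ℝ) (_ : Torus 3) => (0 : ℝ))
    exact contInL2_const (v := fun _ : Torus 3 => (0 : ℝ)) MemLp.zero' _

end Flows

end ShearFlow

/-! ### Estimates for the flows on 𝕋³ and the main theorem. -/

namespace ShearFlow

open ComplexConjugate AddCircle

lemma homSobolevSq_mul_sub_le {n : ℕ} {u v : Torus n → ℝ} (hu : MemLp u 2 volume)
    (hv : MemLp v 2 volume) (a s : ℝ) :
    homSobolevSq s (fun x => a * u x - v x) ≤
      ENNReal.ofReal (2 * a ^ 2) * homSobolevSq s u + 2 * homSobolevSq s v := by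
  rw [homSobolevSq, homSobolevSq, homSobolevSq, ← ENNReal.tsum_mul_left, ← ENNReal.tsum_mul_left,
    ← ENNReal.tsum_add]
  refine ENNReal.tsum_le_tsum fun K => ?_
  have hc : coeff (fun x => a * u x) K = a * coeff u K := by
    rw [coeff_eq_ccoeff, coeff_eq_ccoeff, ccoeff, ccoeff, mul_smul_comm, ← integral_const_mul]
    congr 2
    ext x
    push_cast
    ring
  have hq : 0 ≤ freqSq K ^ s := Real.rpow_nonneg (freqSq_nonneg K) s
  have h2 : (2 : ℝ≥0∞) = ENNReal.ofReal 2 := by simp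
  rw [coeff_sub (hu.const_mul a) hv, hc, h2, ← ENNReal.ofReal_mul (by positivity),
    ← ENNReal.ofReal_mul (by positivity), ← ENNReal.ofReal_add (by positivity) (by positivity)]
  refine ENNReal.ofReal_le_ofReal ?_
  have h3 : ‖(a : ℂ) * coeff u K - coeff v K‖ ^ 2 ≤
      2 * (a ^ 2 * ‖coeff u K‖ ^ 2) + 2 * ‖coeff v K‖ ^ 2 := by
    have h4 := norm_sub_le ((a : ℂ) * coeff u K) (coeff v K)
    rw [norm_mul, Complex.norm_real, Real.norm_eq_abs] at h4
    have h5 : ‖(a : ℂ) * coeff u K - coeff v K‖ ^ 2 ≤ (|a| * ‖coeff u K‖ + ‖coeff v K‖) ^ 2 := by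
      gcongr
    rw [← sq_abs a]
    nlinarith [sq_nonneg (|a| * ‖coeff u K‖ - ‖coeff v K‖)]
  calc (2 * π) ^ n * (freqSq K ^ s * ‖(a : ℂ) * coeff u K - coeff v K‖ ^ 2)
      ≤ (2 * π) ^ n * (freqSq K ^ s *
          (2 * (a ^ 2 * ‖coeff u K‖ ^ 2) + 2 * ‖coeff v K‖ ^ 2)) := by gcongr
    _ = _ := by ring

lemma homSobolevSq_zero_fun (n : ℕ) (s : ℝ) : homSobolevSq s (fun _ : Torus n => (0 : ℝ)) = 0 := by
  simp [homSobolevSq, coeff]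

/-- The homogeneous Sobolev norms of a 2.75D shear flow. -/
theorem sum_homSobolevSq_le (lam : ℤ) {D : Torus 2 → ℝ} (hD : MemLp D 2 volume) {H : Circ → ℝ}
    (hH : Continuous H) {s : ℝ} (hs : 0 ≤ s) :
    homSobolevSq s (fun x => D (proj lam x)) +
        homSobolevSq s (fun x => -(lam : ℝ) * D (proj lam x) - H (x 2)) ≤
      ENNReal.ofReal ((2 * π) ^ 3 * ((lam : ℝ) ^ 2 + 1) ^ s * (1 + 2 * (lam : ℝ) ^ 2)) *
        wSum (fun K => freqSq K ^ s) D + 2 * homSobolevSq s (fun x : Torus 3 => H (x 2)) := by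
  have h1 := homSobolevSq_comp_proj_le lam hD hs
  have h2 := homSobolevSq_mul_sub_le (hD.comp_proj lam) (memLp_comp_last hH) (-(lam : ℝ)) s
  have hb : 0 ≤ (2 * π) ^ 3 * ((lam : ℝ) ^ 2 + 1) ^ s := by positivity
  refine (add_le_add h1 (h2.trans (add_le_add (mul_le_mul_right h1 _) le_rfl))).trans (le_of_eq ?_)
  rw [← add_assoc]
  congr 1
  rw [← mul_assoc, ← add_mul, ← ENNReal.ofReal_mul (by positivity),
    ← ENNReal.ofReal_add hb (by positivity)]
  congr 2
  ring

/-- The factor (2π)ⁿ ≥ 1 and X ≤ 1 + X. Finiteness of the norm is needed to pass through `toReal`.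
-/
lemma wSum_rpow_le_sobolevNorm {n : ℕ} {f : Torus n → ℝ} {l : ℝ} (hl : 0 ≤ l)
    (hf : MemSobolev l f) :
    wSum (fun K => freqSq K ^ l) f ≤ ENNReal.ofReal ((sobolevNorm l f).toReal ^ 2) := by
  rw [← ENNReal.toReal_pow, ENNReal.ofReal_toReal (ENNReal.pow_ne_top hf.2.ne), sobolevNorm,
    ← ENNReal.rpow_natCast, ← ENNReal.rpow_mul]
  norm_num
  refine ENNReal.tsum_le_tsum fun K => ?_
  have hq := freqSq_nonneg K
  rw [← ENNReal.ofReal_mul (Real.rpow_nonneg hq l)]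
  refine ENNReal.ofReal_le_ofReal ?_
  have h1 : (1 : ℝ) ≤ (2 * π) ^ n := one_le_pow₀ (by linarith [Real.pi_gt_three])
  have h2 : freqSq K ^ l ≤ (1 + freqSq K) ^ l := Real.rpow_le_rpow hq (by linarith) hl
  calc freqSq K ^ l * ‖coeff f K‖ ^ 2 ≤ (1 + freqSq K) ^ l * ‖coeff f K‖ ^ 2 := by gcongr
    _ ≤ (2 * π) ^ n * ((1 + freqSq K) ^ l * ‖coeff f K‖ ^ 2) :=
        le_mul_of_one_le_left (by positivity) h1

section Flows

variable {lam : ℤ} {ν : ℝ} {f : Torus 2 → ℝ} {g : Circ → ℝ} {F : ℝ → Torus 2 → ℝ}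

/-- The Dirichlet energy of the Navier-Stokes shear flow. -/
theorem IsProfile.gradSqVec_uNS_le (hF : IsProfile lam ν f g F) (hg : SmoothCirc g) (hν : 0 ≤ ν)
    {s : ℝ} (hs : 0 ≤ s) :
    gradSqVec (uNS lam ν g F s) ≤
      ENNReal.ofReal ((2 * π) ^ 3 * ((lam : ℝ) ^ 2 + 1) * (1 + 2 * (lam : ℝ) ^ 2)) *
        wSum freqSq (F s) + 2 * ENNReal.ofReal ((2 * π) ^ 3 * supDeriv 1 g ^ 2) := by
  have hc := continuous_heat hg.continuous (mul_nonneg hν hs)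
  have hD := hF.cont.1 s hs
  have h1 := sum_homSobolevSq_le lam hD hc zero_le_one
  simp only [Real.rpow_one] at h1
  refine le_trans ?_ (h1.trans (add_le_add le_rfl
    (mul_le_mul_right (homSobolevSq_one_heat_le hg (mul_nonneg hν hs)) _)))
  rw [gradSqVec, Fin.sum_univ_three]
  have e0 : gradSq (fun x => uNS lam ν g F s x 0) ≤ homSobolevSq 1 (fun x => F s (proj lam x)) :=
    gradSq_le_homSobolevSq (hD.comp_proj lam)
  have e1 : gradSq (fun x => uNS lam ν g F s x 1) ≤
      homSobolevSq 1 (fun x => -(lam : ℝ) * F s (proj lam x) - heat (ν * s) g (x 2)) :=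
    gradSq_le_homSobolevSq (((hD.comp_proj lam).const_mul _).sub (memLp_comp_last hc))
  have e2 : gradSq (fun x => uNS lam ν g F s x 2) ≤ 0 :=
    (gradSq_le_homSobolevSq (v := fun _ : Torus 3 => (0 : ℝ)) MemLp.zero').trans
      (homSobolevSq_zero_fun 3 1).le
  simpa using add_le_add (add_le_add e0 e1) e2

/-- The viscous dissipation of the Navier-Stokes shear flow. -/
theorem IsProfile.viscous_dissipation_le (hF : IsProfile lam ν f g F) (hg : SmoothCirc g)
    (hν : 0 < ν) (hν1 : ν < 1) {l t : ℝ} (h0 : 0 < l) (h1 : l < 1) (hf : MemSobolev l f)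
    (ht : 0 ≤ t) :
    ENNReal.ofReal ν * ∫⁻ s in Ioc 0 t, gradSqVec (uNS lam ν g F s) ≤
      ENNReal.ofReal (ν ^ l * ((2 * π) ^ 3 * ((lam : ℝ) ^ 2 + 1) * (1 + 2 * (lam : ℝ) ^ 2) *
        ((t + 1) * exp (supDeriv 1 g * t) * (sobolevNorm l f).toReal ^ 2) +
          2 * ((2 * π) ^ 3 * supDeriv 1 g ^ 2 * t))) := by
  set Γ := supDeriv 1 g
  set N := (sobolevNorm l f).toReal
  set c := (2 * π) ^ 3 * ((lam : ℝ) ^ 2 + 1) * (1 + 2 * (lam : ℝ) ^ 2) with hc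
  have hc0 : 0 ≤ c := by positivity
  have hd := (hF.isModeFamily hg hν).dissipation_le hν (freqSq_mul_le_damping lam hν.le) h0 h1 ht
  rw [wSum_congr_ae hF.init] at hd
  have hd2 := hd.trans (mul_le_mul_right (wSum_rpow_le_sobolevNorm h0.le hf) _)
  have h2 : (2 : ℝ≥0∞) = ENNReal.ofReal 2 := by simp
  -- The heat part of the flow dissipates at order ν, which is no worse than ν^l.
  have hνl : ν ≤ ν ^ l := by
    simpa using Real.rpow_le_rpow_of_exponent_ge hν hν1.le h1.le
  have hΓ : 0 ≤ Γ := supDeriv_nonneg 1 g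
  calc ENNReal.ofReal ν * ∫⁻ s in Ioc 0 t, gradSqVec (uNS lam ν g F s)
      ≤ ENNReal.ofReal ν * ∫⁻ s in Ioc 0 t,
          (ENNReal.ofReal c * wSum freqSq (F s) + 2 * ENNReal.ofReal ((2 * π) ^ 3 * Γ ^ 2)) := by
        refine mul_le_mul_right (setLIntegral_mono' measurableSet_Ioc fun s hs => ?_) _
        exact hF.gradSqVec_uNS_le hg hν.le hs.1.le
    _ = ENNReal.ofReal c * (ENNReal.ofReal ν * ∫⁻ s in Ioc 0 t, wSum freqSq (F s)) +
          ENNReal.ofReal ν * (2 * ENNReal.ofReal ((2 * π) ^ 3 * Γ ^ 2) * ENNReal.ofReal t) := by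
        rw [lintegral_add_right _ measurable_const, lintegral_const_mul' _ _ ENNReal.ofReal_ne_top,
          setLIntegral_const, Real.volume_Ioc, sub_zero]
        ring
    _ ≤ ENNReal.ofReal c * (ENNReal.ofReal (ν ^ l * ((t + 1) * exp (Γ * t))) *
          ENNReal.ofReal (N ^ 2)) +
          ENNReal.ofReal (ν ^ l) *
            (2 * ENNReal.ofReal ((2 * π) ^ 3 * Γ ^ 2) * ENNReal.ofReal t) := by
        gcongr
    _ = _ := by
        rw [h2, ← ENNReal.ofReal_mul (by positivity), ← ENNReal.ofReal_mul (by positivity),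
          ← ENNReal.ofReal_mul (by positivity), ← ENNReal.ofReal_mul (by positivity),
          ← ENNReal.ofReal_mul (by positivity), ← ENNReal.ofReal_add (by positivity) (by positivity)]
        congr 1
        ring

lemma supDeriv_le_wInfNorm {j m : ℕ} (hj : j ≤ m) (g : Circ → ℝ) : supDeriv j g ≤ wInfNorm m g :=
  Finset.single_le_sum (f := fun j => supDeriv j g) (fun j _ => supDeriv_nonneg j g)
    (Finset.mem_range.mpr (Nat.lt_succ_of_le hj))

/-- The constant in the rate of convergence. -/
noncomputable def rateConst (lam : ℤ) (p T W N : ℝ) : ℝ :=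
  (2 * π) ^ 3 * ((lam : ℝ) ^ 2 + 1) ^ p * (1 + 2 * (lam : ℝ) ^ 2) *
    ((((lam : ℝ) ^ 2 + 1) * ((1 + T) * exp (W * T)) + 2 * (W * √(2 * T) * T) + 4 * exp (W * T)) *
      N ^ 2) + 2 * ((2 * π) ^ 3 * (T ^ 2 * W ^ 2))

lemma uNS_sub_uE (t : ℝ) (x : Torus 3) :
    (uNS lam ν g F t - uE lam f g t) x = !₂[F t (proj lam x) - eulerProfile f g t (proj lam x),
      -(lam : ℝ) * (F t (proj lam x) - eulerProfile f g t (proj lam x)) -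
        (heat (ν * t) g (x 2) - g (x 2)), 0] := by
  rw [Pi.sub_apply, uNS_eq, uE_eq]
  ext i
  fin_cases i
  · simp
  · simp; ring
  · simp

/-- The distance of the Navier-Stokes and the Euler shear flows. -/
theorem IsProfile.homSobolevNormVec_sub_le (hF : IsProfile lam ν f g F) (hg : SmoothCirc g)
    (hν : 0 < ν) (hν1 : ν < 1) {l p t T : ℝ} (hl : 1 / 2 ≤ l) (hl1 : l < 1) (hf : MemSobolev l f)
    (hp : 0 ≤ p) (hpl : p < l) (ht : t ∈ Icc 0 T) :
    homSobolevNormVec p (uNS lam ν g F t - uE lam f g t) ≤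
      ENNReal.ofReal (ν ^ ((1 / 4 : ℝ) * (1 - p / l)) *
        √(rateConst lam p T (wInfNorm 3 g) (sobolevNorm l f).toReal)) := by
  obtain ⟨ht0, htT⟩ := ht
  have hT0 : 0 ≤ T := ht0.trans htT
  have hl0 : 0 < l := by linarith
  set W := wInfNorm 3 g with hW
  set N := (sobolevNorm l f).toReal
  set θ := 1 - p / l with hθ
  have hθ0 : 0 ≤ θ := by
    rw [hθ, sub_nonneg, div_le_one hl0]; exact hpl.le
  have hθ1 : θ ≤ 1 := by
    rw [hθ]; linarith [div_nonneg hp hl0.le]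
  have hs1 : supDeriv 1 g ≤ W := supDeriv_le_wInfNorm (by norm_num) g
  have hs3 : supDeriv 3 g ≤ W := supDeriv_le_wInfNorm le_rfl g
  have hs10 := supDeriv_nonneg 1 g
  have hs30 := supDeriv_nonneg 3 g
  have hW0 : 0 ≤ W := hs10.trans hs1
  set A := ((lam : ℝ) ^ 2 + 1) * ((1 + T) * exp (W * T)) + 2 * (W * √(2 * T) * T) +
    4 * exp (W * T) with hA
  -- The constants of `rateConst`: c is the cost of passing from 𝕋² to 𝕋³, A comes from the
  -- interpolated profile estimate, and the remaining term from the heat flow of g.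
  set c := (2 * π) ^ 3 * ((lam : ℝ) ^ 2 + 1) ^ p * (1 + 2 * (lam : ℝ) ^ 2) with hc
  have hA0 : 0 ≤ A := by positivity
  have hc0 : 0 ≤ c := by positivity
  have hR0 : 0 ≤ rateConst lam p T W N := by unfold rateConst; positivity
  have hD : MemLp (fun y => F t y - eulerProfile f g t y) 2 volume :=
    (hF.cont.1 t ht0).sub (memLp_eulerProfile hf.1 hg.continuous t)
  have hH : Continuous fun x => heat (ν * t) g x - g x :=
    (continuous_heat hg.continuous (mul_nonneg hν.le ht0)).sub hg.continuous
  have hrate := (hF.wSum_rpow_sub_le hg hν hl hl1 hp hpl ht0).trans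
    (mul_le_mul_right (wSum_rpow_le_sobolevNorm hl0.le hf) _)
  have hrate2 : wSum (fun K => freqSq K ^ p) (fun y => F t y - eulerProfile f g t y) ≤
      ENNReal.ofReal (ν ^ (1 / 2 * θ) * A) * ENNReal.ofReal (N ^ 2) := by
    refine hrate.trans (mul_le_mul_left (ENNReal.ofReal_le_ofReal ?_) _)
    rw [hA]
    gcongr
  have hheat : homSobolevSq p (fun x : Torus 3 => heat (ν * t) g (x 2) - g (x 2)) ≤
      ENNReal.ofReal (ν ^ (1 / 2 * θ) * ((2 * π) ^ 3 * (T ^ 2 * W ^ 2))) := by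
    refine (homSobolevSq_heat_sub_le hg (mul_nonneg hν.le ht0) (by linarith)).trans
      (ENNReal.ofReal_le_ofReal ?_)
    -- The squared heat error is of order ν², smaller than the profile error because θ ≤ 1.
    have h1 : ν ^ 2 ≤ ν ^ (1 / 2 * θ) := by
      rw [← Real.rpow_natCast]
      exact Real.rpow_le_rpow_of_exponent_ge hν hν1.le (by push_cast; linarith)
    calc (2 * π) ^ 3 * ((ν * t) ^ 2 * supDeriv 3 g ^ 2)
        = ν ^ 2 * ((2 * π) ^ 3 * (t ^ 2 * supDeriv 3 g ^ 2)) := by ring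
      _ ≤ _ := by gcongr
  have hsq : ∑ j, homSobolevSq p (fun x => (uNS lam ν g F t - uE lam f g t) x j) ≤
      ENNReal.ofReal (ν ^ (1 / 2 * θ) * rateConst lam p T W N) := by
    simp only [uNS_sub_uE]
    rw [Fin.sum_univ_three]
    have h2 : (2 : ℝ≥0∞) = ENNReal.ofReal 2 := by simp
    calc _ = homSobolevSq p (fun x => F t (proj lam x) - eulerProfile f g t (proj lam x)) +
          homSobolevSq p (fun x => -(lam : ℝ) * (F t (proj lam x) -
            eulerProfile f g t (proj lam x)) - (heat (ν * t) g (x 2) - g (x 2))) := by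
          simp [homSobolevSq_zero_fun]
      _ ≤ _ := sum_homSobolevSq_le lam hD hH hp
      _ ≤ ENNReal.ofReal c * (ENNReal.ofReal (ν ^ (1 / 2 * θ) * A) * ENNReal.ofReal (N ^ 2)) +
          2 * ENNReal.ofReal (ν ^ (1 / 2 * θ) * ((2 * π) ^ 3 * (T ^ 2 * W ^ 2))) := by
          gcongr
      _ = _ := by
          rw [h2, ← ENNReal.ofReal_mul (by positivity), ← ENNReal.ofReal_mul (by positivity),
            ← ENNReal.ofReal_mul (by positivity),
            ← ENNReal.ofReal_add (by positivity) (by positivity), rateConst]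
          congr 1
          ring
  -- The square root turns the exponent θ/2 of the squared norm into θ/4.
  refine (ENNReal.rpow_le_rpow hsq (by norm_num)).trans (le_of_eq ?_)
  rw [ENNReal.ofReal_rpow_of_nonneg (by positivity) (by norm_num),
    Real.mul_rpow (by positivity) hR0, ← Real.rpow_mul hν.le, ← Real.sqrt_eq_rpow]
  congr 3
  ring

/-- The Navier-Stokes shear flows converge to the Euler shear flow. -/
theorem tendsto_iSup_eLpNorm_sub {F : ℝ → ℝ → Torus 2 → ℝ}
    (hF : ∀ ν : ℝ, 0 < ν → IsProfile lam ν f g (F ν)) (hg : SmoothCirc g) {l : ℝ} (hl : 1 / 2 ≤ l)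
    (hl1 : l < 1) (hf : MemSobolev l f) (T : ℝ) :
    Tendsto (fun ν : ℝ => ⨆ t ∈ Icc (0 : ℝ) T,
      eLpNorm (uNS lam ν g (F ν) t - uE lam f g t) 2 volume) (𝓝[>] 0) (𝓝 0) := by
  set R := √(rateConst lam 0 T (wInfNorm 3 g) (sobolevNorm l f).toReal)
  -- The L² case is p = 0 of the rate, so the bound is ν^{1/4} uniformly on [0, T].
  have h1 : Tendsto (fun ν : ℝ => ENNReal.ofReal (ν ^ ((1 / 4 : ℝ) * (1 - 0 / l)) * R))
      (𝓝[>] 0) (𝓝 0) := by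
    have hc : Continuous fun ν : ℝ => ENNReal.ofReal (ν ^ ((1 / 4 : ℝ) * (1 - 0 / l)) * R) :=
      ENNReal.continuous_ofReal.comp
        ((Real.continuous_rpow_const (by norm_num)).mul continuous_const)
    have h0 : ENNReal.ofReal ((0 : ℝ) ^ ((1 / 4 : ℝ) * (1 - 0 / l)) * R) = 0 := by
      rw [Real.zero_rpow (by norm_num), zero_mul, ENNReal.ofReal_zero]
    exact h0 ▸ (hc.tendsto 0).mono_left nhdsWithin_le_nhds
  refine tendsto_of_tendsto_of_tendsto_of_le_of_le' tendsto_const_nhds h1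
    (Eventually.of_forall fun _ => zero_le) ?_
  filter_upwards [Ioo_mem_nhdsGT (zero_lt_one' ℝ)] with ν hν
  have hP := hF ν hν.1
  refine iSup₂_le fun t ht => ?_
  rw [eLpNorm_eq_homSobolevNormVec]
  · exact hP.homSobolevNormVec_sub_le hg hν.1 hν.2 hl hl1 hf le_rfl (by linarith) ht
  · intro j
    have h2 := ((hP.contInL2_uNS hg hν.1.le).1 t ht.1).sub
      ((contInL2_uE (lam := lam) hf.1 hg.continuous univ).1 t trivial)
    exact h2.eval_piLp j

end Flows

end ShearFlow

theorem mainTheorem5 (lam : ℤ) (l : ℝ) (hl0 : 0 < l) (hl1 : l < 5 / 6) :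
    -- the viscous dissipation, with a constant that depends on `lam, l, t, ‖g'‖_∞, ‖f‖_{H^l}`
    (∃ C : ℝ → ℝ → ℝ → ℝ,
      ∀ (f : ShearFlow.Torus 2 → ℝ) (g : ShearFlow.Circ → ℝ),
        ShearFlow.MemSobolev l f → ShearFlow.SmoothCirc g →
      ∀ (ν : ℝ), 0 < ν → ν < 1 →
      ∀ (F : ℝ → ShearFlow.Torus 2 → ℝ), ShearFlow.IsProfile lam ν f g F →
      ∀ (t : ℝ), 0 ≤ t →
        ENNReal.ofReal ν * ∫⁻ s in Ioc 0 t, ShearFlow.gradSqVec (ShearFlow.uNS lam ν g F s)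
          ≤ ENNReal.ofReal
              (ν ^ l * C t (ShearFlow.supDeriv 1 g) (ShearFlow.sobolevNorm l f).toReal)) ∧
    (1 / 2 ≤ l →
      -- convergence in `C([0,T]; L²)` as `ν → 0`
      (∀ (f : ShearFlow.Torus 2 → ℝ) (g : ShearFlow.Circ → ℝ),
          ShearFlow.MemSobolev l f → ShearFlow.SmoothCirc g →
        ∀ (F : ℝ → ℝ → ShearFlow.Torus 2 → ℝ),
          (∀ ν : ℝ, 0 < ν → ShearFlow.IsProfile lam ν f g (F ν)) →
        ∀ (T : ℝ), 0 < T →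
          (∀ ν : ℝ, 0 < ν → ShearFlow.ContInL2 (Icc 0 T) (ShearFlow.uNS lam ν g (F ν))) ∧
          ShearFlow.ContInL2 (Icc 0 T) (ShearFlow.uE lam f g) ∧
          Tendsto
            (fun ν : ℝ => ⨆ t ∈ Icc (0 : ℝ) T,
              eLpNorm (ShearFlow.uNS lam ν g (F ν) t - ShearFlow.uE lam f g t) 2 volume)
            (𝓝[>] 0) (𝓝 0)) ∧
      -- the rate, with a constant that depends on `lam, l, l', T, ‖g‖_{W^{3,∞}}, ‖f‖_{H^l}`
      (∀ (l' : ℝ), 0 ≤ l' → l' < l →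
        ∃ C : ℝ → ℝ → ℝ → ℝ,
          ∀ (f : ShearFlow.Torus 2 → ℝ) (g : ShearFlow.Circ → ℝ),
            ShearFlow.MemSobolev l f → ShearFlow.SmoothCirc g →
          ∀ (ν : ℝ), 0 < ν → ν < 1 →
          ∀ (F : ℝ → ShearFlow.Torus 2 → ℝ), ShearFlow.IsProfile lam ν f g F →
          ∀ (T : ℝ), 0 < T →
            (⨆ t ∈ Icc (0 : ℝ) T,
              ShearFlow.homSobolevNormVec l'
                (ShearFlow.uNS lam ν g F t - ShearFlow.uE lam f g t))
            ≤ ENNReal.ofReal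
                (ν ^ ((1 / 4 : ℝ) * (1 - l' / l)) *
                  C T (ShearFlow.wInfNorm 3 g) (ShearFlow.sobolevNorm l f).toReal))) := by
  have h1 : l < 1 := by linarith
  refine ⟨⟨fun t Γ N => (2 * π) ^ 3 * ((lam : ℝ) ^ 2 + 1) * (1 + 2 * (lam : ℝ) ^ 2) *
      ((t + 1) * Real.exp (Γ * t) * N ^ 2) + 2 * ((2 * π) ^ 3 * Γ ^ 2 * t),
    fun f g hf hg ν hν hν1 F hF t ht => hF.viscous_dissipation_le hg hν hν1 hl0 h1 hf ht⟩,
    fun hl => ⟨fun f g hf hg F hF T _ => ⟨fun ν hν => ?_, ?_, ?_⟩, fun p hp hpl =>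
      ⟨fun T W N => √(ShearFlow.rateConst lam p T W N), fun f g hf hg ν hν hν1 F hF T _ => ?_⟩⟩⟩
  · exact ((hF ν hν).contInL2_uNS hg hν.le).mono Icc_subset_Ici_self
  · exact ShearFlow.contInL2_uE hf.1 hg.continuous _
  · exact ShearFlow.tendsto_iSup_eLpNorm_sub hF hg hl h1 hf T
  · exact iSup₂_le fun t ht => hF.homSobolevNormVec_sub_le hg hν hν1 hl h1 hf hp hpl ht
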